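/- **Setting.** Let $d\in\mathbb N$; all functions are real-valued. For $i=1,\dots,d$ let $X_i=(\sigma_i,\Sigma_i)$ with $-\infty\le\sigma_i<\Sigma_i\le\infty$, and let $w_i,p_i,q_i\in C^\infty(X_i)$ with $w_i>0$ and $p_i\ne0$ on $X_i$, and $a_i\ge0$. Put $d\mu_i=w_i\,dx_i$, $X=X_1\times\dots\times X_d$, $\mu=\mu_1\otimes\dots\otimes\mu_d$, $\|\cdot\|_s=\|\cdot\|_{L^s(X,\mu)}$ (for vector-valued functions, the $L^s$ norm of the pointwise Euclidean norm), $\langle\cdot,\cdot\rangle=\langle\cdot,\cdot\rangle_{L^2(X,\mu)}$. Let $$d_i=p_i\partial_{x_i},\quad \delta_i=p_i\partial_{x_i}+q_i,\quad \delta_i^*f=-\tfrac1{w_i}\partial_{x_i}(p_iw_if)+q_if,\quad L_i=\delta_i^*\delta_i+a_i,$$ $$v_i=p_i\Big(2q_i'-\big(p_i\tfrac{w_i'}{w_i}\big)'-p_i''\Big)=[\delta_i,\delta_i^*],\qquad r(x)=\sum_{i=1}^d\Big(a_i+q_i^2-p_iq_i'-p_i'q_i-p_iq_i\tfrac{w_i'}{w_i}\Big)(x_i).$$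 For each $i$ let $\{\varphi^i_k\}_{k\in\mathbb N}$ be an orthonormal basis of $L^2(X_i,\mu_i)$ consisting of (classical) eigenfunctions, $L_i\varphi^i_k=\lambda^i_k\varphi^i_k$ on $X_i$, where $0\le\lambda^i_0<\lambda^i_1<\cdots$ and $\lambda^i_k\to\infty$. For $k\in\mathbb N^d$ let $\varphi_k=\varphi^1_{k_1}\otimes\dots\otimes\varphi^d_{k_d}$, $\lambda_k=\lambda^1_{k_1}+\dots+\lambda^d_{k_d}$, and let $\mathcal D=\mathrm{lin}\{\varphi_k:k\in\mathbb N^d\}$, $\mathcal D_i=\mathrm{lin}\{\delta_i\varphi_k:k\in\mathbb N^d\}$. Assume: * (A1) $v_i\ge0$ on $X_i$ for all $i$; * (A2) there is $K\ge0$ with $\sum_{i=1}^dq_i(x_i)^2\le K\,r(x)$ for all $x\in X$; * (T1) $\langle\delta_i\varphi^i_k,\delta_i\varphi^i_m\rangle_{L^2(X_i,\mu_i)}=\langle\delta_i^*\delta_i\varphi^i_k,\varphi^i_m\rangle_{L^2(X_i,\mu_i)}$ for all $i$ and all $k,m\in\mathbb N$; * (T2) for all $i$, $k\in\mathbb N$,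 $s_1,s_2>0$, $z\in\{\sigma_i,\Sigma_i\}$, and for both $h=\varphi^i_k$ and $h=\delta_i\varphi^i_k$, $\ \lim_{x\to z}\big[(1+|\varphi^i_k|^{s_1}+|\delta_i\varphi^i_k|^{s_2})\,p_i^2w_ih'\big](x)=0$; * (T3) $\mathcal D$ and $\mathcal D_1,\dots,\mathcal D_d$ are dense subspaces of $L^s(X,\mu)$ for every $1\le s<\infty$. Let $\Lambda_0=\lambda_0^1+\dots+\lambda_0^d$, and let $\mathbb N^d_\Lambda=\mathbb N^d$ if $\Lambda_0>0$, $\mathbb N^d_\Lambda=\mathbb N^d\setminus\{0\}$ if $\Lambda_0=0$. Let $c^i_k=\|\delta_i\varphi_k\|_2^{-1}$ if $\delta_i\varphi_k\neq0$ and $c_k^i=0$ otherwise, and define $$\Pi f=\sum_{k\in\mathbb N^d_\Lambda}\langle f,\varphi_k\rangle\varphi_k,\quad P_tf=\sum_{k\in\mathbb N^d}e^{-t\lambda_k^{1/2}}\langle f,\varphi_k\rangle\varphi_k,\quad Q^i_tg=\sum_{k\in\mathbb N^d}e^{-t\lambda_k^{1/2}}\langle g,c^i_k\delta_i\varphi_k\rangle\,c^i_k\delta_i\varphi_k$$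 (finite sums when $f\in\mathcal D$, $g\in\mathcal D_i$). For $F=(F_1,\dots,F_N):X\times(0,\infty)\to\mathbb R^N$ write $$|F|_*^2=r|F|^2+|\partial_tF|^2+\sum_{i=1}^d|d_iF|^2,$$ with Euclidean norms on $\mathbb R^N$ on the right. **Theorem.** Let $1<p<\infty$, $\frac1p+\frac1q=1$ and $p^*=\max\big(p,\frac p{p-1}\big)$. Let $f\in\mathcal D$ and $\mathbf g=(g_1,\dots,g_d)$ with $g_i\in\mathcal D_i$ for $i=1,\dots,d$. Put $F(x,t)=P_t\Pi f(x)$ and $G(x,t)=(Q^1_tg_1(x),\dots,Q^d_tg_d(x))$. Then $$\int_0^\infty\int_X|F(x,t)|_*\,|G(x,t)|_*\,d\mu(x)\,t\,dt\le6\,(p^*-1)\,\|\Pi f\|_p\,\|\mathbf g\|_q .$$ -/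

import Mathlib

open MeasureTheory Filter Topology
open scoped ENNReal ContDiff

noncomputable section

/-- The data of a product orthogonal expansion in dimension `d`. For each coordinate `i`:
the endpoints of the open interval `X_i`, the weight `w_i`, the coefficients `p_i` (`pc`) and
`q_i` (`qc`) of the operator `δ_i = p_i ∂ + q_i`, the constant `a_i`, the eigenfunctions `φ^i_k`
and the eigenvalues `λ^i_k` (`ev`). Functions on `X_i` are represented by functions on `ℝ`; their
values outside `X_i` play no role. The laws these data satisfy are in `Standing`, `A1`, `A2`,
`T1`, `T2`, `T3` below. -/
structure OrthExpansion (d : ℕ) where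
  lo : Fin d → EReal
  hi : Fin d → EReal
  w : Fin d → ℝ → ℝ
  pc : Fin d → ℝ → ℝ
  qc : Fin d → ℝ → ℝ
  a : Fin d → ℝ
  phi1 : Fin d → ℕ → ℝ → ℝ
  ev : Fin d → ℕ → ℝ

namespace OrthExpansion

variable {d : ℕ} (S : OrthExpansion d)

/-! ### One coordinate -/

/-- The open interval `X_i` (possibly a half-line or the line). -/
def X1 (i : Fin d) : Set ℝ := {x : ℝ | S.lo i < (x : EReal) ∧ (x : EReal) < S.hi i}

/-- The measure `dμ_i = w_i dx` on `X_i`. -/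
def mu1 (i : Fin d) : Measure ℝ :=
  (volume.restrict (S.X1 i)).withDensity (fun x => ENNReal.ofReal (S.w i x))

/-- `δ_i f = p_i f' + q_i f`, for functions of one variable. -/
def delta1 (i : Fin d) (f : ℝ → ℝ) (x : ℝ) : ℝ := S.pc i x * deriv f x + S.qc i x * f x

/-- The formal adjoint `δ_i^* f = -(1/w_i) (p_i w_i f)' + q_i f`, for functions of one variable. -/
def delta1Adj (i : Fin d) (f : ℝ → ℝ) (x : ℝ) : ℝ :=
  -(1 / S.w i x) * deriv (fun y => S.pc i y * S.w i y * f y) x + S.qc i x * f x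

/-- `L_i = δ_i^* δ_i + a_i`, for functions of one variable. -/
def L1 (i : Fin d) (f : ℝ → ℝ) (x : ℝ) : ℝ :=
  S.delta1Adj i (S.delta1 i f) x + S.a i * f x

/-- The commutator `v_i = [δ_i, δ_i^*] = p_i (2 q_i' - (p_i w_i'/w_i)' - p_i'')`, a function. -/
def v (i : Fin d) (x : ℝ) : ℝ :=
  S.pc i x * (2 * deriv (S.qc i) x
    - deriv (fun y => S.pc i y * (deriv (S.w i) y / S.w i y)) x
    - deriv (deriv (S.pc i)) x)

/-- The potential `r_i = a_i + q_i² - p_i q_i' - p_i' q_i - p_i q_i w_i'/w_i` of `L_i`. -/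
def r1 (i : Fin d) (x : ℝ) : ℝ :=
  S.a i + ((S.qc i x) ^ 2 - S.pc i x * deriv (S.qc i) x - deriv (S.pc i) x * S.qc i x
    - S.pc i x * S.qc i x * (deriv (S.w i) x / S.w i x))

/-- The filter of points of `X_i` tending to the left endpoint. -/
def toLo (i : Fin d) : Filter ℝ := comap (fun x : ℝ => (x : EReal)) (𝓝[>] (S.lo i))

/-- The filter of points of `X_i` tending to the right endpoint. -/
def toHi (i : Fin d) : Filter ℝ := comap (fun x : ℝ => (x : EReal)) (𝓝[<] (S.hi i))

/-! ### The product space -/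

/-- `X = X_1 × ⋯ × X_d`. -/
def X : Set (Fin d → ℝ) := {x | ∀ i, x i ∈ S.X1 i}

/-- `μ = μ_1 ⊗ ⋯ ⊗ μ_d`. -/
def mu : Measure (Fin d → ℝ) := Measure.pi S.mu1

/-- The partial derivative `∂F/∂x_i`. -/
def partialX (i : Fin d) (F : (Fin d → ℝ) → ℝ) (x : Fin d → ℝ) : ℝ :=
  deriv (fun y => F (Function.update x i y)) (x i)

/-- `𝔡_i = p_i ∂_{x_i}`, the differential part of `δ_i`. -/
def dOp (i : Fin d) (F : (Fin d → ℝ) → ℝ) (x : Fin d → ℝ) : ℝ :=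
  S.pc i (x i) * partialX i F x

/-- `δ_i = p_i ∂_{x_i} + q_i`. -/
def delta (i : Fin d) (F : (Fin d → ℝ) → ℝ) (x : Fin d → ℝ) : ℝ :=
  S.dOp i F x + S.qc i (x i) * F x

/-- The potential `r = ∑ r_i` of `L = ∑ L_i`. -/
def r (x : Fin d → ℝ) : ℝ := ∑ i, S.r1 i (x i)

/-- `φ_k = φ^1_{k_1} ⊗ ⋯ ⊗ φ^d_{k_d}`. -/
def phi (k : Fin d → ℕ) (x : Fin d → ℝ) : ℝ := ∏ i, S.phi1 i (k i) (x i)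

/-- `λ_k = λ^1_{k_1} + ⋯ + λ^d_{k_d}`. -/
def eigenvalue (k : Fin d → ℕ) : ℝ := ∑ i, S.ev i (k i)

/-- `𝒟 = lin {φ_k}`. -/
def D : Submodule ℝ ((Fin d → ℝ) → ℝ) := Submodule.span ℝ (Set.range S.phi)

/-- `𝒟_i = lin {δ_i φ_k}`. -/
def Di (i : Fin d) : Submodule ℝ ((Fin d → ℝ) → ℝ) :=
  Submodule.span ℝ (Set.range fun k => S.delta i (S.phi k))

/-! ### Assumptions -/

/-- The standing assumptions: `X_i` is a nonempty open interval, the coefficients are smooth on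
it, `w_i > 0`, `p_i ≠ 0`, `a_i ≥ 0`, and the `φ^i_k` are (classical) eigenfunctions of `L_i`
forming an orthonormal basis of `L²(X_i, μ_i)`, with nonnegative eigenvalues increasing strictly
to infinity. -/
structure Standing : Prop where
  lo_lt_hi : ∀ i, S.lo i < S.hi i
  w_smooth : ∀ i, ContDiffOn ℝ ∞ (S.w i) (S.X1 i)
  w_pos : ∀ i, ∀ x ∈ S.X1 i, 0 < S.w i x
  pc_smooth : ∀ i, ContDiffOn ℝ ∞ (S.pc i) (S.X1 i)
  pc_ne_zero : ∀ i, ∀ x ∈ S.X1 i, S.pc i x ≠ 0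
  qc_smooth : ∀ i, ContDiffOn ℝ ∞ (S.qc i) (S.X1 i)
  a_nonneg : ∀ i, 0 ≤ S.a i
  phi_contDiff : ∀ i k, ContDiffOn ℝ 2 (S.phi1 i k) (S.X1 i)
  phi_eigen : ∀ i k, ∀ x ∈ S.X1 i, S.L1 i (S.phi1 i k) x = S.ev i k * S.phi1 i k x
  phi_basis : ∀ i, ∃ b : HilbertBasis ℕ ℝ (Lp ℝ 2 (S.mu1 i)),
    ∀ k, (b k : ℝ → ℝ) =ᵐ[S.mu1 i] S.phi1 i k
  ev_nonneg : ∀ i k, 0 ≤ S.ev i k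
  ev_strictMono : ∀ i, StrictMono (S.ev i)
  ev_tendsto : ∀ i, Tendsto (S.ev i) atTop atTop

/-- The commutators `v_i` are nonnegative. -/
def A1 : Prop := ∀ i, ∀ x ∈ S.X1 i, 0 ≤ S.v i x

/-- `∑ q_i² ≤ K r` on `X` for some constant `K ≥ 0`. -/
def A2 : Prop := ∃ K : ℝ, 0 ≤ K ∧ ∀ x ∈ S.X, ∑ i, (S.qc i (x i)) ^ 2 ≤ K * S.r x

/-- `⟨δ_i φ^i_k, δ_i φ^i_m⟩ = ⟨δ_i^* δ_i φ^i_k, φ^i_m⟩` in `L²(X_i, μ_i)`. -/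
def T1 : Prop := ∀ i k m,
  ∫ x, S.delta1 i (S.phi1 i k) x * S.delta1 i (S.phi1 i m) x ∂(S.mu1 i) =
    ∫ x, S.delta1Adj i (S.delta1 i (S.phi1 i k)) x * S.phi1 i m x ∂(S.mu1 i)

/-- The boundary conditions: with `h = φ^i_k` or `h = δ_i φ^i_k`, the quantity
`(1 + |φ^i_k|^{s₁} + |δ_i φ^i_k|^{s₂}) p_i² w_i h'` tends to `0` at both endpoints of `X_i`. -/
def T2 : Prop := ∀ i k, ∀ s₁ s₂ : ℝ, 0 < s₁ → 0 < s₂ →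
  ∀ l ∈ ({S.toLo i, S.toHi i} : Set (Filter ℝ)),
  Tendsto (fun x => (1 + |S.phi1 i k x| ^ s₁ + |S.delta1 i (S.phi1 i k) x| ^ s₂) *
    ((S.pc i x) ^ 2 * S.w i x * deriv (S.phi1 i k) x)) l (𝓝 0) ∧
  Tendsto (fun x => (1 + |S.phi1 i k x| ^ s₁ + |S.delta1 i (S.phi1 i k) x| ^ s₂) *
    ((S.pc i x) ^ 2 * S.w i x * deriv (S.delta1 i (S.phi1 i k)) x)) l (𝓝 0)

/-- `V` consists of functions in `L^s(μ)` and is dense there. -/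
def DenseInLp (μ : Measure (Fin d → ℝ)) (V : Submodule ℝ ((Fin d → ℝ) → ℝ)) (s : ℝ≥0∞) : Prop :=
  (∀ F ∈ V, MemLp F s μ) ∧
    ∀ h : (Fin d → ℝ) → ℝ, MemLp h s μ → ∀ ε : ℝ≥0∞, 0 < ε → ∃ F ∈ V, eLpNorm (h - F) s μ < ε

/-- `𝒟` and all `𝒟_i` are dense subspaces of `L^s`, `1 ≤ s < ∞`. -/
def T3 : Prop := ∀ s : ℝ≥0∞, 1 ≤ s → s ≠ ⊤ →
  DenseInLp S.mu S.D s ∧ ∀ i, DenseInLp S.mu (S.Di i) s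

/-! ### The projection and the semigroups

The series below are written pointwise. On `𝒟` (for `Π` and `P_t`) and on `𝒟_i` (for `Q_t^i`)
orthogonality leaves only finitely many nonzero terms, so there the sums are finite and give the
smooth representative. -/

/-- `Λ_0 = λ^1_0 + ⋯ + λ^d_0`, the smallest eigenvalue of `L`. -/
def Lam0 : ℝ := ∑ i, S.ev i 0

open Classical in
/-- `ℕ^d_Λ`: all of `ℕ^d` if `Λ_0 > 0`, and `ℕ^d ∖ {0}` if `Λ_0 = 0`. -/
def indexSet : Set (Fin d → ℕ) := if 0 < S.Lam0 then Set.univ else {0}ᶜ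

/-- `Π f = ∑_{k ∈ ℕ^d_Λ} ⟨f, φ_k⟩ φ_k`. -/
def proj (f : (Fin d → ℝ) → ℝ) (x : Fin d → ℝ) : ℝ :=
  ∑' k : S.indexSet, (∫ y, f y * S.phi k y ∂S.mu) * S.phi k x

/-- `P_t f = ∑_k e^{-t λ_k^{1/2}} ⟨f, φ_k⟩ φ_k`. -/
def P (t : ℝ) (f : (Fin d → ℝ) → ℝ) (x : Fin d → ℝ) : ℝ :=
  ∑' k : Fin d → ℕ, Real.exp (-t * √(S.eigenvalue k)) *
    (∫ y, f y * S.phi k y ∂S.mu) * S.phi k x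

/-- `c^i_k = ‖δ_i φ_k‖₂⁻¹`, and `c^i_k = 0` if `δ_i φ_k = 0` (by the convention `0⁻¹ = 0`). -/
def c (i : Fin d) (k : Fin d → ℕ) : ℝ := (eLpNorm (S.delta i (S.phi k)) 2 S.mu).toReal⁻¹

/-- `Q_t^i g = ∑_k e^{-t λ_k^{1/2}} ⟨g, c^i_k δ_i φ_k⟩ c^i_k δ_i φ_k`. -/
def Q (i : Fin d) (t : ℝ) (g : (Fin d → ℝ) → ℝ) (x : Fin d → ℝ) : ℝ :=
  ∑' k : Fin d → ℕ, Real.exp (-t * √(S.eigenvalue k)) *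
    (∫ y, g y * (S.c i k * S.delta i (S.phi k) y) ∂S.mu) * (S.c i k * S.delta i (S.phi k) x)

/-- For `F = (F_1, …, F_N) : X × (0,∞) → ℝ^N`, written `F n t x`, the quantity
`|F|_* = (r |F|² + |∂_t F|² + ∑_i |𝔡_i F|²)^{1/2}` at `(x, t)`. -/
def starNorm {N : ℕ} (F : Fin N → ℝ → (Fin d → ℝ) → ℝ) (x : Fin d → ℝ) (t : ℝ) : ℝ :=
  √(S.r x * ∑ n, (F n t x) ^ 2 + ∑ n, (deriv (fun τ => F n τ x) t) ^ 2
    + ∑ i, ∑ n, (S.dOp i (F n t) x) ^ 2)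

end OrthExpansion

end

/-!
The theorem is a bilinear embedding, proved with a Bellman function of Nazarov–Treil type. Put
`u = (F, G₁, …, G_d)`. Every component of `u` is a finite sum of products of eigenfunctions
`φ^j_k` and `δ_j φ^j_k`, multiplied by `e^{-t λ_k^{1/2}}`. The function `φ^j_k` is an eigenfunction
of `f ↦ -w_j⁻¹ (p_j² w_j f')' + r_j f`, and `δ_j φ^j_k` is one of the same operator with `r_j + v_j`
in place of `r_j` (`Standing.hasDerivAt_diffusion_mode1`). Hence `F` is annihilated by
`∂_t² + ∑ w_j⁻¹ ∂_j (p_j² w_j ∂_j ⬝) - r` and `G_i` by the same operator with the additional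
potential `v_i ≥ 0` (`sum_fieldL_add`).

For `p ≥ 2` the Bellman function is `b(|F|², |G|²)` with `b(X, Y) = Y^{q/2} + γ X S^{1-2/p}`,
`S = X^{p/2} + Y^{q/2}`, `γ = (q-1)/8`; for `p < 2` the roles of `F` and `G` are exchanged. This is
smooth away from `X Y = 0`, and shifting both arguments by `ε²` makes it smooth everywhere. Its
Hessian dominates `c (τ |dF|² + τ⁻¹ |dG|²)` for a weight `τ > 0`, where `4 c (p* - 1) = 1`
(`bellman_dissipation`). By the arithmetic-geometric mean inequality,
`2 c |F|_* |G|_* ≤ (∂_t² + ∑ w_j⁻¹ ∂_j (p_j² w_j ∂_j ⬝)) b(u)` (`le_bTT_add_sum_bL`).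

This is integrated against `t dμ dt`. The time derivatives give at most `∫ b(u(0, x)) dμ`. The space
derivatives contribute nothing, by the boundary condition (T2). That condition bounds each
eigenfunction in terms of the same eigenfunction only, so products of different modes are not
controlled by it directly. Instead, the cutoff functions are affine in the scale function `E` of
the operator, `E' = 1/(p_j² w_j)`: the integral of `w_j⁻¹ (p_j² w_j β')'` against such a cutoff is
a difference quotient of `β` with respect to `E` near each of the end points
(`exists_coordinate_cutoff`), and (T2) makes these difference quotients arbitrarily small, uniformly
for all the modes that occur. The cutoffs in all the coordinates together form a product measure
below `μ`; the powers of the eigenfunctions in the remaining variables are integrable by (T3)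
(`memLp_mode1`, `exists_integral_bL_le`).

Letting the cutoffs tend to `1` yields `2 c ∫∫ |F|_* |G|_* t dt dμ ≤ ∫ b(u(0, x)) dμ`
(`lintegral_starNorm_mul_le`), and `ε → 0` bounds the right-hand side by
`9/8 (‖F(0)‖_p^p + ‖G(0)‖_q^q)`. By homogeneity this improves to a multiple of the product of the
norms, with constant `9/2 (p* - 1) ≤ 6 (p* - 1)`.
-/


/-! ### The Bellman function -/

theorem quadratic_form_nonneg {A B C x y : ℝ} (hA : 0 ≤ A) (hC : 0 ≤ C) (h : B ^ 2 ≤ 4 * A * C)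
    (hx : 0 ≤ x) (hy : 0 ≤ y) {m : ℝ} (hm : m ^ 2 = x * y) : 0 ≤ A * x + B * m + C * y := by
  have h1 : (B * m) ^ 2 ≤ (A * x + C * y) ^ 2 := by
    have : B ^ 2 * (x * y) ≤ 4 * A * C * (x * y) := by gcongr
    rw [mul_pow, hm]
    nlinarith [sq_nonneg (A * x - C * y)]
  have h2 := abs_le_of_sq_le_sq' h1 (by positivity)
  linarith [h2.1]

set_option maxHeartbeats 1000000 in
/-- The Hessian estimate for the Bellman function, as an algebraic inequality. Here `x = |U|²`,
`y = |V|²`, `Z = S^{1 - 2/p}` with `S = x^{p/2} + y^{q/2}`, `N = y^{q/2 - 1}`, `κ = x Z / S` and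
`ν = y^{q/2} / S`. The second derivative in `x` is nonnegative and is dropped; the mixed derivative
is absorbed in the diagonal terms by its discriminant. -/
theorem bellman_hessian_bound {p q γ Z N κ ν x y a b u v : ℝ} (hp : 2 ≤ p) (hq1 : 1 < q)
    (hq2 : q ≤ 2) (hγ : γ = (q - 1) / 8) (hx : 0 < x) (hy : 0 < y) (hZ : 0 < Z) (hN : 0 < N)
    (hNZ : 1 ≤ N * Z) (hκ0 : 0 ≤ κ) (hκ1 : κ ≤ 1) (hν0 : 0 ≤ ν) (hν1 : ν ≤ 1)
    (hxZ : x * Z * ν = κ * N * y) (ha : a ^ 2 ≤ x * u) (hb : b ^ 2 ≤ y * v) :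
    γ * Z * u + (q - 1) / 2 * Z⁻¹ * v ≤
      2 * (γ * Z * (1 + (p - 2) / 2 * (1 - ν))) * u
      + 2 * (N * (q / 2 + γ * ((2 - q) / 2) * κ)) * v
      + 4 * (γ * (Z / x) * ((p - 2) / 2) * (1 - ν) * (1 + p / 2 - (1 - ν))) * a ^ 2
      + 8 * (γ * (Z / y) * ((2 - q) / 2) * ν ^ 2) * (a * b)
      + 4 * (N / y * ((2 - q) / 2) *
          (-(q / 2) - γ * ((2 - q) / 2) * κ - γ * (q - 1) * κ * ν)) * b ^ 2 := by
  have hγ0 : 0 < γ := by rw [hγ]; linarith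
  have hγ1 : γ ≤ 1 / 8 := by rw [hγ]; linarith
  have hq : 0 < q - 1 := by linarith
  have h2q : 0 ≤ 2 - q := by linarith
  have hZi : Z⁻¹ ≤ N := by rw [inv_le_iff_one_le_mul₀ hZ]; exact hNZ
  have hZi0 : 0 < Z⁻¹ := inv_pos.mpr hZ
  obtain ⟨A, hA⟩ : ∃ A, a ^ 2 = x * A := ⟨a ^ 2 / x, by field_simp⟩
  obtain ⟨B, hB⟩ : ∃ B, b ^ 2 = y * B := ⟨b ^ 2 / y, by field_simp⟩
  have hA0 : 0 ≤ A := by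
    by_contra! h
    nlinarith [sq_nonneg a, mul_pos hx (neg_pos.mpr h)]
  have hB0 : 0 ≤ B := by
    by_contra! h
    nlinarith [sq_nonneg b, mul_pos hy (neg_pos.mpr h)]
  have hAu : A ≤ u := by rw [hA] at ha; exact le_of_mul_le_mul_left ha hx
  have hBv : B ≤ v := by rw [hB] at hb; exact le_of_mul_le_mul_left hb hy
  have hγκ : γ * (2 - q) * κ ≤ γ * (2 - q) := by
    have : 0 ≤ γ * (2 - q) := by positivity
    nlinarith
  have hγκ0 : 0 ≤ γ * (2 - q) * κ := by positivity
  obtain ⟨W, hW⟩ : ∃ W, W = N * ((q - 1) * (q + γ * (2 - q) * κ * (1 - 2 * ν))) - (q - 1) / 2 * Z⁻¹ := ⟨_, rfl⟩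
  have hWlow : N * ((q - 1) * (q - 1 / 2 - γ * (2 - q))) ≤ W := by
    have h1 : -(γ * (2 - q)) ≤ γ * (2 - q) * κ * (1 - 2 * ν) := by
      have : 0 ≤ γ * (2 - q) * κ * (1 - ν) := mul_nonneg hγκ0 (by linarith)
      linarith
    have h2 : N * ((q - 1) * (q - γ * (2 - q))) ≤
        N * ((q - 1) * (q + γ * (2 - q) * κ * (1 - 2 * ν))) := by
      gcongr; linarith
    have h3 : (q - 1) / 2 * Z⁻¹ ≤ (q - 1) / 2 * N := by gcongr
    have h4 : N * ((q - 1) * (q - 1 / 2 - γ * (2 - q))) =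
        N * ((q - 1) * (q - γ * (2 - q))) - (q - 1) / 2 * N := by ring
    rw [hW]; linarith
  have hkey : 4 * γ * (2 - q) ^ 2 ≤ (q - 1) * (q - 1 / 2 - γ * (2 - q)) := by
    rw [hγ]
    have : 0 ≤ (q - 1) * ((q - 1) * (6 - q)) := by
      have : 0 < 6 - q := by linarith
      positivity
    nlinarith
  have hW0 : 0 ≤ W := le_trans (by
    have : 0 ≤ 4 * γ * (2 - q) ^ 2 := by positivity
    exact mul_nonneg hN.le (this.trans hkey)) hWlow
  -- the mixed derivative is controlled by the remaining parts of the diagonal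
  have hdisc : (8 * (γ * (Z / y) * ((2 - q) / 2) * ν ^ 2)) ^ 2 * (x * y) ≤ 4 * (γ * Z) * W := by
    have e : (8 * (γ * (Z / y) * ((2 - q) / 2) * ν ^ 2)) ^ 2 * (x * y)
        = 16 * γ ^ 2 * (2 - q) ^ 2 * Z * ν ^ 3 * (x * Z * ν / y) := by
      field_simp; ring
    rw [e, hxZ]
    have e2 : κ * N * y / y = κ * N := by field_simp
    rw [e2]
    have h3 : ν ^ 3 * κ ≤ 1 := by
      have : ν ^ 3 ≤ 1 := pow_le_one₀ hν0 hν1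
      have : 0 ≤ ν ^ 3 := by positivity
      nlinarith
    calc 16 * γ ^ 2 * (2 - q) ^ 2 * Z * ν ^ 3 * (κ * N)
        = 16 * γ ^ 2 * (2 - q) ^ 2 * Z * N * (ν ^ 3 * κ) := by ring
      _ ≤ 16 * γ ^ 2 * (2 - q) ^ 2 * Z * N * 1 := by gcongr
      _ = 4 * (γ * Z) * (N * (4 * γ * (2 - q) ^ 2)) := by ring
      _ ≤ 4 * (γ * Z) * (N * ((q - 1) * (q - 1 / 2 - γ * (2 - q)))) := by gcongr
      _ ≤ 4 * (γ * Z) * W := by gcongr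
  have hquad' : 0 ≤ γ * Z * A + 8 * (γ * (Z / y) * ((2 - q) / 2) * ν ^ 2) * (a * b) + W * B := by
    have hm : (√(x * y)⁻¹ * (a * b)) ^ 2 = A * B := by
      rw [mul_pow, Real.sq_sqrt (by positivity), mul_pow, hA, hB]; field_simp
    have := quadratic_form_nonneg (A := γ * Z)
      (B := 8 * (γ * (Z / y) * ((2 - q) / 2) * ν ^ 2) * √(x * y)) (C := W) (x := A) (y := B)
      (by positivity) hW0 (by rw [mul_pow, Real.sq_sqrt (by positivity)]; exact hdisc) hA0 hB0 hm
    have e : √(x * y) * (√(x * y)⁻¹ * (a * b)) = a * b := by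
      rw [← mul_assoc, ← Real.sqrt_mul (by positivity), mul_inv_cancel₀ (by positivity),
        Real.sqrt_one, one_mul]
    rw [mul_assoc (8 * _) (√(x * y)), e] at this
    exact this
  have hcv : 0 ≤ N * (q + γ * (2 - q) * κ) - (q - 1) / 2 * Z⁻¹ := by
    have : (q - 1) / 2 * Z⁻¹ ≤ (q - 1) / 2 * N := by gcongr
    nlinarith [mul_nonneg hN.le hγκ0]
  have hv : (N * (q + γ * (2 - q) * κ) - (q - 1) / 2 * Z⁻¹) * B ≤
      (N * (q + γ * (2 - q) * κ) - (q - 1) / 2 * Z⁻¹) * v := by gcongr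
  have hu : γ * Z * A ≤ γ * Z * u := by gcongr
  have hu0 : 0 ≤ u := hA0.trans hAu
  have hμu : 0 ≤ γ * Z * ((p - 2) * (1 - ν)) * u := by
    have : 0 ≤ p - 2 := by linarith
    have : 0 ≤ 1 - ν := by linarith
    positivity
  have haa : 0 ≤ 4 * (γ * (Z / x) * ((p - 2) / 2) * (1 - ν) * (1 + p / 2 - (1 - ν))) * a ^ 2 := by
    have : 0 ≤ p - 2 := by linarith
    have : 0 ≤ 1 - ν := by linarith
    have : 0 ≤ 1 + p / 2 - (1 - ν) := by linarith
    positivity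
  have hbb : 4 * (N / y * ((2 - q) / 2) *
          (-(q / 2) - γ * ((2 - q) / 2) * κ - γ * (q - 1) * κ * ν)) * b ^ 2
      = (W - (N * (q + γ * (2 - q) * κ) - (q - 1) / 2 * Z⁻¹)) * B := by
    rw [hB, hW]; field_simp; ring
  rw [hbb]
  linarith

/-- `|U|^p + |V|^q` in terms of `x = |U|²`, `y = |V|²`. -/
noncomputable def powSum (p q x y : ℝ) : ℝ := x ^ (p / 2) + y ^ (q / 2)

/-- `(|U|^p + |V|^q)^{1 - 2/p}`, in terms of `x = |U|²` and `y = |V|²`; it is the weight that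
balances the two sides of the convexity estimate. -/
noncomputable def balance (p q x y : ℝ) : ℝ := powSum p q x y ^ (1 - 2 / p)

/-- The homogeneous Bellman function `|V|^q + γ |U|² (|U|^p + |V|^q)^{1 - 2/p}`,
`γ = (q - 1) / 8`, for `p ≥ 2`, in terms of `x = |U|²` and `y = |V|²`. -/
noncomputable def bellman (p q x y : ℝ) : ℝ :=
  y ^ (q / 2) + (q - 1) / 8 * (x * balance p q x y)

/-- The partial derivative of `bellman` in `x`. -/
noncomputable def bellmanX (p q x y : ℝ) : ℝ :=
  (q - 1) / 8 * balance p q x y * (1 + (p - 2) / 2 * (1 - y ^ (q / 2) / powSum p q x y))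

/-- The partial derivative of `bellman` in `y`. -/
noncomputable def bellmanY (p q x y : ℝ) : ℝ :=
  y ^ (q / 2) / y *
    (q / 2 + (q - 1) / 8 * ((2 - q) / 2) * (x * balance p q x y / powSum p q x y))

/-- The second partial derivative of `bellman` in `x`. -/
noncomputable def bellmanXX (p q x y : ℝ) : ℝ :=
  (q - 1) / 8 * (balance p q x y / x) * ((p - 2) / 2) * (1 - y ^ (q / 2) / powSum p q x y) *
    (1 + p / 2 - (1 - y ^ (q / 2) / powSum p q x y))

/-- The mixed second partial derivative of `bellman`. -/
noncomputable def bellmanXY (p q x y : ℝ) : ℝ :=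
  (q - 1) / 8 * (balance p q x y / y) * ((2 - q) / 2) * (y ^ (q / 2) / powSum p q x y) ^ 2

/-- The second partial derivative of `bellman` in `y`. -/
noncomputable def bellmanYY (p q x y : ℝ) : ℝ :=
  y ^ (q / 2) / y / y * ((2 - q) / 2) *
    (-(q / 2) - (q - 1) / 8 * ((2 - q) / 2) * (x * balance p q x y / powSum p q x y)
      - (q - 1) / 8 * (q - 1) * (x * balance p q x y / powSum p q x y)
        * (y ^ (q / 2) / powSum p q x y))

section Bellman

variable {p q x y : ℝ}

theorem powSum_pos (hx : 0 < x) (hy : 0 < y) : 0 < powSum p q x y := by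
  unfold powSum; positivity

theorem balance_pos (hx : 0 < x) (hy : 0 < y) : 0 < balance p q x y :=
  Real.rpow_pos_of_pos (powSum_pos hx hy) _

theorem mul_balance_le (hp : 2 ≤ p) (hx : 0 ≤ x) (hy : 0 ≤ y) :
    x * balance p q x y ≤ powSum p q x y := by
  have h0 : 0 ≤ powSum p q x y := by unfold powSum; positivity
  rcases hx.eq_or_lt with rfl | hx
  · simpa using h0
  have hS : 0 < powSum p q x y := by unfold powSum; positivity
  have h1 : x ≤ powSum p q x y ^ (2 / p) := by
    calc x = (x ^ (p / 2)) ^ (2 / p) := by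
          rw [← Real.rpow_mul hx.le, div_mul_div_comm, mul_comm p 2, div_self (by positivity),
            Real.rpow_one]
      _ ≤ _ := by
          apply Real.rpow_le_rpow (by positivity) _ (by positivity)
          unfold powSum; linarith [Real.rpow_nonneg hy (q / 2)]
  calc x * balance p q x y ≤ powSum p q x y ^ (2 / p) * powSum p q x y ^ (1 - 2 / p) := by
        unfold balance; gcongr
    _ = powSum p q x y := by rw [← Real.rpow_add hS]; simp

theorem conj_identity (hpq : 1 / p + 1 / q = 1) (hp : 2 ≤ p) : p + q = p * q ∧ 1 < q ∧ q ≤ 2 := by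
  have hp0 : p ≠ 0 := by positivity
  have hq0 : q ≠ 0 := by
    rintro rfl
    simp at hpq; linarith
  have h1 : p + q = p * q := by field_simp at hpq; linarith
  have hq : q = 1 + q / p := by field_simp; linarith
  have : 0 < q := by
    by_contra! h
    nlinarith
  refine ⟨h1, ?_, ?_⟩
  · have : 0 < q / p := by positivity
    linarith
  · nlinarith

theorem one_le_mul_balance (hpq : 1 / p + 1 / q = 1) (hp : 2 ≤ p) (hx : 0 < x) (hy : 0 < y) :
    1 ≤ y ^ (q / 2) / y * balance p q x y := by
  obtain ⟨h1, h2, h3⟩ := conj_identity hpq hp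
  have e : y ^ (1 - q / 2) ≤ balance p q x y := by
    have : 1 - q / 2 = q / 2 * (1 - 2 / p) := by field_simp; linarith
    rw [this, Real.rpow_mul hy.le]
    apply Real.rpow_le_rpow (by positivity) _ (by
      have : 2 / p ≤ 1 := (div_le_one (by positivity)).2 hp
      linarith)
    unfold powSum; linarith [Real.rpow_pos_of_pos hx (p / 2)]
  calc 1 = y ^ (q / 2) / y * y ^ (1 - q / 2) := by
        rw [Real.rpow_sub hy, Real.rpow_one]; field_simp
    _ ≤ _ := by gcongr

/-- The Hessian of the Bellman function dominates the quadratic form with weights proportional to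
`S^{1 - 2/p}` and its inverse. Here `u`, `v` stand for `|dU|²`, `|dV|²` and `a`, `b` for `U ⬝ dU`,
`V ⬝ dV`. -/
theorem bellman_dissipation (hpq : 1 / p + 1 / q = 1) (hp : 2 ≤ p) (hx : 0 < x) (hy : 0 < y)
    {u v a b : ℝ} (ha : a ^ 2 ≤ x * u) (hb : b ^ 2 ≤ y * v) :
    (q - 1) / 8 * balance p q x y * u + (q - 1) / 2 * (balance p q x y)⁻¹ * v ≤
      2 * bellmanX p q x y * u + 2 * bellmanY p q x y * v + 4 * bellmanXX p q x y * a ^ 2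
      + 8 * bellmanXY p q x y * (a * b) + 4 * bellmanYY p q x y * b ^ 2 := by
  obtain ⟨h1, h2, h3⟩ := conj_identity hpq hp
  have hS := powSum_pos (p := p) (q := q) hx hy
  have hZ := balance_pos (p := p) (q := q) hx hy
  have hm := Real.rpow_pos_of_pos hx (p / 2)
  have hn := Real.rpow_pos_of_pos hy (q / 2)
  exact bellman_hessian_bound hp h2 h3 rfl hx hy hZ (by positivity)
    (one_le_mul_balance hpq hp hx hy) (by positivity)
    ((div_le_one hS).2 (mul_balance_le hp hx.le hy.le)) (by positivity)
    ((div_le_one hS).2 (by unfold powSum; linarith)) (by field_simp) ha hb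

theorem hasDerivAt_rpow_comp {f : ℝ → ℝ} {f' s : ℝ} (r : ℝ) (hf : HasDerivAt f f' s)
    (h : 0 < f s) : HasDerivAt (fun t => f t ^ r) (r * (f s ^ r / f s) * f') s := by
  have := hf.rpow_const (p := r) (Or.inl h.ne')
  convert this using 1
  rw [Real.rpow_sub_one h.ne']; ring

variable {f g : ℝ → ℝ} {f' g' s : ℝ}

theorem hasDerivAt_powSum (hf : HasDerivAt f f' s) (hg : HasDerivAt g g' s) (hx : 0 < f s)
    (hy : 0 < g s) : HasDerivAt (fun t => powSum p q (f t) (g t))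
      (p / 2 * (f s ^ (p / 2) / f s) * f' + q / 2 * (g s ^ (q / 2) / g s) * g') s :=
  (hasDerivAt_rpow_comp _ hf hx).add (hasDerivAt_rpow_comp _ hg hy)

theorem hasDerivAt_balance (hf : HasDerivAt f f' s) (hg : HasDerivAt g g' s) (hx : 0 < f s)
    (hy : 0 < g s) : HasDerivAt (fun t => balance p q (f t) (g t))
      ((1 - 2 / p) * (balance p q (f s) (g s) / powSum p q (f s) (g s)) *
        (p / 2 * (f s ^ (p / 2) / f s) * f' + q / 2 * (g s ^ (q / 2) / g s) * g')) s :=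
  hasDerivAt_rpow_comp (f := fun t => powSum p q (f t) (g t)) _ (hasDerivAt_powSum hf hg hx hy)
    (powSum_pos hx hy)

theorem hasDerivAt_bellman (hpq : 1 / p + 1 / q = 1) (hp : 2 ≤ p) (hf : HasDerivAt f f' s)
    (hg : HasDerivAt g g' s) (hx : 0 < f s) (hy : 0 < g s) :
    HasDerivAt (fun t => bellman p q (f t) (g t))
      (bellmanX p q (f s) (g s) * f' + bellmanY p q (f s) (g s) * g') s := by
  obtain ⟨h1, h2, h3⟩ := conj_identity hpq hp
  have hS := powSum_pos (p := p) (q := q) hx hy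
  refine ((hasDerivAt_rpow_comp (q / 2) hg hy).add
    ((hf.mul (hasDerivAt_balance (p := p) (q := q) hf hg hx hy)).const_mul
      ((q - 1) / 8))).congr_deriv ?_
  have hp0 : p ≠ 0 := by positivity
  have hm : f s ^ (p / 2) = powSum p q (f s) (g s) - g s ^ (q / 2) := by unfold powSum; ring
  have hq : 2 - q = q * (1 - 2 / p) := by field_simp; linarith
  unfold bellmanX bellmanY
  rw [hm, hq]
  generalize g s ^ (q / 2) = n
  generalize powSum p q (f s) (g s) = S at *
  generalize balance p q (f s) (g s) = Z
  field_simp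
  ring

theorem hasDerivAt_bellmanX (hpq : 1 / p + 1 / q = 1) (hp : 2 ≤ p) (hf : HasDerivAt f f' s)
    (hg : HasDerivAt g g' s) (hx : 0 < f s) (hy : 0 < g s) :
    HasDerivAt (fun t => bellmanX p q (f t) (g t))
      (bellmanXX p q (f s) (g s) * f' + bellmanXY p q (f s) (g s) * g') s := by
  obtain ⟨h1, h2, h3⟩ := conj_identity hpq hp
  have hS := powSum_pos (p := p) (q := q) hx hy
  refine (((hasDerivAt_balance (p := p) (q := q) hf hg hx hy).const_mul ((q - 1) / 8)).mul
    ((((hasDerivAt_rpow_comp (q / 2) hg hy).div (hasDerivAt_powSum (p := p) hf hg hx hy)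
      hS.ne').const_sub 1).const_mul ((p - 2) / 2) |>.const_add 1)).congr_deriv ?_
  have hp0 : p ≠ 0 := by positivity
  have hp1 : p - 1 ≠ 0 := by linarith
  have hm : f s ^ (p / 2) = powSum p q (f s) (g s) - g s ^ (q / 2) := by unfold powSum; ring
  have hq : q = p / (p - 1) := by field_simp; linarith
  unfold bellmanXX bellmanXY
  simp only [Pi.div_apply]
  rw [hm]
  generalize g s ^ (q / 2) = n
  generalize powSum p q (f s) (g s) = S at *
  generalize balance p q (f s) (g s) = Z
  rw [hq]
  field_simp
  ring

theorem hasDerivAt_bellmanY (hpq : 1 / p + 1 / q = 1) (hp : 2 ≤ p) (hf : HasDerivAt f f' s)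
    (hg : HasDerivAt g g' s) (hx : 0 < f s) (hy : 0 < g s) :
    HasDerivAt (fun t => bellmanY p q (f t) (g t))
      (bellmanXY p q (f s) (g s) * f' + bellmanYY p q (f s) (g s) * g') s := by
  obtain ⟨h1, h2, h3⟩ := conj_identity hpq hp
  have hS := powSum_pos (p := p) (q := q) hx hy
  refine (((hasDerivAt_rpow_comp (q / 2) hg hy).div hg hy.ne').mul
    ((((hf.mul (hasDerivAt_balance (p := p) (q := q) hf hg hx hy)).div
      (hasDerivAt_powSum (p := p) (q := q) hf hg hx hy) hS.ne').const_mul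
        ((q - 1) / 8 * ((2 - q) / 2))).const_add (q / 2))).congr_deriv ?_
  have hp0 : p ≠ 0 := by positivity
  have hp1 : p - 1 ≠ 0 := by linarith
  have hm : f s ^ (p / 2) = powSum p q (f s) (g s) - g s ^ (q / 2) := by unfold powSum; ring
  have hq : q = p / (p - 1) := by field_simp; linarith
  unfold bellmanXY bellmanYY
  simp only [Pi.div_apply, Pi.mul_apply]
  rw [hm]
  generalize g s ^ (q / 2) = n
  generalize powSum p q (f s) (g s) = S at *
  generalize balance p q (f s) (g s) = Z
  rw [hq]
  field_simp
  ring

end Bellman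

/-- A smooth function `b(|U|², |V|²)` with its partial derivatives `bX`, `bY`, `bXX`, `bXY`, `bYY`,
nonnegative together with its first derivatives, of polynomial growth, and whose Hessian in the
variables `(U, V)` dominates `c (τ |dU|² + τ⁻¹ |dV|²)` for some weight `τ > 0`. In `dissipation`,
`u`, `v` stand for `|dU|²`, `|dV|²` and `s`, `t` for `U ⬝ dU`, `V ⬝ dV`. -/
structure SmoothBellman (c : ℝ) where
  b : ℝ → ℝ → ℝ
  bX : ℝ → ℝ → ℝ
  bY : ℝ → ℝ → ℝ
  bXX : ℝ → ℝ → ℝ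
  bXY : ℝ → ℝ → ℝ
  bYY : ℝ → ℝ → ℝ
  τ : ℝ → ℝ → ℝ
  hasDerivAt_b : ∀ {f g : ℝ → ℝ} {f' g' s : ℝ}, HasDerivAt f f' s → HasDerivAt g g' s →
    0 ≤ f s → 0 ≤ g s →
    HasDerivAt (fun t => b (f t) (g t)) (bX (f s) (g s) * f' + bY (f s) (g s) * g') s
  hasDerivAt_bX : ∀ {f g : ℝ → ℝ} {f' g' s : ℝ}, HasDerivAt f f' s → HasDerivAt g g' s →
    0 ≤ f s → 0 ≤ g s →
    HasDerivAt (fun t => bX (f t) (g t)) (bXX (f s) (g s) * f' + bXY (f s) (g s) * g') s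
  hasDerivAt_bY : ∀ {f g : ℝ → ℝ} {f' g' s : ℝ}, HasDerivAt f f' s → HasDerivAt g g' s →
    0 ≤ f s → 0 ≤ g s →
    HasDerivAt (fun t => bY (f t) (g t)) (bXY (f s) (g s) * f' + bYY (f s) (g s) * g') s
  continuousOn_b : ContinuousOn (fun z : ℝ × ℝ => b z.1 z.2) (Set.Ici 0 ×ˢ Set.Ici 0)
  continuousOn_bX : ContinuousOn (fun z : ℝ × ℝ => bX z.1 z.2) (Set.Ici 0 ×ˢ Set.Ici 0)
  continuousOn_bY : ContinuousOn (fun z : ℝ × ℝ => bY z.1 z.2) (Set.Ici 0 ×ˢ Set.Ici 0)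
  continuousOn_bXX : ContinuousOn (fun z : ℝ × ℝ => bXX z.1 z.2) (Set.Ici 0 ×ˢ Set.Ici 0)
  continuousOn_bXY : ContinuousOn (fun z : ℝ × ℝ => bXY z.1 z.2) (Set.Ici 0 ×ˢ Set.Ici 0)
  continuousOn_bYY : ContinuousOn (fun z : ℝ × ℝ => bYY z.1 z.2) (Set.Ici 0 ×ˢ Set.Ici 0)
  b_zero : b 0 0 = 0
  bX_nonneg : ∀ {x y : ℝ}, 0 ≤ x → 0 ≤ y → 0 ≤ bX x y
  bY_nonneg : ∀ {x y : ℝ}, 0 ≤ x → 0 ≤ y → 0 ≤ bY x y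
  growth : ∃ C : ℝ, 0 ≤ C ∧ ∃ m : ℕ, ∀ {x y : ℝ}, 0 ≤ x → 0 ≤ y →
    bX x y ≤ C * (1 + x + y) ^ m ∧ bY x y ≤ C * (1 + x + y) ^ m
  τ_pos : ∀ {x y : ℝ}, 0 ≤ x → 0 ≤ y → 0 < τ x y
  dissipation : ∀ {x y u v s t : ℝ}, 0 ≤ x → 0 ≤ y → 0 ≤ u → 0 ≤ v →
    s ^ 2 ≤ x * u → t ^ 2 ≤ y * v →
    c * (τ x y * u + (τ x y)⁻¹ * v) ≤
      2 * bX x y * u + 2 * bY x y * v + 4 * bXX x y * s ^ 2 + 8 * bXY x y * (s * t)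
        + 4 * bYY x y * t ^ 2

namespace SmoothBellman

variable {c : ℝ} (B : SmoothBellman c)

/-- Exchange of the roles of `U` and `V`. -/
noncomputable def swap : SmoothBellman c where
  b x y := B.b y x
  bX x y := B.bY y x
  bY x y := B.bX y x
  bXX x y := B.bYY y x
  bXY x y := B.bXY y x
  bYY x y := B.bXX y x
  τ x y := (B.τ y x)⁻¹
  hasDerivAt_b hf hg h1 h2 := (B.hasDerivAt_b hg hf h2 h1).congr_deriv (add_comm _ _)
  hasDerivAt_bX hf hg h1 h2 := (B.hasDerivAt_bY hg hf h2 h1).congr_deriv (add_comm _ _)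
  hasDerivAt_bY hf hg h1 h2 := (B.hasDerivAt_bX hg hf h2 h1).congr_deriv (add_comm _ _)
  continuousOn_b := B.continuousOn_b.comp (t := Set.Ici 0 ×ˢ Set.Ici 0) (f := Prod.swap)
    continuous_swap.continuousOn (fun _ h => ⟨h.2, h.1⟩)
  continuousOn_bX := B.continuousOn_bY.comp (t := Set.Ici 0 ×ˢ Set.Ici 0) (f := Prod.swap)
    continuous_swap.continuousOn (fun _ h => ⟨h.2, h.1⟩)
  continuousOn_bY := B.continuousOn_bX.comp (t := Set.Ici 0 ×ˢ Set.Ici 0) (f := Prod.swap)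
    continuous_swap.continuousOn (fun _ h => ⟨h.2, h.1⟩)
  continuousOn_bXX := B.continuousOn_bYY.comp (t := Set.Ici 0 ×ˢ Set.Ici 0) (f := Prod.swap)
    continuous_swap.continuousOn (fun _ h => ⟨h.2, h.1⟩)
  continuousOn_bXY := B.continuousOn_bXY.comp (t := Set.Ici 0 ×ˢ Set.Ici 0) (f := Prod.swap)
    continuous_swap.continuousOn (fun _ h => ⟨h.2, h.1⟩)
  continuousOn_bYY := B.continuousOn_bXX.comp (t := Set.Ici 0 ×ˢ Set.Ici 0) (f := Prod.swap)
    continuous_swap.continuousOn (fun _ h => ⟨h.2, h.1⟩)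
  b_zero := B.b_zero
  bX_nonneg h1 h2 := B.bY_nonneg h2 h1
  bY_nonneg h1 h2 := B.bX_nonneg h2 h1
  growth := by
    obtain ⟨C, hC, m, h⟩ := B.growth
    refine ⟨C, hC, m, fun {x y} h1 h2 => ?_⟩
    rw [show 1 + x + y = 1 + y + x by ring]
    exact (h h2 h1).symm
  τ_pos h1 h2 := inv_pos.mpr (B.τ_pos h2 h1)
  dissipation {x y u v s t} h1 h2 hu hv h3 h4 := by
    have := B.dissipation h2 h1 hv hu h4 h3
    rw [inv_inv, add_comm ((B.τ y x)⁻¹ * u), mul_comm s t]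
    linarith

theorem continuousOn_comp {g : ℝ → ℝ → ℝ}
    (hg : ContinuousOn (fun z : ℝ × ℝ => g z.1 z.2) (Set.Ici 0 ×ˢ Set.Ici 0))
    {α : Type*} [TopologicalSpace α] {X Y : α → ℝ} {s : Set α} (hX : ContinuousOn X s)
    (hY : ContinuousOn Y s) (hX0 : ∀ a, 0 ≤ X a) (hY0 : ∀ a, 0 ≤ Y a) :
    ContinuousOn (fun a => g (X a) (Y a)) s :=
  hg.comp (hX.prodMk hY) (fun a _ => ⟨hX0 a, hY0 a⟩)

/-- The increments of `b` are controlled by the growth of its first derivatives. -/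
theorem abs_sub_le {C : ℝ} (hC : 0 ≤ C) {m : ℕ} (h : ∀ {x y : ℝ}, 0 ≤ x → 0 ≤ y →
      B.bX x y ≤ C * (1 + x + y) ^ m ∧ B.bY x y ≤ C * (1 + x + y) ^ m)
    {x₀ y₀ x₁ y₁ R : ℝ} (hx0 : 0 ≤ x₀) (hy0 : 0 ≤ y₀) (hx1 : 0 ≤ x₁) (hy1 : 0 ≤ y₁)
    (h0 : x₀ + y₀ ≤ R) (h1 : x₁ + y₁ ≤ R) :
    |B.b x₁ y₁ - B.b x₀ y₀| ≤ C * (1 + R) ^ m * (|x₁ - x₀| + |y₁ - y₀|) := by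
  have hpos : ∀ s ∈ Set.Icc (0 : ℝ) 1, 0 ≤ x₀ + s * (x₁ - x₀) ∧ 0 ≤ y₀ + s * (y₁ - y₀) ∧
      x₀ + s * (x₁ - x₀) + (y₀ + s * (y₁ - y₀)) ≤ R := by
    rintro s ⟨hs0, hs1⟩
    refine ⟨?_, ?_, ?_⟩ <;> nlinarith
  have hd : ∀ s ∈ Set.Icc (0 : ℝ) 1, HasDerivAt
      (fun s => B.b (x₀ + s * (x₁ - x₀)) (y₀ + s * (y₁ - y₀)))
      (B.bX (x₀ + s * (x₁ - x₀)) (y₀ + s * (y₁ - y₀)) * (x₁ - x₀) +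
        B.bY (x₀ + s * (x₁ - x₀)) (y₀ + s * (y₁ - y₀)) * (y₁ - y₀)) s := by
    intro s hs
    have hl : ∀ a c : ℝ, HasDerivAt (fun s : ℝ => a + s * c) c s := fun a c => by
      simpa using ((hasDerivAt_id s).mul_const c).const_add a
    exact B.hasDerivAt_b (hl _ _) (hl _ _) (hpos s hs).1 (hpos s hs).2.1
  have := norm_image_sub_le_of_norm_deriv_le_segment_01'
    (f := fun s => B.b (x₀ + s * (x₁ - x₀)) (y₀ + s * (y₁ - y₀)))
    (C := C * (1 + R) ^ m * (|x₁ - x₀| + |y₁ - y₀|))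
    (fun s hs => (hd s hs).hasDerivWithinAt) (fun s hs => ?_)
  · simpa using this
  · obtain ⟨hx, hy, hR⟩ := hpos s ⟨hs.1, hs.2.le⟩
    have hle : (1 + (x₀ + s * (x₁ - x₀)) + (y₀ + s * (y₁ - y₀))) ^ m ≤ (1 + R) ^ m :=
      pow_le_pow_left₀ (by linarith) (by linarith) m
    have e1 := (h hx hy).1.trans (mul_le_mul_of_nonneg_left hle hC)
    have e2 := (h hx hy).2.trans (mul_le_mul_of_nonneg_left hle hC)
    have p1 := B.bX_nonneg hx hy
    have p2 := B.bY_nonneg hx hy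
    rw [Real.norm_eq_abs]
    refine (abs_add_le _ _).trans ?_
    rw [abs_mul, abs_mul, abs_of_nonneg p1, abs_of_nonneg p2, mul_add]
    gcongr

theorem b_nonneg {x y : ℝ} (hx : 0 ≤ x) (hy : 0 ≤ y) : 0 ≤ B.b x y := by
  have hl : ∀ c s : ℝ, HasDerivAt (fun s : ℝ => s * c) c s := fun c s => by
    simpa using (hasDerivAt_id s).mul_const c
  have hd : ∀ s, 0 ≤ s → HasDerivAt (fun s => B.b (s * x) (s * y))
      (B.bX (s * x) (s * y) * x + B.bY (s * x) (s * y) * y) s := fun s hs =>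
    B.hasDerivAt_b (hl _ _) (hl _ _) (mul_nonneg hs hx) (mul_nonneg hs hy)
  have hm : MonotoneOn (fun s => B.b (s * x) (s * y)) (Set.Icc 0 1) := by
    refine monotoneOn_of_deriv_nonneg (convex_Icc 0 1)
      (fun s hs => (hd s hs.1).continuousAt.continuousWithinAt)
      (fun s hs => ?_) (fun s hs => ?_)
    · rw [interior_Icc] at hs
      exact (hd s hs.1.le).differentiableAt.differentiableWithinAt
    · rw [interior_Icc] at hs
      rw [(hd s hs.1.le).deriv]
      have h1 := B.bX_nonneg (mul_nonneg hs.1.le hx) (mul_nonneg hs.1.le hy)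
      have h2 := B.bY_nonneg (mul_nonneg hs.1.le hx) (mul_nonneg hs.1.le hy)
      positivity
  have := hm (Set.left_mem_Icc.2 zero_le_one) (Set.right_mem_Icc.2 zero_le_one) zero_le_one
  simpa [B.b_zero] using this

theorem weight_le {x y : ℝ} (hx : 0 ≤ x) (hy : 0 ≤ y) :
    c * B.τ x y ≤ 2 * B.bX x y ∧ c * (B.τ x y)⁻¹ ≤ 2 * B.bY x y := by
  have h1 := B.dissipation (u := 1) (v := 0) (s := 0) (t := 0) hx hy (by simp) (by simp)
    (by simpa) (by simp)
  have h2 := B.dissipation (u := 0) (v := 1) (s := 0) (t := 0) hx hy (by simp) (by simp)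
    (by simp) (by simpa)
  simp only [mul_one, mul_zero, add_zero, zero_add, ne_eq, OfNat.ofNat_ne_zero,
    not_false_eq_true, zero_pow] at h1 h2
  exact ⟨h1, h2⟩

end SmoothBellman

/-! ### Existence of Bellman functions -/

section

variable {p q : ℝ}

theorem rpow_le_one_add_pow {x r : ℝ} {m : ℕ} {w : ℝ} (hx : 0 ≤ x) (hxw : x ≤ w) (hw : 1 ≤ w)
    (hr : 0 ≤ r) (hm : r ≤ m) : x ^ r ≤ w ^ m := by
  calc x ^ r ≤ w ^ r := Real.rpow_le_rpow hx hxw hr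
    _ ≤ w ^ (m : ℝ) := Real.rpow_le_rpow_of_exponent_le hw hm
    _ = w ^ m := Real.rpow_natCast _ _

theorem balance_le_pow (hp : 2 ≤ p) (hq : 0 ≤ q) {x y w : ℝ} {m : ℕ} (hpm : p ≤ m) (hqm : q ≤ m)
    (hx : 0 ≤ x) (hy : 0 ≤ y) (hxw : x ≤ w) (hyw : y ≤ w) (hw : 1 ≤ w) :
    balance p q x y ≤ 3 * w ^ m := by
  have hα : 2 / p ≤ 1 := (div_le_one (by positivity)).2 hp
  have hα0 : 0 ≤ 2 / p := by positivity
  have h1 := rpow_le_one_add_pow (r := p / 2) (m := m) hx hxw hw (by positivity) (by linarith)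
  have h2 := rpow_le_one_add_pow (r := q / 2) (m := m) hy hyw hw (by positivity) (by linarith)
  have h3 : 1 ≤ w ^ m := one_le_pow₀ hw
  have h4 : 0 ≤ powSum p q x y := by unfold powSum; positivity
  calc balance p q x y ≤ (1 + powSum p q x y) ^ (1 - 2 / p) :=
        Real.rpow_le_rpow h4 (by linarith) (by linarith)
    _ ≤ (1 + powSum p q x y) ^ (1 : ℝ) :=
        Real.rpow_le_rpow_of_exponent_le (by linarith) (by linarith)
    _ ≤ 3 * w ^ m := by rw [Real.rpow_one]; unfold powSum; linarith

theorem continuousOn_bellman_derivatives {e : ℝ} (he : 0 < e) :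
    ContinuousOn (fun z : ℝ × ℝ => bellman p q (z.1 + e) (z.2 + e)) (Set.Ici 0 ×ˢ Set.Ici 0) ∧
    ContinuousOn (fun z : ℝ × ℝ => bellmanX p q (z.1 + e) (z.2 + e)) (Set.Ici 0 ×ˢ Set.Ici 0) ∧
    ContinuousOn (fun z : ℝ × ℝ => bellmanY p q (z.1 + e) (z.2 + e)) (Set.Ici 0 ×ˢ Set.Ici 0) ∧
    ContinuousOn (fun z : ℝ × ℝ => bellmanXX p q (z.1 + e) (z.2 + e)) (Set.Ici 0 ×ˢ Set.Ici 0) ∧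
    ContinuousOn (fun z : ℝ × ℝ => bellmanXY p q (z.1 + e) (z.2 + e)) (Set.Ici 0 ×ˢ Set.Ici 0) ∧
    ContinuousOn (fun z : ℝ × ℝ => bellmanYY p q (z.1 + e) (z.2 + e))
      (Set.Ici 0 ×ˢ Set.Ici 0) := by
  set D : Set (ℝ × ℝ) := Set.Ici 0 ×ˢ Set.Ici 0 with hD
  have hx : ContinuousOn (fun z : ℝ × ℝ => z.1 + e) D := by fun_prop
  have hy : ContinuousOn (fun z : ℝ × ℝ => z.2 + e) D := by fun_prop
  have hx0 : ∀ z ∈ D, z.1 + e ≠ 0 := fun z hz => (add_pos_of_nonneg_of_pos hz.1 he).ne'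
  have hy0 : ∀ z ∈ D, z.2 + e ≠ 0 := fun z hz => (add_pos_of_nonneg_of_pos hz.2 he).ne'
  have hn : ContinuousOn (fun z : ℝ × ℝ => (z.2 + e) ^ (q / 2)) D :=
    hy.rpow_const fun z hz => Or.inl (hy0 z hz)
  have hS : ContinuousOn (fun z : ℝ × ℝ => powSum p q (z.1 + e) (z.2 + e)) D :=
    (hx.rpow_const fun z hz => Or.inl (hx0 z hz)).add hn
  have hS0 : ∀ z ∈ D, powSum p q (z.1 + e) (z.2 + e) ≠ 0 := fun z hz =>
    (powSum_pos (add_pos_of_nonneg_of_pos hz.1 he) (add_pos_of_nonneg_of_pos hz.2 he)).ne'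
  have hZ : ContinuousOn (fun z : ℝ × ℝ => balance p q (z.1 + e) (z.2 + e)) D :=
    hS.rpow_const fun z hz => Or.inl (hS0 z hz)
  refine ⟨?_, ?_, ?_, ?_, ?_, ?_⟩
  · unfold bellman; fun_prop
  · unfold bellmanX; fun_prop (disch := assumption)
  · unfold bellmanY; fun_prop (disch := assumption)
  · unfold bellmanXX; fun_prop (disch := assumption)
  · unfold bellmanXY; fun_prop (disch := assumption)
  · unfold bellmanYY; fun_prop (disch := assumption)

/-- The homogeneous Bellman function, regularized by the shift `|U|² ↦ |U|² + e`,
`|V|² ↦ |V|² + e` and normalized to vanish at the origin. -/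
noncomputable def shiftedBellman (hpq : 1 / p + 1 / q = 1) (hp : 2 ≤ p) {e : ℝ} (he : 0 < e) :
    SmoothBellman ((q - 1) / 4) where
  b x y := bellman p q (x + e) (y + e) - bellman p q e e
  bX x y := bellmanX p q (x + e) (y + e)
  bY x y := bellmanY p q (x + e) (y + e)
  bXX x y := bellmanXX p q (x + e) (y + e)
  bXY x y := bellmanXY p q (x + e) (y + e)
  bYY x y := bellmanYY p q (x + e) (y + e)
  τ x y := balance p q (x + e) (y + e) / 2
  hasDerivAt_b hf hg h1 h2 := (hasDerivAt_bellman hpq hp (hf.add_const e) (hg.add_const e)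
    (by linarith) (by linarith)).sub_const _
  hasDerivAt_bX hf hg h1 h2 := hasDerivAt_bellmanX hpq hp (hf.add_const e) (hg.add_const e)
    (by linarith) (by linarith)
  hasDerivAt_bY hf hg h1 h2 := hasDerivAt_bellmanY hpq hp (hf.add_const e) (hg.add_const e)
    (by linarith) (by linarith)
  continuousOn_b := (continuousOn_bellman_derivatives he).1.sub continuousOn_const
  continuousOn_bX := (continuousOn_bellman_derivatives he).2.1
  continuousOn_bY := (continuousOn_bellman_derivatives he).2.2.1
  continuousOn_bXX := (continuousOn_bellman_derivatives he).2.2.2.1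
  continuousOn_bXY := (continuousOn_bellman_derivatives he).2.2.2.2.1
  continuousOn_bYY := (continuousOn_bellman_derivatives he).2.2.2.2.2
  b_zero := by simp
  bX_nonneg {x y} h1 h2 := by
    obtain ⟨-, hq1, hq2⟩ := conj_identity hpq hp
    have hx : 0 < x + e := by linarith
    have hy : 0 < y + e := by linarith
    have hZ := balance_pos (p := p) (q := q) hx hy
    have hS := powSum_pos (p := p) (q := q) hx hy
    have hn : (y + e) ^ (q / 2) / powSum p q (x + e) (y + e) ≤ 1 := by
      rw [div_le_one hS]; unfold powSum; linarith [Real.rpow_pos_of_pos hx (p / 2)]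
    have : 0 ≤ (p - 2) / 2 * (1 - (y + e) ^ (q / 2) / powSum p q (x + e) (y + e)) :=
      mul_nonneg (by linarith) (by linarith)
    have : 0 ≤ q - 1 := by linarith
    unfold bellmanX
    positivity
  bY_nonneg {x y} h1 h2 := by
    obtain ⟨-, hq1, hq2⟩ := conj_identity hpq hp
    have hx : 0 < x + e := by linarith
    have hy : 0 < y + e := by linarith
    have hZ := balance_pos (p := p) (q := q) hx hy
    have hS := powSum_pos (p := p) (q := q) hx hy
    have : 0 ≤ q - 1 := by linarith
    have : 0 ≤ 2 - q := by linarith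
    unfold bellmanY
    positivity
  growth := by
    obtain ⟨-, hq1, hq2⟩ := conj_identity hpq hp
    obtain ⟨m, hm⟩ := exists_nat_ge (p + 1)
    have h1e : 1 ≤ 1 + e := by linarith
    refine ⟨(p * 3) * (1 + e) ^ m + 2 * (e ^ (q / 2 - 1)), by positivity, m, fun {x y} h1 h2 => ?_⟩
    have hx : 0 < x + e := by linarith
    have hy : 0 < y + e := by linarith
    have hZ := balance_pos (p := p) (q := q) hx hy
    have hS := powSum_pos (p := p) (q := q) hx hy
    have hw : 1 ≤ (1 + x + y) ^ m := one_le_pow₀ (by linarith)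
    have hn0 : 0 ≤ (y + e) ^ (q / 2) / powSum p q (x + e) (y + e) := by positivity
    constructor
    · have hb := balance_le_pow (q := q) hp (by linarith) (m := m) (w := (1 + e) * (1 + x + y))
        (by linarith) (by linarith) hx.le hy.le (by nlinarith) (by nlinarith) (by nlinarith)
      rw [mul_pow] at hb
      have h4 : 1 + (p - 2) / 2 * (1 - (y + e) ^ (q / 2) / powSum p q (x + e) (y + e)) ≤ p := by
        have : 0 ≤ (p - 2) / 2 := by linarith
        nlinarith
      calc bellmanX p q (x + e) (y + e)
          ≤ (q - 1) / 8 * balance p q (x + e) (y + e) * p := by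
            unfold bellmanX
            have : 0 ≤ q - 1 := by linarith
            gcongr
        _ ≤ 1 * balance p q (x + e) (y + e) * p := by gcongr; linarith
        _ ≤ 1 * (3 * ((1 + e) ^ m * (1 + x + y) ^ m)) * p := by gcongr
        _ = (p * 3) * (1 + e) ^ m * (1 + x + y) ^ m := by ring
        _ ≤ _ := by
          gcongr
          linarith [Real.rpow_pos_of_pos he (q / 2 - 1)]
    · have h3 : (y + e) ^ (q / 2) / (y + e) ≤ e ^ (q / 2 - 1) := by
        rw [← Real.rpow_sub_one hy.ne']
        exact Real.rpow_le_rpow_of_nonpos he (by linarith) (by linarith)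
      have h4 : (x + e) * balance p q (x + e) (y + e) / powSum p q (x + e) (y + e) ≤ 1 :=
        (div_le_one hS).2 (mul_balance_le hp hx.le hy.le)
      have h5 : q / 2 + (q - 1) / 8 * ((2 - q) / 2) *
          ((x + e) * balance p q (x + e) (y + e) / powSum p q (x + e) (y + e)) ≤ 2 := by
        have : 0 ≤ (q - 1) / 8 * ((2 - q) / 2) := mul_nonneg (by linarith) (by linarith)
        have : (q - 1) / 8 * ((2 - q) / 2) ≤ 1 := by nlinarith
        nlinarith
      have h6 : 0 < e ^ (q / 2 - 1) := Real.rpow_pos_of_pos he _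
      calc bellmanY p q (x + e) (y + e) ≤ e ^ (q / 2 - 1) * 2 := by
            unfold bellmanY
            have : 0 ≤ 2 - q := by linarith
            have : 0 ≤ q - 1 := by linarith
            gcongr
        _ ≤ ((p * 3) * (1 + e) ^ m + 2 * (e ^ (q / 2 - 1))) * 1 := by
            have : 0 ≤ (p * 3) * (1 + e) ^ m := by positivity
            linarith
        _ ≤ _ := by gcongr
  τ_pos h1 h2 := half_pos (balance_pos (by linarith) (by linarith))
  dissipation {x y u v s t} h1 h2 hu0 hv0 h3 h4 := by
    have hx : 0 < x + e := by linarith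
    have hy : 0 < y + e := by linarith
    have hZ := balance_pos (p := p) (q := q) hx hy
    have hu : s ^ 2 ≤ (x + e) * u := by nlinarith
    have hv : t ^ 2 ≤ (y + e) * v := by nlinarith
    refine le_trans (le_of_eq ?_) (bellman_dissipation hpq hp hx hy hu hv)
    field_simp
    ring

end

section

variable {p q x y : ℝ}

theorem bellman_le (hp : 2 ≤ p) (hq1 : 1 < q) (hq2 : q ≤ 2) (hx : 0 ≤ x) (hy : 0 ≤ y) :
    bellman p q x y ≤ 9 / 8 * (x ^ (p / 2) + y ^ (q / 2)) := by
  have h1 := mul_balance_le (q := q) hp hx hy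
  have h2 : (q - 1) / 8 * (x * balance p q x y) ≤ 1 / 8 * powSum p q x y := by
    have : 0 ≤ powSum p q x y := by unfold powSum; positivity
    calc (q - 1) / 8 * (x * balance p q x y) ≤ (q - 1) / 8 * powSum p q x y := by
          have : 0 ≤ q - 1 := by linarith
          gcongr
      _ ≤ _ := by gcongr; linarith
  have : 0 ≤ x ^ (p / 2) := by positivity
  unfold bellman
  unfold powSum at h2
  linarith

theorem rpow_add_sub_rpow_le {r e : ℝ} (hr : 1 ≤ r) (hx : 0 ≤ x) (he : 0 < e) :
    (x + e) ^ r - e ^ r ≤ r * x * (x + e) ^ (r - 1) := by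
  have hxe : 0 < x + e := by linarith
  have h := one_add_mul_self_le_rpow_one_add (s := e / (x + e) - 1) (by
    have : 0 ≤ e / (x + e) := by positivity
    linarith) hr
  rw [add_sub_cancel, Real.div_rpow he.le hxe.le, le_div_iff₀ (by positivity)] at h
  have e2 : e / (x + e) - 1 = -x / (x + e) := by field_simp; ring
  rw [e2] at h
  rw [Real.rpow_sub_one hxe.ne']
  have e3 : (1 + r * (-x / (x + e))) * (x + e) ^ r
      = (x + e) ^ r - r * x * ((x + e) ^ r / (x + e)) := by field_simp; ring
  linarith

/-- A bound for the regularized Bellman functions that is uniform in the regularization. -/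
theorem exists_shiftedBellman_le (hpq : 1 / p + 1 / q = 1) (hp : 2 ≤ p) :
    ∃ C : ℝ, 0 ≤ C ∧ ∃ m : ℕ, ∀ {e x y : ℝ} (he : 0 < e), e ≤ 1 → 0 ≤ x → 0 ≤ y →
      (shiftedBellman hpq hp he).b x y ≤ C * (1 + x + y) ^ m * x + 2 * y ^ (q / 2) := by
  obtain ⟨-, hq1, hq2⟩ := conj_identity hpq hp
  obtain ⟨m, hm⟩ := exists_nat_ge (p + 1)
  refine ⟨3 + p / 2, by positivity, m, fun {e x y} he he1 hx hy => ?_⟩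
  have hxe : 0 < x + e := by linarith
  have hye : 0 < y + e := by linarith
  have hw : 1 ≤ 1 + x + y := by linarith
  have hZ := balance_le_pow (q := q) hp (by linarith) (m := m) (w := 1 + x + y)
        (by linarith) (by linarith) hxe.le hye.le (by linarith) (by linarith) hw
  have hy1 : (y + e) ^ (q / 2) ≤ y ^ (q / 2) + e ^ (q / 2) :=
    Real.rpow_add_le_add_rpow hy he.le (by linarith) (by linarith)
  have hS0 := powSum_pos (p := p) (q := q) he he
  have hS1 := powSum_pos (p := p) (q := q) hxe hye
  have hS01 : powSum p q e e ≤ powSum p q (x + e) (y + e) := by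
    unfold powSum
    gcongr <;> linarith
  -- concavity of `S ↦ S ^ (1 - 2 / p)` in the form of a tangent line bound at `e`
  have hbal : e * (balance p q (x + e) (y + e) - balance p q e e) ≤
      powSum p q (x + e) (y + e) - powSum p q e e := by
    have h1 : balance p q (x + e) (y + e) ≤
        powSum p q (x + e) (y + e) * (balance p q e e / powSum p q e e) := by
      unfold balance
      rw [← Real.rpow_sub_one hS0.ne']
      have : powSum p q (x + e) (y + e) ^ (1 - 2 / p) = powSum p q (x + e) (y + e) *
          powSum p q (x + e) (y + e) ^ (1 - 2 / p - 1) := by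
        rw [Real.rpow_sub_one hS1.ne']; field_simp
      rw [this]
      gcongr ?_ * ?_
      exact Real.rpow_le_rpow_of_nonpos hS0 hS01 (by
        have : 0 ≤ 2 / p := by positivity
        linarith)
    have h2 : e * balance p q e e / powSum p q e e ≤ 1 :=
      (div_le_one hS0).2 (mul_balance_le hp he.le he.le)
    calc e * (balance p q (x + e) (y + e) - balance p q e e)
        ≤ e * (powSum p q (x + e) (y + e) * (balance p q e e / powSum p q e e)
            - balance p q e e) := by gcongr
      _ = (powSum p q (x + e) (y + e) - powSum p q e e) *
            (e * balance p q e e / powSum p q e e) := by field_simp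
      _ ≤ (powSum p q (x + e) (y + e) - powSum p q e e) * 1 := by gcongr
      _ = _ := mul_one _
  have hxp := rpow_add_sub_rpow_le (r := p / 2) (by linarith) hx he
  have hxm : (x + e) ^ (p / 2 - 1) ≤ (1 + x + y) ^ m :=
    rpow_le_one_add_pow hxe.le (by linarith) hw (by linarith) (by linarith)
  have hxp' : (x + e) ^ (p / 2) - e ^ (p / 2) ≤ p / 2 * x * (1 + x + y) ^ m :=
    hxp.trans (by gcongr)
  have hxZ : x * balance p q (x + e) (y + e) ≤ x * (3 * (1 + x + y) ^ m) := by gcongr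
  have htot : (x + e) * balance p q (x + e) (y + e) - e * balance p q e e ≤
      (3 + p / 2) * (1 + x + y) ^ m * x + y ^ (q / 2) := by
    unfold powSum at hbal
    linarith
  have hpos : 0 ≤ (3 + p / 2) * (1 + x + y) ^ m * x + y ^ (q / 2) := by positivity
  have hq8 : (q - 1) / 8 * ((x + e) * balance p q (x + e) (y + e) - e * balance p q e e) ≤
      (3 + p / 2) * (1 + x + y) ^ m * x + y ^ (q / 2) := by
    calc _ ≤ (q - 1) / 8 * ((3 + p / 2) * (1 + x + y) ^ m * x + y ^ (q / 2)) := by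
          have : 0 ≤ q - 1 := by linarith
          gcongr
      _ ≤ 1 * ((3 + p / 2) * (1 + x + y) ^ m * x + y ^ (q / 2)) := by gcongr; linarith
      _ = _ := one_mul _
  change bellman p q (x + e) (y + e) - bellman p q e e ≤ _
  unfold bellman
  linarith

theorem tendsto_shiftedBellman (hpq : 1 / p + 1 / q = 1) (hp : 2 ≤ p) :
    Tendsto (fun n : ℕ => (shiftedBellman hpq hp (Nat.one_div_pos_of_nat (n := n))).b x y) atTop
      (𝓝 (bellman p q x y)) := by
  obtain ⟨-, hq1, hq2⟩ := conj_identity hpq hp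
  have hα : 0 ≤ 1 - 2 / p := by
    have : 2 / p ≤ 1 := (div_le_one (by positivity)).2 hp
    linarith
  have hcont : Continuous fun e : ℝ => bellman p q (x + e) (y + e) - bellman p q e e := by
    have c1 := Real.continuous_rpow_const (q := p / 2) (by positivity)
    have c2 := Real.continuous_rpow_const (q := q / 2) (by positivity)
    have c3 := Real.continuous_rpow_const hα
    have hS : Continuous fun z : ℝ × ℝ => powSum p q z.1 z.2 :=
      (c1.comp continuous_fst).add (c2.comp continuous_snd)
    have hb : Continuous fun z : ℝ × ℝ => bellman p q z.1 z.2 :=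
      (c2.comp continuous_snd).add
        (continuous_const.mul (continuous_fst.mul (c3.comp hS)))
    exact (hb.comp (f := fun e : ℝ => (x + e, y + e)) (by fun_prop)).sub
      (hb.comp (f := fun e : ℝ => (e, e)) (by fun_prop))
  have h0 := (hcont.tendsto 0).comp tendsto_one_div_add_atTop_nhds_zero_nat
  have e0 : bellman p q 0 0 = 0 := by
    unfold bellman
    rw [Real.zero_rpow (by positivity)]; simp
  simpa [e0, shiftedBellman, Function.comp_def] using h0

/-- Bellman functions for every `1 < p < ∞`: the constant is `1 / (4 (p^* - 1))`, and the functions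
converge to a limit that is at most `9/8 (|U|^p + |V|^q)`. -/
theorem exists_bellman_sequence (hp : 1 < p) (hpq : 1 / p + 1 / q = 1) :
    ∃ c : ℝ, c * (4 * (max p (p / (p - 1)) - 1)) = 1 ∧ 0 < c ∧ ∃ B : ℕ → SmoothBellman c,
      (∃ C : ℝ, 0 ≤ C ∧ ∃ m : ℕ, ∀ n {x y : ℝ}, 0 ≤ x → 0 ≤ y →
        (B n).b x y ≤ C * (1 + x + y) ^ m * (x + y) + 2 * x ^ (p / 2) + 2 * y ^ (q / 2)) ∧
      ∃ b : ℝ → ℝ → ℝ, ∀ {x y : ℝ}, 0 ≤ x → 0 ≤ y →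
        Tendsto (fun n => (B n).b x y) atTop (𝓝 (b x y)) ∧
          b x y ≤ 9 / 8 * (x ^ (p / 2) + y ^ (q / 2)) := by
  have hp0 : p ≠ 0 := by positivity
  have hp1 : p - 1 ≠ 0 := by linarith
  have hq0 : q ≠ 0 := by
    rintro rfl
    simp at hpq; linarith
  have hq : q = p / (p - 1) := by field_simp at hpq ⊢; linarith
  have hn1 : ∀ n : ℕ, 1 / ((n : ℝ) + 1) ≤ 1 := fun n => by
    rw [div_le_one (by positivity)]; linarith [Nat.cast_nonneg (α := ℝ) n]
  rcases le_total 2 p with h2 | h2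
  · obtain ⟨h1, hq1, hq2⟩ := conj_identity hpq h2
    refine ⟨(q - 1) / 4, ?_, by linarith,
      fun n => shiftedBellman hpq h2 (Nat.one_div_pos_of_nat (n := n)), ?_, bellman p q,
      fun {x y} hx hy => ⟨tendsto_shiftedBellman hpq h2, bellman_le h2 hq1 hq2 hx hy⟩⟩
    · rw [max_eq_left (by rw [← hq]; linarith), hq]; field_simp; ring
    · obtain ⟨C, hC, m, h⟩ := exists_shiftedBellman_le hpq h2
      refine ⟨C, hC, m, fun n {x y} hx hy => (h (Nat.one_div_pos_of_nat (n := n)) (hn1 n) hx hy).trans ?_⟩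
      have a1 : 0 ≤ x ^ (p / 2) := by positivity
      have a2 : 0 ≤ C * (1 + x + y) ^ m * y := by positivity
      linarith
  · have hqp : 1 / q + 1 / p = 1 := by rw [add_comm]; exact hpq
    have h2' : 2 ≤ q := by rw [hq, le_div_iff₀ (by linarith)]; linarith
    refine ⟨(p - 1) / 4, ?_, by linarith,
      fun n => (shiftedBellman hqp h2' (Nat.one_div_pos_of_nat (n := n))).swap, ?_,
      fun x y => bellman q p y x,
      fun {x y} hx hy => ⟨tendsto_shiftedBellman hqp h2',
        (bellman_le h2' hp h2 hy hx).trans (by rw [add_comm])⟩⟩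
    · rw [max_eq_right (by rw [← hq]; linarith)]; field_simp; ring
    · obtain ⟨C, hC, m, h⟩ := exists_shiftedBellman_le hqp h2'
      refine ⟨C, hC, m, fun n {x y} hx hy => (h (Nat.one_div_pos_of_nat (n := n)) (hn1 n) hy hx).trans ?_⟩
      have a1 : 0 ≤ y ^ (q / 2) := by positivity
      have a2 : 0 ≤ C * (1 + x + y) ^ m * x := by positivity
      rw [show 1 + y + x = 1 + x + y by ring]
      linarith

end

/-! ### Cutoffs adapted to the scale function -/

section Scale

variable {I : Set ℝ} {P E w : ℝ → ℝ}

theorem abs_sub_le_scale {f f' : ℝ → ℝ} {a b ε : ℝ} (hab : a ≤ b)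
    (hE : ∀ y ∈ Set.Icc a b, HasDerivAt E (1 / P y) y) (hP : ∀ y ∈ Set.Icc a b, 0 < P y)
    (hf : ∀ y ∈ Set.Icc a b, HasDerivAt f (f' y) y)
    (h : ∀ y ∈ Set.Icc a b, |P y * f' y| ≤ ε) : |f b - f a| ≤ ε * (E b - E a) := by
  have key : ∀ σ : ℝ, |σ| = 1 → 0 ≤ ε * (E b - E a) + σ * (f b - f a) := by
    intro σ hσ
    have hd : ∀ y ∈ Set.Icc a b, HasDerivAt (fun y => ε * E y + σ * f y)
        (ε * (1 / P y) + σ * f' y) y := fun y hy =>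
      ((hE y hy).const_mul ε).add ((hf y hy).const_mul σ)
    have hm : MonotoneOn (fun y => ε * E y + σ * f y) (Set.Icc a b) := by
      refine monotoneOn_of_deriv_nonneg (convex_Icc a b)
        (fun y hy => (hd y hy).continuousAt.continuousWithinAt)
        (fun y hy => (hd y (interior_subset hy)).differentiableAt.differentiableWithinAt)
        (fun y hy => ?_)
      have hy' := interior_subset hy
      rw [(hd y hy').deriv]
      have hPy := hP y hy'
      have h1 : |σ * (P y * f' y)| ≤ ε := by rw [abs_mul, hσ, one_mul]; exact h y hy'
      have h2 := (abs_le.1 h1).1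
      have : ε * (1 / P y) + σ * f' y = (ε + σ * (P y * f' y)) / P y := by field_simp
      rw [this]
      exact div_nonneg (by linarith) hPy.le
    have := hm (Set.left_mem_Icc.2 hab) (Set.right_mem_Icc.2 hab) hab
    simp only at this
    linarith
  have h1 := key 1 (by simp)
  have h2 := key (-1) (by simp)
  rw [abs_le]
  constructor <;> linarith

theorem strictMonoOn_scale (hoc : I.OrdConnected) (hE : ∀ y ∈ I, HasDerivAt E (1 / P y) y)
    (hP : ∀ y ∈ I, 0 < P y) : StrictMonoOn E I :=
  strictMonoOn_of_deriv_pos hoc.convex (fun y hy => (hE y hy).continuousAt.continuousWithinAt)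
    (fun y hy => by
      have hy' := interior_subset hy
      rw [(hE y hy').deriv]
      exact one_div_pos.2 (hP y hy'))

theorem exists_scale (hI : IsOpen I) (hoc : I.OrdConnected) (hPc : ContinuousOn P I)
    (hP : ∀ y ∈ I, 0 < P y) : ∃ E : ℝ → ℝ, ∀ y ∈ I, HasDerivAt E (1 / P y) y := by
  rcases I.eq_empty_or_nonempty with rfl | ⟨x, hx⟩
  · exact ⟨0, by simp⟩
  have hc : ContinuousOn (fun y => 1 / P y) I :=
    continuousOn_const.div hPc fun y hy => (hP y hy).ne'
  refine ⟨fun y => ∫ t in x..y, 1 / P t, fun y hy => ?_⟩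
  refine intervalIntegral.integral_hasDerivAt_right
    ((hc.mono (hoc.uIcc_subset hx hy)).intervalIntegrable) ?_ (hc.continuousAt (hI.mem_nhds hy))
  exact hc.stronglyMeasurableAtFilter hI y hy

theorem exists_mem_max {ι : Type*} [Finite ι] {x : ℝ} (hx : x ∈ I) {f : ι → ℝ}
    (hf : ∀ k, f k ∈ I) : ∃ z ∈ I, x ≤ z ∧ ∀ k, f k ≤ z := by
  obtain ⟨k, hk⟩ := Finite.exists_max (fun k : Option ι => k.elim x f)
  refine ⟨k.elim x f, ?_, hk none, fun l => hk (some l)⟩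
  cases k
  · exact hx
  · exact hf _

/-- Near the right end of the interval `I` there are arbitrarily flat pieces, measured in the scale
function `E`: either the functions `h k` are negligible against the increment of `E` (when `E` is
unbounded), or they stay bounded and their increments are negligible (when `E` is bounded).
Only products `h_k ^ n ⬝ P h_k'` with the same index `k` are assumed to be small. -/
theorem exists_slope_control_right {ι : Type*} [Finite ι] (hI : IsOpen I) (hoc : I.OrdConnected)
    (hne : I.Nonempty)
    (hE : ∀ y ∈ I, HasDerivAt E (1 / P y) y) (hP : ∀ y ∈ I, 0 < P y) {h h' : ι → ℝ → ℝ}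
    (hh : ∀ k, ∀ y ∈ I, HasDerivAt (h k) (h' k y) y) (m : ℕ)
    (hdecay : ∀ k, ∀ ε > 0, ∃ z ∈ I, ∀ y ∈ I, z ≤ y →
      |P y * h' k y| ≤ ε ∧ |h k y ^ (2 * m + 1) * (P y * h' k y)| ≤ ε) :
    ∃ M, 0 ≤ M ∧ ∀ η > 0, ∀ x ∈ I, ∃ a ∈ I, ∃ b ∈ I, x ≤ a ∧ a < b ∧
      ((∀ k, 1 + h k b ^ (2 * m + 2) ≤ η * (E b - E a)) ∨
        ∀ k, |h k a| ≤ M ∧ |h k b| ≤ M ∧ |h k b - h k a| ≤ η * (E b - E a)) := by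
  have hmono := strictMonoOn_scale hoc hE hP
  have htail : ∀ ε > 0, ∀ x ∈ I, ∃ z ∈ I, x ≤ z ∧ ∀ k, ∀ y ∈ I, z ≤ y →
      |P y * h' k y| ≤ ε ∧ |h k y ^ (2 * m + 1) * (P y * h' k y)| ≤ ε := by
    intro ε hε x hx
    choose f hf hf' using fun k => hdecay k ε hε
    obtain ⟨z, hz, hxz, hfz⟩ := exists_mem_max hx hf
    exact ⟨z, hz, hxz, fun k y hy hzy => hf' k y hy ((hfz k).trans hzy)⟩
  have hsub : ∀ {a b : ℝ}, a ∈ I → b ∈ I → Set.Icc a b ⊆ I := fun ha hb => hoc.out ha hb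
  by_cases hbdd : BddAbove (E '' I)
  · obtain ⟨R, hR⟩ := hbdd
    have hR' : ∀ y ∈ I, E y ≤ R := fun y hy => hR ⟨y, hy, rfl⟩
    obtain ⟨x₀, hx₀⟩ := hne
    obtain ⟨z₀, hz₀, -, htz₀⟩ := htail 1 one_pos x₀ hx₀
    obtain ⟨M₀, hM₀⟩ : ∃ M₀, ∀ k, |h k z₀| ≤ M₀ := by
      obtain ⟨M, hM⟩ := (Set.finite_range fun k => |h k z₀|).bddAbove
      exact ⟨M, fun k => hM ⟨k, rfl⟩⟩
    refine ⟨|M₀| + (R - E z₀), add_nonneg (abs_nonneg _) (by linarith [hR' _ hz₀]), ?_⟩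
    have hbound : ∀ k, ∀ y ∈ I, z₀ ≤ y → |h k y| ≤ |M₀| + (R - E z₀) := by
      intro k y hy hzy
      have := abs_sub_le_scale hzy (fun t ht => hE t (hsub hz₀ hy ht))
        (fun t ht => hP t (hsub hz₀ hy ht)) (fun t ht => hh k t (hsub hz₀ hy ht))
        (fun t ht => (htz₀ k t (hsub hz₀ hy ht) ht.1).1)
      have h2 := abs_sub_abs_le_abs_sub (h k y) (h k z₀)
      have h3 := (hM₀ k).trans (le_abs_self M₀)
      have h4 := hR' y hy
      linarith
    intro η hη x hx
    obtain ⟨z₁, hz₁, hz₁₀, hz₁x⟩ := exists_mem_max (ι := Unit) hz₀ (f := fun _ => x) (fun _ => hx)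
    obtain ⟨a, ha, hza, hta⟩ := htail η hη z₁ hz₁
    obtain ⟨δ, hδ, hball⟩ := Metric.isOpen_iff.1 hI a ha
    have hb : a + δ / 2 ∈ I := hball (by
      rw [Metric.mem_ball, Real.dist_eq, add_sub_cancel_left, abs_of_pos (by positivity)]
      linarith)
    have hab : a < a + δ / 2 := by linarith
    refine ⟨a, ha, a + δ / 2, hb, (hz₁x ()).trans hza, hab, Or.inr fun k => ⟨?_, ?_, ?_⟩⟩
    · exact hbound k a ha (hz₁₀.trans hza)
    · exact hbound k _ hb ((hz₁₀.trans hza).trans hab.le)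
    · exact abs_sub_le_scale hab.le (fun t ht => hE t (hsub ha hb ht))
        (fun t ht => hP t (hsub ha hb ht)) (fun t ht => hh k t (hsub ha hb ht))
        (fun t ht => (hta k t (hsub ha hb ht) ht.1).1)
  · refine ⟨0, le_rfl, fun η hη x hx => ?_⟩
    have hm0 : (0 : ℝ) < 2 * m + 2 := by positivity
    obtain ⟨a, ha, hxa, hta⟩ := htail (η / (2 * (2 * m + 2))) (by positivity) x hx
    obtain ⟨M, hM⟩ : ∃ M, ∀ k, h k a ^ (2 * m + 2) ≤ M := by
      obtain ⟨M, hM⟩ := (Set.finite_range fun k => h k a ^ (2 * m + 2)).bddAbove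
      exact ⟨M, fun k => hM ⟨k, rfl⟩⟩
    rw [not_bddAbove_iff] at hbdd
    obtain ⟨-, ⟨b, hb, rfl⟩, hRb⟩ := hbdd (E a + 2 * (1 + |M|) / η)
    have hpos : 0 < 2 * (1 + |M|) / η := by positivity
    have hab : a < b := (hmono.lt_iff_lt ha hb).1 (by linarith)
    refine ⟨a, ha, b, hb, hxa, hab, Or.inl fun k => ?_⟩
    have hd : ∀ t ∈ Set.Icc a b, HasDerivAt (fun y => h k y ^ (2 * m + 2))
        ((2 * m + 2 : ℝ) * h k t ^ (2 * m + 1) * h' k t) t := fun t ht => by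
      have := (hh k t (hsub ha hb ht)).fun_pow (2 * m + 2)
      refine this.congr_deriv ?_
      push_cast
      rfl
    have := abs_sub_le_scale hab.le (fun t ht => hE t (hsub ha hb ht))
        (fun t ht => hP t (hsub ha hb ht)) hd (ε := η / 2) (fun t ht => by
          have h1 := (hta k t (hsub ha hb ht) ht.1).2
          have e : P t * ((2 * m + 2 : ℝ) * h k t ^ (2 * m + 1) * h' k t)
            = (2 * m + 2) * (h k t ^ (2 * m + 1) * (P t * h' k t)) := by ring
          rw [e, abs_mul, abs_of_pos hm0]
          calc _ ≤ (2 * m + 2 : ℝ) * (η / (2 * (2 * m + 2))) := by gcongr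
            _ = η / 2 := by field_simp)
    have h1 := le_abs_self (h k b ^ (2 * m + 2) - h k a ^ (2 * m + 2))
    have h2 : 1 + |M| ≤ η / 2 * (E b - E a) := by
      have : 2 * (1 + |M|) / η ≤ E b - E a := by linarith
      rw [div_le_iff₀ hη] at this
      linarith
    have h3 := (hM k).trans (le_abs_self M)
    linarith

theorem exists_slope_control_left {ι : Type*} [Finite ι] (hI : IsOpen I) (hoc : I.OrdConnected)
    (hne : I.Nonempty)
    (hE : ∀ y ∈ I, HasDerivAt E (1 / P y) y) (hP : ∀ y ∈ I, 0 < P y) {h h' : ι → ℝ → ℝ}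
    (hh : ∀ k, ∀ y ∈ I, HasDerivAt (h k) (h' k y) y) (m : ℕ)
    (hdecay : ∀ k, ∀ ε > 0, ∃ z ∈ I, ∀ y ∈ I, y ≤ z →
      |P y * h' k y| ≤ ε ∧ |h k y ^ (2 * m + 1) * (P y * h' k y)| ≤ ε) :
    ∃ M, 0 ≤ M ∧ ∀ η > 0, ∀ x ∈ I, ∃ a ∈ I, ∃ b ∈ I, b ≤ x ∧ a < b ∧
      ((∀ k, 1 + h k a ^ (2 * m + 2) ≤ η * (E b - E a)) ∨
        ∀ k, |h k a| ≤ M ∧ |h k b| ≤ M ∧ |h k b - h k a| ≤ η * (E b - E a)) := by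
  have hoc' : (Neg.neg ⁻¹' I).OrdConnected := ⟨fun x hx y hy z hz =>
    hoc.out hy hx ⟨neg_le_neg hz.2, neg_le_neg hz.1⟩⟩
  have hneg : ∀ {f : ℝ → ℝ} {f' y : ℝ}, HasDerivAt f f' (-y) →
      HasDerivAt (fun y => f (-y)) (-f') y := fun {f f' y} hf => by
    simpa [Function.comp_def] using hf.scomp y (hasDerivAt_neg y)
  obtain ⟨M, hM, H⟩ := exists_slope_control_right (I := Neg.neg ⁻¹' I) (P := fun y => P (-y))
    (E := fun y => -E (-y)) (h := fun k y => h k (-y)) (h' := fun k y => -h' k (-y))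
    (hI.preimage continuous_neg) hoc' (hne.elim fun x hx => ⟨-x, by simpa using hx⟩)
    (fun y hy => (hneg (hE (-y) hy)).neg.congr_deriv (neg_neg _))
    (fun y hy => hP _ hy)
    (fun k y hy => hneg (hh k (-y) hy)) m
    (fun k ε hε => by
      obtain ⟨z, hz, H⟩ := hdecay k ε hε
      refine ⟨-z, by simpa using hz, fun y hy hzy => ?_⟩
      have := H (-y) hy (by linarith)
      simpa [abs_mul] using this)
  refine ⟨M, hM, fun η hη x hx => ?_⟩
  obtain ⟨a, ha, b, hb, hxa, hab, H⟩ := H η hη (-x) (by simpa using hx)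
  refine ⟨-b, hb, -a, ha, by linarith, by linarith, H.imp (fun H k => ?_) (fun H k => ?_)⟩
  · have := H k
    rwa [show -E (-b) - -E (-a) = E (-a) - E (-b) by ring] at this
  · have := H k
    rw [show -E (-b) - -E (-a) = E (-a) - E (-b) by ring] at this
    exact ⟨this.2.1, this.1, by rw [abs_sub_comm]; exact this.2.2⟩

theorem integral_affine_scale {β β₁ g : ℝ → ℝ} {a b : ℝ} (hab : a ≤ b)
    (hE : ∀ y ∈ Set.Icc a b, HasDerivAt E (1 / P y) y) (hP : ∀ y ∈ Set.Icc a b, 0 < P y)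
    (hβ : ∀ y ∈ Set.Icc a b, HasDerivAt β (β₁ y) y)
    (hg : ∀ y ∈ Set.Icc a b, HasDerivAt (fun y => P y * β₁ y) (g y) y)
    (hgc : ContinuousOn g (Set.Icc a b)) (A B : ℝ) :
    ∫ y in a..b, (A + B * E y) * g y =
      (A + B * E b) * (P b * β₁ b) - (A + B * E a) * (P a * β₁ a) - B * (β b - β a) := by
  have hu : Set.uIcc a b = Set.Icc a b := Set.uIcc_of_le hab
  have hEc : ContinuousOn E (Set.Icc a b) := fun y hy => (hE y hy).continuousAt.continuousWithinAt
  have := intervalIntegral.integral_eq_sub_of_hasDerivAt (a := a) (b := b)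
    (f := fun y => (A + B * E y) * (P y * β₁ y) - B * β y) (f' := fun y => (A + B * E y) * g y)
    (fun y hy => by
      rw [hu] at hy
      have hPy := hP y hy
      refine (((((hE y hy).const_mul B).const_add A).mul (hg y hy)).sub
        ((hβ y hy).const_mul B)).congr_deriv ?_
      field_simp
      ring)
    (by
      apply ContinuousOn.intervalIntegrable
      rw [hu]
      fun_prop)
  rw [this]
  ring

/-- The cutoff that is `1` on `[a₀, b₀]` and decreases to `0` at `a₁` and `b₁`, affinely in the
scale function `E`. It is meant for arguments in `[a₁, b₁]`. -/
noncomputable def scaleCutoff (E : ℝ → ℝ) (a₁ a₀ b₀ b₁ y : ℝ) : ℝ :=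
  if y ≤ a₀ then (E y - E a₁) / (E a₀ - E a₁)
  else if y ≤ b₀ then 1 else (E b₁ - E y) / (E b₁ - E b₀)

variable {a₁ a₀ b₀ b₁ : ℝ}

theorem integral_scaleCutoff_mul {β β₁ g : ℝ → ℝ} (ha : a₁ < a₀) (h0 : a₀ ≤ b₀) (hb : b₀ < b₁)
    (hE : ∀ y ∈ Set.Icc a₁ b₁, HasDerivAt E (1 / P y) y) (hP : ∀ y ∈ Set.Icc a₁ b₁, 0 < P y)
    (hβ : ∀ y ∈ Set.Icc a₁ b₁, HasDerivAt β (β₁ y) y)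
    (hg : ∀ y ∈ Set.Icc a₁ b₁, HasDerivAt (fun y => P y * β₁ y) (g y) y)
    (hgc : ContinuousOn g (Set.Icc a₁ b₁)) :
    ∫ y in a₁..b₁, scaleCutoff E a₁ a₀ b₀ b₁ y * g y =
      (β b₁ - β b₀) / (E b₁ - E b₀) - (β a₀ - β a₁) / (E a₀ - E a₁) := by
  have hmono := strictMonoOn_scale (Set.ordConnected_Icc (a := a₁) (b := b₁)) hE hP
  have hEa : 0 < E a₀ - E a₁ := sub_pos.2 (hmono ⟨le_rfl, by linarith⟩ ⟨ha.le, by linarith⟩ ha)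
  have hEb : 0 < E b₁ - E b₀ :=
    sub_pos.2 (hmono ⟨by linarith, by linarith⟩ ⟨by linarith, le_rfl⟩ hb)
  have hEc : ContinuousOn E (Set.Icc a₁ b₁) := fun y hy => (hE y hy).continuousAt.continuousWithinAt
  have s1 : Set.Icc a₁ a₀ ⊆ Set.Icc a₁ b₁ := Set.Icc_subset_Icc le_rfl (by linarith)
  have s2 : Set.Icc a₀ b₀ ⊆ Set.Icc a₁ b₁ := Set.Icc_subset_Icc ha.le hb.le
  have s3 : Set.Icc b₀ b₁ ⊆ Set.Icc a₁ b₁ := Set.Icc_subset_Icc (by linarith) le_rfl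
  have piece : ∀ {a b : ℝ}, a ≤ b → Set.Icc a b ⊆ Set.Icc a₁ b₁ → ∀ A B : ℝ,
      (∀ y ∈ Set.Ioc a b, scaleCutoff E a₁ a₀ b₀ b₁ y = A + B * E y) →
      (∫ y in a..b, scaleCutoff E a₁ a₀ b₀ b₁ y * g y =
        (A + B * E b) * (P b * β₁ b) - (A + B * E a) * (P a * β₁ a) - B * (β b - β a)) ∧
      IntervalIntegrable (fun y => scaleCutoff E a₁ a₀ b₀ b₁ y * g y) volume a b := by
    intro a b hab hs A B hc
    have hcongr : Set.EqOn (fun y => (A + B * E y) * g y)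
        (fun y => scaleCutoff E a₁ a₀ b₀ b₁ y * g y) (Set.uIoc a b) := by
      intro y hy
      rw [Set.uIoc_of_le hab] at hy
      simp only [hc y hy]
    constructor
    · rw [← integral_affine_scale hab (fun y hy => hE y (hs hy)) (fun y hy => hP y (hs hy))
        (fun y hy => hβ y (hs hy)) (fun y hy => hg y (hs hy)) (hgc.mono hs)]
      exact (intervalIntegral.integral_congr_ae (ae_of_all _ hcongr)).symm
    · refine IntervalIntegrable.congr hcongr ?_
      apply ContinuousOn.intervalIntegrable
      rw [Set.uIcc_of_le hab]
      exact (continuousOn_const.add (continuousOn_const.mul (hEc.mono hs))).mul (hgc.mono hs)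
  obtain ⟨p1, i1⟩ := piece ha.le s1 (-E a₁ / (E a₀ - E a₁)) (1 / (E a₀ - E a₁)) (fun y hy => by
    rw [scaleCutoff, if_pos hy.2]; ring)
  obtain ⟨p2, i2⟩ := piece h0 s2 1 0 (fun y hy => by
    rw [scaleCutoff, if_neg (not_le.2 hy.1), if_pos hy.2]; ring)
  obtain ⟨p3, i3⟩ := piece hb.le s3 (E b₁ / (E b₁ - E b₀)) (-1 / (E b₁ - E b₀)) (fun y hy => by
    rw [scaleCutoff, if_neg (not_le.2 (h0.trans_lt hy.1)), if_neg (not_le.2 hy.1)]; ring)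
  rw [← intervalIntegral.integral_add_adjacent_intervals (i1.trans i2) i3,
    ← intervalIntegral.integral_add_adjacent_intervals i1 i2, p1, p2, p3]
  field_simp
  ring

theorem scaleCutoff_mem_Icc (ha : a₁ < a₀) (h0 : a₀ ≤ b₀) (hb : b₀ < b₁)
    (hmono : StrictMonoOn E (Set.Icc a₁ b₁)) {y : ℝ} (hy : y ∈ Set.Icc a₁ b₁) :
    scaleCutoff E a₁ a₀ b₀ b₁ y ∈ Set.Icc (0 : ℝ) 1 := by
  have ma1 : a₁ ∈ Set.Icc a₁ b₁ := ⟨le_rfl, by linarith⟩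
  have ma0 : a₀ ∈ Set.Icc a₁ b₁ := ⟨by linarith, by linarith⟩
  have mb0 : b₀ ∈ Set.Icc a₁ b₁ := ⟨by linarith, by linarith⟩
  have mb1 : b₁ ∈ Set.Icc a₁ b₁ := ⟨by linarith, le_rfl⟩
  have hEa := hmono ma1 ma0 ha
  have hEb := hmono mb0 mb1 hb
  unfold scaleCutoff
  split_ifs with h1 h2
  · have e1 := hmono.monotoneOn ma1 hy hy.1
    have e2 := hmono.monotoneOn hy ma0 h1
    exact ⟨div_nonneg (by linarith) (by linarith), (div_le_one (by linarith)).2 (by linarith)⟩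
  · exact ⟨zero_le_one, le_rfl⟩
  · have e1 := hmono.monotoneOn mb0 hy (not_le.1 h2).le
    have e2 := hmono.monotoneOn hy mb1 hy.2
    exact ⟨div_nonneg (by linarith) (by linarith), (div_le_one (by linarith)).2 (by linarith)⟩

/-- A finite measure between the restrictions of `w dx` to `[a₀, b₀]` and to `[a₁, b₁]` against
which `w⁻¹ (P β')'` integrates to a difference of slopes of `β` in the scale function `E`. -/
theorem exists_cutoff_measure (hoc : I.OrdConnected)
    (hE : ∀ y ∈ I, HasDerivAt E (1 / P y) y) (hP : ∀ y ∈ I, 0 < P y) (hw : ContinuousOn w I)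
    (hw0 : ∀ y ∈ I, 0 < w y) (ha : a₁ < a₀) (h0 : a₀ ≤ b₀) (hb : b₀ < b₁) (ha₁ : a₁ ∈ I)
    (hb₁ : b₁ ∈ I) :
    ∃ ν : Measure ℝ, IsFiniteMeasure ν ∧
      ν ≤ (volume.restrict I).withDensity (fun x => ENNReal.ofReal (w x)) ∧
      ν (Set.Icc a₁ b₁)ᶜ = 0 ∧
      ((volume.restrict I).withDensity (fun x => ENNReal.ofReal (w x))).restrict (Set.Icc a₀ b₀)
        ≤ ν ∧
      ∀ β β₁ g : ℝ → ℝ, (∀ y ∈ Set.Icc a₁ b₁, HasDerivAt β (β₁ y) y) →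
        (∀ y ∈ Set.Icc a₁ b₁, HasDerivAt (fun y => P y * β₁ y) (w y * g y) y) →
        ContinuousOn g (Set.Icc a₁ b₁) →
        ∫ y, g y ∂ν = (β b₁ - β b₀) / (E b₁ - E b₀) - (β a₀ - β a₁) / (E a₀ - E a₁) := by
  have hsub : Set.Icc a₁ b₁ ⊆ I := hoc.out ha₁ hb₁
  have hmono := strictMonoOn_scale (Set.ordConnected_Icc (a := a₁) (b := b₁))
    (fun y hy => hE y (hsub hy)) (fun y hy => hP y (hsub hy))
  set χ := scaleCutoff E a₁ a₀ b₀ b₁ with hχ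
  have hχ01 : ∀ y ∈ Set.Icc a₁ b₁, χ y ∈ Set.Icc (0 : ℝ) 1 := fun y hy =>
    scaleCutoff_mem_Icc ha h0 hb hmono hy
  have hEc : ContinuousOn E (Set.Icc a₁ b₁) := fun y hy =>
    (hE y (hsub hy)).continuousAt.continuousWithinAt
  have hm : MeasurableSet (Set.Icc a₁ b₁) := measurableSet_Icc
  -- a globally measurable version of `χ w` on `[a₁, b₁]`
  have hχm : AEMeasurable (fun y => χ y * w y) (volume.restrict (Set.Icc a₁ b₁)) := by
    refine AEMeasurable.mul ?_ ((hw.mono hsub).aemeasurable hm)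
    have hE1 : AEMeasurable E (volume.restrict (Set.Icc a₁ b₁)) := hEc.aemeasurable hm
    obtain ⟨E', hE'm, hE'⟩ := hE1
    refine ⟨fun y => if y ≤ a₀ then (E' y - E a₁) / (E a₀ - E a₁)
      else if y ≤ b₀ then 1 else (E b₁ - E' y) / (E b₁ - E b₀), ?_, ?_⟩
    · refine Measurable.ite measurableSet_Iic (by fun_prop)
        (Measurable.ite measurableSet_Iic (by fun_prop) (by fun_prop))
    · filter_upwards [hE'] with y hy
      simp only [hχ, scaleCutoff, hy]
  set ν : Measure ℝ := (volume.restrict (Set.Icc a₁ b₁)).withDensity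
    (fun x => ENNReal.ofReal (χ x * w x)) with hν
  obtain ⟨W, hW⟩ := isCompact_Icc.exists_bound_of_continuousOn (hw.mono hsub)
  refine ⟨ν, ?_, ?_, ?_, ?_, ?_⟩
  · refine isFiniteMeasure_withDensity ?_
    have : ∫⁻ y in Set.Icc a₁ b₁, ENNReal.ofReal (χ y * w y) ≤
        ∫⁻ _ in Set.Icc a₁ b₁, ENNReal.ofReal W := by
      refine setLIntegral_mono' hm fun y hy => ENNReal.ofReal_le_ofReal ?_
      have h1 := hχ01 y hy
      have h2 := (le_abs_self _).trans (hW y hy)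
      have h3 := hw0 y (hsub hy)
      nlinarith [h1.1, h1.2]
    refine ne_top_of_le_ne_top ?_ this
    rw [setLIntegral_const]
    exact ENNReal.mul_ne_top ENNReal.ofReal_ne_top (by simp)
  · calc ν ≤ (volume.restrict (Set.Icc a₁ b₁)).withDensity (fun x => ENNReal.ofReal (w x)) := by
          refine withDensity_mono ?_
          rw [EventuallyLE, ae_restrict_iff' hm]
          refine ae_of_all _ fun y hy => ENNReal.ofReal_le_ofReal ?_
          have h1 := hχ01 y hy
          have h3 := hw0 y (hsub hy)
          nlinarith [h1.1, h1.2]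
      _ ≤ _ := by
          refine Measure.le_iff.2 fun s hs => ?_
          rw [withDensity_apply _ hs, withDensity_apply _ hs]
          exact lintegral_mono' (Measure.restrict_mono le_rfl (Measure.restrict_mono hsub le_rfl))
            le_rfl
  · rw [hν, withDensity_apply _ hm.compl, Measure.restrict_restrict hm.compl]
    simp
  · have hs0 : Set.Icc a₀ b₀ ⊆ Set.Icc a₁ b₁ := Set.Icc_subset_Icc ha.le hb.le
    rw [restrict_withDensity measurableSet_Icc, Measure.restrict_restrict measurableSet_Icc,
      Set.inter_eq_left.2 (hs0.trans hsub)]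
    have hnull : ∀ᵐ y ∂(volume.restrict (Set.Icc a₀ b₀)), y ≠ a₀ :=
      ae_restrict_of_ae (by simp [ae_iff])
    have : (volume.restrict (Set.Icc a₀ b₀)).withDensity (fun x => ENNReal.ofReal (w x))
        = (volume.restrict (Set.Icc a₀ b₀)).withDensity (fun x => ENNReal.ofReal (χ x * w x)) := by
      refine withDensity_congr_ae ?_
      filter_upwards [hnull, ae_restrict_mem measurableSet_Icc] with y hy hy'
      have : χ y = 1 := by
        rw [hχ, scaleCutoff, if_neg (not_le.2 (lt_of_le_of_ne hy'.1 hy.symm)), if_pos hy'.2]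
      rw [this, one_mul]
    rw [this]
    refine Measure.le_iff.2 fun s hs => ?_
    rw [withDensity_apply _ hs, withDensity_apply _ hs]
    exact lintegral_mono' (Measure.restrict_mono le_rfl (Measure.restrict_mono hs0 le_rfl)) le_rfl
  · intro β β₁ g hβ hg hgc
    rw [← integral_scaleCutoff_mul ha h0 hb (fun y hy => hE y (hsub hy))
      (fun y hy => hP y (hsub hy)) hβ hg ((hw.mono hsub).mul hgc),
      intervalIntegral.integral_of_le (by linarith), ← integral_Icc_eq_integral_Ioc,
      integral_withDensity_eq_integral_toReal_smul₀ hχm.ennreal_ofReal (by simp)]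
    refine setIntegral_congr_fun hm fun y hy => ?_
    have h1 := hχ01 y hy
    have h3 := hw0 y (hsub hy)
    simp only [smul_eq_mul]
    rw [ENNReal.toReal_ofReal (mul_nonneg h1.1 h3.le), mul_assoc]

end Scale

/-! ### The eigenfunctions in one variable -/

namespace OrthExpansion

variable {d : ℕ} (S : OrthExpansion d)

theorem isOpen_X1 (i : Fin d) : IsOpen (S.X1 i) :=
  (isOpen_lt continuous_const continuous_coe_real_ereal).inter
    (isOpen_lt continuous_coe_real_ereal continuous_const)

theorem ordConnected_X1 (i : Fin d) : (S.X1 i).OrdConnected :=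
  ⟨fun _ hx _ hy _ hz => ⟨hx.1.trans_le (EReal.coe_le_coe_iff.2 hz.1),
    (EReal.coe_le_coe_iff.2 hz.2).trans_lt hy.2⟩⟩

theorem nonempty_X1 (hS : S.Standing) (i : Fin d) : (S.X1 i).Nonempty := by
  obtain ⟨x, h1, h2⟩ := EReal.lt_iff_exists_real_btwn.1 (hS.lo_lt_hi i)
  exact ⟨x, h1, h2⟩

instance (i : Fin d) : SigmaFinite (S.mu1 i) := SigmaFinite.withDensity_ofReal _

/-- The coefficient `p_i² w_i` of the second order operator `f ↦ w_i⁻¹ (p_i² w_i f')'`. -/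
def diffusion (i : Fin d) (y : ℝ) : ℝ := S.pc i y ^ 2 * S.w i y

variable {S}

theorem hasDerivAt_of_contDiffOn {i : Fin d} {f : ℝ → ℝ} (hf : ContDiffOn ℝ ∞ f (S.X1 i)) {x : ℝ}
    (hx : x ∈ S.X1 i) :
    HasDerivAt f (deriv f x) x ∧ HasDerivAt (deriv f) (deriv (deriv f) x) x := by
  have ho := S.isOpen_X1 i
  have h2 : ContDiffOn ℝ 1 (deriv f) (S.X1 i) := hf.deriv_of_isOpen ho (by norm_cast)
  exact ⟨((hf.differentiableOn (by simp)).differentiableAt (ho.mem_nhds hx)).hasDerivAt,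
    ((h2.differentiableOn (by simp)).differentiableAt (ho.mem_nhds hx)).hasDerivAt⟩

theorem continuousOn_deriv_coeff {i : Fin d} {f : ℝ → ℝ} (hf : ContDiffOn ℝ ∞ f (S.X1 i)) :
    ContinuousOn (deriv f) (S.X1 i) := fun _ hx =>
  (hasDerivAt_of_contDiffOn hf hx).2.continuousAt.continuousWithinAt

namespace Standing

variable (hS : S.Standing) (i : Fin d)
include hS

theorem diffusion_pos {x : ℝ} (hx : x ∈ S.X1 i) : 0 < S.diffusion i x := by
  have := hS.w_pos i x hx
  have := hS.pc_ne_zero i x hx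
  unfold diffusion
  positivity

theorem continuousOn_diffusion : ContinuousOn (S.diffusion i) (S.X1 i) :=
  ((hS.pc_smooth i).continuousOn.pow 2).mul (hS.w_smooth i).continuousOn

theorem hasDerivAt_phi1 (k : ℕ) {x : ℝ} (hx : x ∈ S.X1 i) :
    HasDerivAt (S.phi1 i k) (deriv (S.phi1 i k) x) x ∧
      HasDerivAt (deriv (S.phi1 i k)) (deriv (deriv (S.phi1 i k)) x) x := by
  have ho := S.isOpen_X1 i
  have h2 : ContDiffOn ℝ 1 (deriv (S.phi1 i k)) (S.X1 i) :=
    (hS.phi_contDiff i k).deriv_of_isOpen ho (by norm_num)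
  exact ⟨(((hS.phi_contDiff i k).differentiableOn (by simp)).differentiableAt
    (ho.mem_nhds hx)).hasDerivAt,
    ((h2.differentiableOn (by simp)).differentiableAt (ho.mem_nhds hx)).hasDerivAt⟩

theorem hasDerivAt_delta1 (k : ℕ) {x : ℝ} (hx : x ∈ S.X1 i) :
    HasDerivAt (S.delta1 i (S.phi1 i k))
      (deriv (S.pc i) x * deriv (S.phi1 i k) x + S.pc i x * deriv (deriv (S.phi1 i k)) x
        + (deriv (S.qc i) x * S.phi1 i k x + S.qc i x * deriv (S.phi1 i k) x)) x :=
  ((hasDerivAt_of_contDiffOn (hS.pc_smooth i) hx).1.mul (hS.hasDerivAt_phi1 i k hx).2).add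
    ((hasDerivAt_of_contDiffOn (hS.qc_smooth i) hx).1.mul (hS.hasDerivAt_phi1 i k hx).1)

/-- The eigenvalue equation, written as a first order system for `φ` and `δφ`. -/
theorem deriv_delta1_eq (k : ℕ) {x : ℝ} (hx : x ∈ S.X1 i) :
    deriv (S.pc i) x * S.w i x * S.delta1 i (S.phi1 i k) x
      + S.pc i x * deriv (S.w i) x * S.delta1 i (S.phi1 i k) x
      + S.pc i x * S.w i x * deriv (S.delta1 i (S.phi1 i k)) x =
    S.w i x * (S.qc i x * S.delta1 i (S.phi1 i k) x + (S.a i - S.ev i k) * S.phi1 i k x) := by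
  have hw := hS.w_pos i x hx
  have e := hS.phi_eigen i k x hx
  have hd : HasDerivAt (fun y => S.pc i y * S.w i y * S.delta1 i (S.phi1 i k) y)
      ((deriv (S.pc i) x * S.w i x + S.pc i x * deriv (S.w i) x) * S.delta1 i (S.phi1 i k) x
        + S.pc i x * S.w i x * deriv (S.delta1 i (S.phi1 i k)) x) x :=
    ((hasDerivAt_of_contDiffOn (hS.pc_smooth i) hx).1.mul
      (hasDerivAt_of_contDiffOn (hS.w_smooth i) hx).1).mul
      (hS.hasDerivAt_delta1 i k hx).differentiableAt.hasDerivAt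
  unfold L1 delta1Adj at e
  rw [hd.deriv] at e
  field_simp at e
  linear_combination -e

theorem hasDerivAt_diffusion_phi1 (k : ℕ) {x : ℝ} (hx : x ∈ S.X1 i) :
    HasDerivAt (fun y => S.diffusion i y * deriv (S.phi1 i k) y)
      (S.w i x * ((S.r1 i x - S.ev i k) * S.phi1 i k x)) x := by
  have hw := hS.w_pos i x hx
  have hp := (hasDerivAt_of_contDiffOn (hS.pc_smooth i) hx).1
  have hw' := (hasDerivAt_of_contDiffOn (hS.w_smooth i) hx).1
  have e := hS.deriv_delta1_eq i k hx
  rw [(hS.hasDerivAt_delta1 i k hx).deriv] at e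
  refine (((hp.fun_pow 2).mul hw').mul (hS.hasDerivAt_phi1 i k hx).2).congr_deriv ?_
  have e1 : S.r1 i x * S.w i x = S.w i x * (S.a i + S.qc i x ^ 2 - S.pc i x * deriv (S.qc i) x
      - deriv (S.pc i) x * S.qc i x) - S.pc i x * S.qc i x * deriv (S.w i) x := by
    unfold r1; field_simp; ring
  unfold delta1 at e
  simp only [Pi.mul_apply, Nat.cast_ofNat]
  linear_combination e - S.phi1 i k x * e1

theorem hasDerivAt_diffusion_delta1 (k : ℕ) {x : ℝ} (hx : x ∈ S.X1 i) :
    HasDerivAt (fun y => S.diffusion i y * deriv (S.delta1 i (S.phi1 i k)) y)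
      (S.w i x * ((S.r1 i x + S.v i x - S.ev i k) * S.delta1 i (S.phi1 i k) x)) x := by
  have hw := hS.w_pos i x hx
  have hpne := hS.pc_ne_zero i x hx
  obtain ⟨hp, hp2⟩ := hasDerivAt_of_contDiffOn (hS.pc_smooth i) hx
  obtain ⟨hw', hw2⟩ := hasDerivAt_of_contDiffOn (hS.w_smooth i) hx
  obtain ⟨hq, -⟩ := hasDerivAt_of_contDiffOn (hS.qc_smooth i) hx
  have hφ := (hS.hasDerivAt_phi1 i k hx).1
  have hψ := (hS.hasDerivAt_delta1 i k hx).differentiableAt.hasDerivAt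
  have heq : (fun y => S.diffusion i y * deriv (S.delta1 i (S.phi1 i k)) y) =ᶠ[𝓝 x]
      fun y => S.pc i y * (S.w i y * (S.qc i y * S.delta1 i (S.phi1 i k) y
        + (S.a i - S.ev i k) * S.phi1 i k y)
        - (deriv (S.pc i) y * S.w i y + S.pc i y * deriv (S.w i) y)
          * S.delta1 i (S.phi1 i k) y) := by
    filter_upwards [(S.isOpen_X1 i).mem_nhds hx] with y hy
    have := hS.deriv_delta1_eq i k hy
    unfold diffusion
    linear_combination S.pc i y * this
  refine HasDerivAt.congr_of_eventuallyEq ?_ heq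
  refine (hp.mul ((hw'.mul ((hq.mul hψ).add (hφ.const_mul _))).sub
    (((hp2.mul hw').add (hp.mul hw2)).mul hψ))).congr_deriv ?_
  have e := hS.deriv_delta1_eq i k hx
  have hv : deriv (fun y => S.pc i y * (deriv (S.w i) y / S.w i y)) x = _ :=
    (hp.mul (hw2.div hw' hw.ne')).deriv
  have hφ' : deriv (S.phi1 i k) x =
      (S.delta1 i (S.phi1 i k) x - S.qc i x * S.phi1 i k x) / S.pc i x := by
    unfold delta1; field_simp; ring
  have hψ' : deriv (S.delta1 i (S.phi1 i k)) x =
      (S.w i x * (S.qc i x * S.delta1 i (S.phi1 i k) x + (S.a i - S.ev i k) * S.phi1 i k x)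
        - (deriv (S.pc i) x * S.w i x + S.pc i x * deriv (S.w i) x) * S.delta1 i (S.phi1 i k) x)
        / (S.pc i x * S.w i x) := by
    field_simp; linear_combination e
  unfold v r1
  rw [hv, hφ', hψ']
  simp only [Pi.mul_apply, Pi.add_apply, Pi.div_apply, Pi.sub_apply]
  field_simp
  ring

end Standing

/-- `φ^i_k` for `ψ = false` and `δ_i φ^i_k` for `ψ = true`. -/
noncomputable def mode1 (S : OrthExpansion d) (i : Fin d) (ψ : Bool) (k : ℕ) : ℝ → ℝ :=
  if ψ then S.delta1 i (S.phi1 i k) else S.phi1 i k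

/-- The potential of the operator having `S.mode1 i ψ k` as eigenfunctions: `r_i`, increased by the
commutator `v_i` in the case of `δ_i φ^i_k`. -/
noncomputable def potential1 (S : OrthExpansion d) (i : Fin d) (ψ : Bool) (x : ℝ) : ℝ :=
  S.r1 i x + if ψ then S.v i x else 0

namespace Standing

variable (hS : S.Standing) (i : Fin d) (ψ : Bool) (k : ℕ)
include hS

theorem hasDerivAt_mode1 {x : ℝ} (hx : x ∈ S.X1 i) :
    HasDerivAt (S.mode1 i ψ k) (deriv (S.mode1 i ψ k) x) x := by
  cases ψ
  · exact (hS.hasDerivAt_phi1 i k hx).1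
  · exact (hS.hasDerivAt_delta1 i k hx).differentiableAt.hasDerivAt

theorem hasDerivAt_diffusion_mode1 {x : ℝ} (hx : x ∈ S.X1 i) :
    HasDerivAt (fun y => S.diffusion i y * deriv (S.mode1 i ψ k) y)
      (S.w i x * ((S.potential1 i ψ x - S.ev i k) * S.mode1 i ψ k x)) x := by
  cases ψ
  · simpa [mode1, potential1] using hS.hasDerivAt_diffusion_phi1 i k hx
  · simpa [mode1, potential1] using hS.hasDerivAt_diffusion_delta1 i k hx

theorem continuousOn_mode1 : ContinuousOn (S.mode1 i ψ k) (S.X1 i) := fun _ hx =>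
  (hS.hasDerivAt_mode1 i ψ k hx).continuousAt.continuousWithinAt

theorem continuousOn_deriv_mode1 : ContinuousOn (deriv (S.mode1 i ψ k)) (S.X1 i) := by
  have h1 : ContinuousOn (fun y => S.diffusion i y * deriv (S.mode1 i ψ k) y) (S.X1 i) :=
    fun x hx => (hS.hasDerivAt_diffusion_mode1 i ψ k hx).continuousAt.continuousWithinAt
  refine (h1.div (hS.continuousOn_diffusion i) fun x hx => (hS.diffusion_pos i hx).ne').congr
    fun x hx => ?_
  have := hS.diffusion_pos i hx
  simp only [Pi.div_apply]
  field_simp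

theorem continuousOn_r1 : ContinuousOn (S.r1 i) (S.X1 i) := by
  have h1 := (hS.pc_smooth i).continuousOn
  have h2 := (hS.qc_smooth i).continuousOn
  have h3 := (hS.w_smooth i).continuousOn
  have h4 := continuousOn_deriv_coeff (hS.pc_smooth i)
  have h5 := continuousOn_deriv_coeff (hS.qc_smooth i)
  have h6 := continuousOn_deriv_coeff (hS.w_smooth i)
  have h7 : ∀ x ∈ S.X1 i, S.w i x ≠ 0 := fun x hx => (hS.w_pos i x hx).ne'
  unfold r1
  fun_prop (disch := assumption)

theorem continuousOn_v : ContinuousOn (S.v i) (S.X1 i) := by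
  have ho := S.isOpen_X1 i
  have h1 := (hS.pc_smooth i).continuousOn
  have h5 := continuousOn_deriv_coeff (hS.qc_smooth i)
  have h7 : ∀ x ∈ S.X1 i, S.w i x ≠ 0 := fun x hx => (hS.w_pos i x hx).ne'
  have hp2 : ContinuousOn (deriv (deriv (S.pc i))) (S.X1 i) :=
    continuousOn_deriv_coeff ((hS.pc_smooth i).deriv_of_isOpen ho (by norm_cast))
  have hz : ContinuousOn (deriv fun y => S.pc i y * (deriv (S.w i) y / S.w i y)) (S.X1 i) :=
    continuousOn_deriv_coeff ((hS.pc_smooth i).mul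
      (((hS.w_smooth i).deriv_of_isOpen ho (by norm_cast)).div (hS.w_smooth i) h7))
  unfold v
  fun_prop

theorem continuousOn_potential1 : ContinuousOn (S.potential1 i ψ) (S.X1 i) := by
  cases ψ
  · exact (hS.continuousOn_r1 i).add continuousOn_const
  · exact (hS.continuousOn_r1 i).add (hS.continuousOn_v i)

end Standing

end OrthExpansion

/-! ### Cutoff measures in one variable -/

namespace OrthExpansion

variable {d : ℕ} {S : OrthExpansion d}

theorem exists_of_eventually_toHi (hS : S.Standing) (i : Fin d) {Q : ℝ → Prop}
    (h : ∀ᶠ x in S.toHi i, Q x) : ∃ z ∈ S.X1 i, ∀ y ∈ S.X1 i, z ≤ y → Q y := by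
  obtain ⟨t, ht, hts⟩ := Filter.mem_comap.1 h
  obtain ⟨x, hx⟩ := S.nonempty_X1 hS i
  obtain ⟨l, hl, hlt⟩ := (mem_nhdsLT_iff_exists_Ioo_subset' hx.2).1 ht
  obtain ⟨z, hz1, hz2⟩ := EReal.lt_iff_exists_real_btwn.1 (max_lt hl hx.2)
  refine ⟨z, ⟨hx.1.trans ((le_max_right _ _).trans_lt hz1), hz2⟩, fun y hy hzy => hts (hlt ⟨?_, hy.2⟩)⟩
  exact ((le_max_left _ _).trans_lt hz1).trans_le (EReal.coe_le_coe_iff.2 hzy)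

theorem exists_of_eventually_toLo (hS : S.Standing) (i : Fin d) {Q : ℝ → Prop}
    (h : ∀ᶠ x in S.toLo i, Q x) : ∃ z ∈ S.X1 i, ∀ y ∈ S.X1 i, y ≤ z → Q y := by
  obtain ⟨t, ht, hts⟩ := Filter.mem_comap.1 h
  obtain ⟨x, hx⟩ := S.nonempty_X1 hS i
  obtain ⟨l, hl, hlt⟩ := (mem_nhdsGT_iff_exists_Ioo_subset' hx.1).1 ht
  obtain ⟨z, hz1, hz2⟩ := EReal.lt_iff_exists_real_btwn.1 (lt_min hl hx.1)
  refine ⟨z, ⟨hz1, (hz2.trans_le (min_le_right _ _)).trans hx.2⟩, fun y hy hzy => hts (hlt ⟨hy.1, ?_⟩)⟩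
  exact (EReal.coe_le_coe_iff.2 hzy).trans_lt (hz2.trans_le (min_le_left _ _))

/-- The boundary condition (T2) in the form of decay of `p² w h'` and `h^{2m+1} p² w h'` for
`h = φ^i_k` and `h = δ_i φ^i_k`. -/
theorem eventually_decay (hT2 : S.T2) (i : Fin d) (ψ : Bool) (k m : ℕ) {l : Filter ℝ}
    (hl : l ∈ ({S.toLo i, S.toHi i} : Set (Filter ℝ))) {ε : ℝ} (hε : 0 < ε) :
    ∀ᶠ y in l, |S.diffusion i y * deriv (S.mode1 i ψ k) y| ≤ ε ∧
      |S.mode1 i ψ k y ^ (2 * m + 1) * (S.diffusion i y * deriv (S.mode1 i ψ k) y)| ≤ ε := by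
  have hN : (0 : ℝ) < ((2 * m + 1 : ℕ) : ℝ) := by positivity
  obtain ⟨h1, h2⟩ := hT2 i k _ _ hN hN l hl
  have key : Tendsto (fun x => (1 + |S.phi1 i k x| ^ ((2 * m + 1 : ℕ) : ℝ)
      + |S.delta1 i (S.phi1 i k) x| ^ ((2 * m + 1 : ℕ) : ℝ)) *
      (S.diffusion i x * deriv (S.mode1 i ψ k) x)) l (𝓝 0) := by
    cases ψ
    · exact h1
    · exact h2
  filter_upwards [key.abs.eventually (ge_mem_nhds (by simpa using hε))] with y hy
  simp only [Real.rpow_natCast] at hy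
  rw [abs_mul, abs_of_nonneg (by positivity)] at hy
  have hD := abs_nonneg (S.diffusion i y * deriv (S.mode1 i ψ k) y)
  have a1 : 0 ≤ |S.phi1 i k y| ^ (2 * m + 1) := by positivity
  have a2 : 0 ≤ |S.delta1 i (S.phi1 i k) y| ^ (2 * m + 1) := by positivity
  refine ⟨le_trans ?_ hy, le_trans ?_ hy⟩
  · nlinarith
  · rw [abs_mul, abs_pow]
    gcongr
    cases ψ <;> simp only [mode1, Bool.false_eq_true, if_true, if_false] <;> linarith

/-- The sum of the absolute values of the `φ^i_k` and `δ_i φ^i_k` with `k ∈ T`. -/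
noncomputable def envelope (S : OrthExpansion d) (T : Finset ℕ) (i : Fin d) (y : ℝ) : ℝ :=
  ∑ k ∈ T, ∑ ψ, |S.mode1 i ψ k y|

/-- The increment, between `x` and `y`, of the functions `φ^i_k` and `δ_i φ^i_k` with `k ∈ T`. -/
noncomputable def increment (S : OrthExpansion d) (T : Finset ℕ) (i : Fin d) (x y : ℝ) : ℝ :=
  ∑ k ∈ T, ∑ ψ, |S.mode1 i ψ k y - S.mode1 i ψ k x|

theorem envelope_nonneg (T : Finset ℕ) (i : Fin d) (y : ℝ) : 0 ≤ S.envelope T i y :=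
  Finset.sum_nonneg fun _ _ => Finset.sum_nonneg fun _ _ => abs_nonneg _

theorem increment_nonneg (T : Finset ℕ) (i : Fin d) (x y : ℝ) : 0 ≤ S.increment T i x y :=
  Finset.sum_nonneg fun _ _ => Finset.sum_nonneg fun _ _ => abs_nonneg _

theorem abs_mode1_le_envelope {T : Finset ℕ} (i : Fin d) (ψ : Bool) {k : ℕ} (hk : k ∈ T) (y : ℝ) :
    |S.mode1 i ψ k y| ≤ S.envelope T i y :=
  (Finset.single_le_sum (f := fun ψ => |S.mode1 i ψ k y|) (fun _ _ => abs_nonneg _)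
    (Finset.mem_univ ψ)).trans
    (Finset.single_le_sum (f := fun k => ∑ ψ, |S.mode1 i ψ k y|)
      (fun _ _ => Finset.sum_nonneg fun _ _ => abs_nonneg _) hk)

theorem abs_sub_le_increment {T : Finset ℕ} (i : Fin d) (ψ : Bool) {k : ℕ} (hk : k ∈ T)
    (x y : ℝ) : |S.mode1 i ψ k y - S.mode1 i ψ k x| ≤ S.increment T i x y :=
  (Finset.single_le_sum (f := fun ψ => |S.mode1 i ψ k y - S.mode1 i ψ k x|)
    (fun _ _ => abs_nonneg _) (Finset.mem_univ ψ)).trans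
    (Finset.single_le_sum (f := fun k => ∑ ψ, |S.mode1 i ψ k y - S.mode1 i ψ k x|)
      (fun _ _ => Finset.sum_nonneg fun _ _ => abs_nonneg _) hk)

theorem sum_sum_bool_le {T : Finset ℕ} {f : ℕ → Bool → ℝ} {R : ℝ}
    (h : ∀ k ∈ T, ∀ ψ, f k ψ ≤ R) : ∑ k ∈ T, ∑ ψ, f k ψ ≤ (2 * T.card) * R := by
  calc ∑ k ∈ T, ∑ ψ, f k ψ ≤ ∑ k ∈ T, (2 * R) := by
        refine Finset.sum_le_sum fun k hk => ?_
        rw [Fintype.sum_bool]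
        linarith [h k hk true, h k hk false]
    _ = _ := by rw [Finset.sum_const, nsmul_eq_mul]; ring

/-- Smallness of the functions in the expansion at the outer point `y`, or of their increments from
`x` to the outer point `y`, relative to the increment `Δ` of the scale function. -/
def FlatPiece (S : OrthExpansion d) (T : Finset ℕ) (i : Fin d) (m : ℕ) (M η x y Δ : ℝ) : Prop :=
  0 < Δ ∧ ((1 + S.envelope T i y) ^ (2 * m + 2) ≤ η * Δ ∨
    (S.envelope T i x ≤ M ∧ S.envelope T i y ≤ M ∧ S.increment T i x y ≤ η * Δ))

theorem flatPiece_of_forall {T : Finset ℕ} {i : Fin d} {m : ℕ} {M η x y Δ : ℝ} (hη : 0 < η)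
    (hΔ : 0 < Δ)
    (h : (∀ k : T × Bool, 1 + S.mode1 i k.2 k.1 y ^ (2 * m + 2) ≤
          η / (2 * T.card + 1) ^ (2 * m + 2) * Δ) ∨
      ∀ k : T × Bool, |S.mode1 i k.2 k.1 x| ≤ M ∧ |S.mode1 i k.2 k.1 y| ≤ M ∧
        |S.mode1 i k.2 k.1 y - S.mode1 i k.2 k.1 x| ≤
          η / (2 * T.card + 1) ^ (2 * m + 2) * Δ) :
    S.FlatPiece T i m (2 * T.card * M) η x y Δ := by
  refine ⟨hΔ, ?_⟩
  -- the empty sum is flat for trivial reasons, while a nonempty `T` forces `1 ≤ η Δ` below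
  rcases T.eq_empty_or_nonempty with rfl | ⟨k₀, hk₀⟩
  · right
    simp only [envelope, increment, Finset.sum_empty, Finset.card_empty]
    refine ⟨by simp, by simp, by positivity⟩
  set n : ℝ := 2 * T.card + 1 with hn
  have hn1 : 1 ≤ n := by rw [hn]; linarith [Nat.cast_nonneg (α := ℝ) T.card]
  have hnN : n ≤ n ^ (2 * m + 2) := le_self_pow₀ hn1 (by omega)
  rcases h with h | h
  · left
    set D := η / n ^ (2 * m + 2) * Δ with hD
    have hD1 : 1 ≤ D := by
      have h0 := h (⟨k₀, hk₀⟩, true)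
      have : 0 ≤ S.mode1 i true k₀ y ^ (2 * m + 2) := by
        rw [show 2 * m + 2 = 2 * (m + 1) by ring, pow_mul]; positivity
      simp only at h0
      linarith
    set ρ := D ^ (((2 * m + 2 : ℕ) : ℝ)⁻¹) with hρ
    have hρN : ρ ^ (2 * m + 2) = D := Real.rpow_inv_natCast_pow (by linarith) (by omega)
    have hρ1 : 1 ≤ ρ := Real.one_le_rpow hD1 (by positivity)
    have hle : ∀ k ∈ T, ∀ ψ, |S.mode1 i ψ k y| ≤ ρ := by
      intro k hk ψ
      refine le_of_pow_le_pow_left₀ (n := 2 * m + 2) (by omega) (by linarith) ?_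
      have h0 := h (⟨k, hk⟩, ψ)
      rw [hρN, show 2 * m + 2 = 2 * (m + 1) by ring, pow_mul, sq_abs, ← pow_mul,
        show 2 * (m + 1) = 2 * m + 2 by ring]
      simp only at h0
      linarith
    have he : 1 + S.envelope T i y ≤ n * ρ := by
      have := sum_sum_bool_le hle
      unfold envelope
      rw [hn]; linarith
    calc (1 + S.envelope T i y) ^ (2 * m + 2) ≤ (n * ρ) ^ (2 * m + 2) :=
          pow_le_pow_left₀ (by linarith [S.envelope_nonneg T i y]) he _
      _ = η * Δ := by rw [mul_pow, hρN, hD]; field_simp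
  · right
    refine ⟨sum_sum_bool_le fun k hk ψ => (h (⟨k, hk⟩, ψ)).1,
      sum_sum_bool_le fun k hk ψ => (h (⟨k, hk⟩, ψ)).2.1, ?_⟩
    calc S.increment T i x y ≤ (2 * T.card) * (η / n ^ (2 * m + 2) * Δ) :=
          sum_sum_bool_le fun k hk ψ => (h (⟨k, hk⟩, ψ)).2.2
      _ ≤ n ^ (2 * m + 2) * (η / n ^ (2 * m + 2) * Δ) := by
          gcongr; linarith
      _ = η * Δ := by field_simp

/-- Finite measures `ν` on `X_i` that approximate `μ_i` from below and annihilate the second order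
operator `w_i⁻¹ (p_i² w_i β')'` up to two slopes of `β` over flat pieces near the end points. -/
theorem exists_coordinate_cutoff (hS : S.Standing) (hT2 : S.T2) (i : Fin d) (T : Finset ℕ)
    (m : ℕ) : ∃ M, 0 ≤ M ∧ ∀ η > 0, ∀ xl ∈ S.X1 i, ∀ xr ∈ S.X1 i, xl ≤ xr →
      ∃ a₁ ∈ S.X1 i, ∃ b₁ ∈ S.X1 i, ∃ a₀ ∈ Set.Icc a₁ b₁, ∃ b₀ ∈ Set.Icc a₁ b₁,
      ∃ Δl Δr : ℝ, S.FlatPiece T i m M η a₀ a₁ Δl ∧ S.FlatPiece T i m M η b₀ b₁ Δr ∧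
      ∃ ν : Measure ℝ, IsFiniteMeasure ν ∧ ν ≤ S.mu1 i ∧ ν (Set.Icc a₁ b₁)ᶜ = 0 ∧
        (S.mu1 i).restrict (Set.Icc xl xr) ≤ ν ∧
        ∀ β β₁ g : ℝ → ℝ, (∀ y ∈ Set.Icc a₁ b₁, HasDerivAt β (β₁ y) y) →
          (∀ y ∈ Set.Icc a₁ b₁, HasDerivAt (fun y => S.diffusion i y * β₁ y) (S.w i y * g y) y) →
          ContinuousOn g (Set.Icc a₁ b₁) →
          ∫ y, g y ∂ν = (β b₁ - β b₀) / Δr + (β a₁ - β a₀) / Δl := by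
  have hI := S.isOpen_X1 i
  have hoc := S.ordConnected_X1 i
  have hne := S.nonempty_X1 hS i
  obtain ⟨E, hE⟩ := exists_scale hI hoc (hS.continuousOn_diffusion i)
    (fun y hy => hS.diffusion_pos i hy)
  have hmono := strictMonoOn_scale hoc hE (fun y hy => hS.diffusion_pos i hy)
  have hh : ∀ k : T × Bool, ∀ y ∈ S.X1 i, HasDerivAt (S.mode1 i k.2 k.1)
      (deriv (S.mode1 i k.2 k.1) y) y := fun k y hy => hS.hasDerivAt_mode1 i k.2 k.1 hy
  obtain ⟨Mr, hMr, Hr⟩ := exists_slope_control_right hI hoc hne hE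
    (fun y hy => hS.diffusion_pos i hy) hh m (fun k ε hε =>
      exists_of_eventually_toHi hS i (eventually_decay hT2 i k.2 k.1 m (by simp) hε))
  obtain ⟨Ml, hMl, Hl⟩ := exists_slope_control_left hI hoc hne hE
    (fun y hy => hS.diffusion_pos i hy) hh m (fun k ε hε =>
      exists_of_eventually_toLo hS i (eventually_decay hT2 i k.2 k.1 m (by simp) hε))
  refine ⟨2 * T.card * max Ml Mr, by positivity, fun η hη xl hxl xr hxr hlr => ?_⟩
  have hη' : 0 < η / (2 * T.card + 1 : ℝ) ^ (2 * m + 2) := by positivity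
  obtain ⟨b₀, hb₀, b₁, hb₁, hxb, hb, Cr⟩ := Hr _ hη' xr hxr
  obtain ⟨a₁, ha₁, a₀, ha₀, hax, ha, Cl⟩ := Hl _ hη' xl hxl
  have hΔr : 0 < E b₁ - E b₀ := sub_pos.2 (hmono hb₀ hb₁ hb)
  have hΔl : 0 < E a₀ - E a₁ := sub_pos.2 (hmono ha₁ ha₀ ha)
  obtain ⟨ν, h1, h2, h3, h4, h5⟩ := exists_cutoff_measure (w := S.w i) hoc hE
    (fun y hy => hS.diffusion_pos i hy) (hS.w_smooth i).continuousOn (hS.w_pos i) ha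
    (hax.trans (hlr.trans hxb)) hb ha₁ hb₁
  refine ⟨a₁, ha₁, b₁, hb₁, a₀, ⟨ha.le, by linarith⟩, b₀, ⟨by linarith, hb.le⟩, E a₀ - E a₁,
    E b₁ - E b₀, ?_, ?_, ν, h1, h2, h3, ?_, ?_⟩
  · refine flatPiece_of_forall hη hΔl (Cl.imp id fun h k => ?_)
    obtain ⟨c1, c2, c3⟩ := h k
    exact ⟨c2.trans (le_max_left _ _), c1.trans (le_max_left _ _), by rwa [abs_sub_comm]⟩
  · refine flatPiece_of_forall hη hΔr (Cr.imp id fun h k => ?_)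
    obtain ⟨c1, c2, c3⟩ := h k
    exact ⟨c1.trans (le_max_right _ _), c2.trans (le_max_right _ _), c3⟩
  · exact (Measure.restrict_mono (Set.Icc_subset_Icc hax hxb) le_rfl).trans h4
  · intro β β₁ g hβ hg hgc
    rw [h5 β β₁ g hβ hg hgc]
    ring

end OrthExpansion

/-! ### Finite expansions and their Poisson extensions -/

namespace OrthExpansion

variable {d : ℕ}

/-- The product of the functions `φ^j_{k_j}` (where `σ j` is `false`) and `δ_j φ^j_{k_j}` (where
`σ j` is `true`). -/
noncomputable def modeProd (S : OrthExpansion d) (σ : Fin d → Bool) (k : Fin d → ℕ)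
    (x : Fin d → ℝ) : ℝ :=
  ∏ j, S.mode1 j (σ j) (k j) (x j)

/-- `S.modeProd σ k` without the factor belonging to the coordinate `i`. -/
noncomputable def modeProdErase (S : OrthExpansion d) (σ : Fin d → Bool) (i : Fin d)
    (k : Fin d → ℕ) (x : Fin d → ℝ) : ℝ :=
  ∏ j ∈ Finset.univ.erase i, S.mode1 j (σ j) (k j) (x j)

/-- The Poisson extension `∑ a_k e^{-t λ_k^{1/2}} m_k(x)` of a finite expansion in the products
`m_k = S.modeProd σ k`. -/
noncomputable def field (S : OrthExpansion d) (s : Finset (Fin d → ℕ)) (σ : Fin d → Bool)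
    (a : (Fin d → ℕ) → ℝ) (t : ℝ) (x : Fin d → ℝ) : ℝ :=
  ∑ k ∈ s, a k * Real.exp (-t * √(S.eigenvalue k)) * S.modeProd σ k x

/-- The partial derivative of `S.field s σ a t` in the coordinate `i`. -/
noncomputable def fieldX (S : OrthExpansion d) (s : Finset (Fin d → ℕ)) (σ : Fin d → Bool)
    (a : (Fin d → ℕ) → ℝ) (i : Fin d) (t : ℝ) (x : Fin d → ℝ) : ℝ :=
  ∑ k ∈ s, a k * Real.exp (-t * √(S.eigenvalue k)) *
    (deriv (S.mode1 i (σ i) (k i)) (x i) * S.modeProdErase σ i k x)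

/-- The image of `S.field s σ a t` under `f ↦ w_i⁻¹ ∂_i (p_i² w_i ∂_i f)`. -/
noncomputable def fieldL (S : OrthExpansion d) (s : Finset (Fin d → ℕ)) (σ : Fin d → Bool)
    (a : (Fin d → ℕ) → ℝ) (i : Fin d) (t : ℝ) (x : Fin d → ℝ) : ℝ :=
  ∑ k ∈ s, a k * Real.exp (-t * √(S.eigenvalue k)) *
    ((S.potential1 i (σ i) (x i) - S.ev i (k i)) * S.modeProd σ k x)

variable {S : OrthExpansion d} {s : Finset (Fin d → ℕ)} {σ : Fin d → Bool}
  {a : (Fin d → ℕ) → ℝ}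

theorem update_mem_X {x : Fin d → ℝ} (hx : x ∈ S.X) {i : Fin d} {y : ℝ} (hy : y ∈ S.X1 i) :
    Function.update x i y ∈ S.X := by
  intro j
  by_cases h : j = i
  · subst h; simpa using hy
  · simpa [h] using hx j

theorem modeProd_eq (σ : Fin d → Bool) (i : Fin d) (k : Fin d → ℕ) (x : Fin d → ℝ) :
    S.modeProd σ k x = S.mode1 i (σ i) (k i) (x i) * S.modeProdErase σ i k x :=
  (Finset.mul_prod_erase _ _ (Finset.mem_univ i)).symm

theorem modeProdErase_update (σ : Fin d → Bool) (i : Fin d) (k : Fin d → ℕ) (x : Fin d → ℝ)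
    (y : ℝ) : S.modeProdErase σ i k (Function.update x i y) = S.modeProdErase σ i k x :=
  Finset.prod_congr rfl fun j hj => by rw [Function.update_of_ne (Finset.ne_of_mem_erase hj)]

theorem modeProd_update (σ : Fin d → Bool) (i : Fin d) (k : Fin d → ℕ) (x : Fin d → ℝ) (y : ℝ) :
    S.modeProd σ k (Function.update x i y) =
      S.mode1 i (σ i) (k i) y * S.modeProdErase σ i k x := by
  rw [modeProd_eq σ i, modeProdErase_update, Function.update_self]

theorem hasDerivAt_field_update (hS : S.Standing) (i : Fin d) (t : ℝ) (x : Fin d → ℝ) {y : ℝ}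
    (hy : y ∈ S.X1 i) :
    HasDerivAt (fun y => S.field s σ a t (Function.update x i y))
      (S.fieldX s σ a i t (Function.update x i y)) y := by
  unfold field fieldX
  simp only [modeProd_update, modeProdErase_update, Function.update_self]
  exact HasDerivAt.fun_sum fun k _ =>
    ((hS.hasDerivAt_mode1 i (σ i) (k i) hy).mul_const _).const_mul _

theorem hasDerivAt_diffusion_fieldX (hS : S.Standing) (i : Fin d) (t : ℝ) (x : Fin d → ℝ) {y : ℝ}
    (hy : y ∈ S.X1 i) :
    HasDerivAt (fun y => S.diffusion i y * S.fieldX s σ a i t (Function.update x i y))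
      (S.w i y * S.fieldL s σ a i t (Function.update x i y)) y := by
  unfold fieldX fieldL
  simp only [modeProd_update, modeProdErase_update, Function.update_self, Finset.mul_sum]
  refine (HasDerivAt.fun_sum fun k _ =>
    ((hS.hasDerivAt_diffusion_mode1 i (σ i) (k i) hy).mul_const
      (a k * Real.exp (-t * √(S.eigenvalue k)) * S.modeProdErase σ i k x))).congr_deriv ?_ |>.congr_of_eventuallyEq
        (Eventually.of_forall fun z => Finset.sum_congr rfl fun k _ => by ring)
  exact Finset.sum_congr rfl fun k _ => by ring

theorem dOp_field (hS : S.Standing) (i : Fin d) (t : ℝ) {x : Fin d → ℝ} (hx : x ∈ S.X) :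
    S.dOp i (S.field s σ a t) x = S.pc i (x i) * S.fieldX s σ a i t x := by
  unfold dOp partialX
  rw [(hasDerivAt_field_update hS i t x (hx i)).deriv, Function.update_eq_self]

theorem hasDerivAt_field_time (t : ℝ) (x : Fin d → ℝ) :
    HasDerivAt (fun t => S.field s σ a t x)
      (S.field s σ (fun k => -√(S.eigenvalue k) * a k) t x) t := by
  unfold field
  refine (HasDerivAt.fun_sum fun k _ => ((((hasDerivAt_id t).neg.mul_const
    (√(S.eigenvalue k))).exp.const_mul (a k)).mul_const (S.modeProd σ k x))).congr_deriv ?_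
  refine Finset.sum_congr rfl fun k _ => ?_
  simp only [Pi.neg_apply, id]
  ring

/-- Harmonicity of the Poisson extension with respect to `∂_t² + ∑ w_i⁻¹ ∂_i (p_i² w_i ∂_i ⬝)`
minus its potential. -/
theorem sum_fieldL_add (hS : S.Standing) (t : ℝ) (x : Fin d → ℝ) :
    S.field s σ (fun k => -√(S.eigenvalue k) * (-√(S.eigenvalue k) * a k)) t x
      + ∑ i, S.fieldL s σ a i t x
      = (∑ i, S.potential1 i (σ i) (x i)) * S.field s σ a t x := by
  unfold field fieldL
  rw [Finset.sum_comm, ← Finset.sum_add_distrib, Finset.mul_sum]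
  refine Finset.sum_congr rfl fun k _ => ?_
  have hsq : √(S.eigenvalue k) * √(S.eigenvalue k) = S.eigenvalue k :=
    Real.mul_self_sqrt (Finset.sum_nonneg fun i _ => hS.ev_nonneg i _)
  rw [← Finset.mul_sum, ← Finset.sum_mul, Finset.sum_sub_distrib]
  have : ∑ i, S.ev i (k i) = S.eigenvalue k := rfl
  rw [this]
  linear_combination a k * Real.exp (-t * √(S.eigenvalue k)) * S.modeProd σ k x * hsq

section Continuity

theorem continuousOn_comp_coord {g : ℝ → ℝ} {j : Fin d} (hg : ContinuousOn g (S.X1 j)) :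
    ContinuousOn (fun z : ℝ × (Fin d → ℝ) => g (z.2 j)) (Set.univ ×ˢ S.X) :=
  hg.comp (by fun_prop) fun z hz => hz.2 j

variable (hS : S.Standing)
include hS

theorem continuousOn_modeProd (k : Fin d → ℕ) :
    ContinuousOn (fun z : ℝ × (Fin d → ℝ) => S.modeProd σ k z.2) (Set.univ ×ˢ S.X) :=
  continuousOn_finsetProd _ fun j _ =>
    continuousOn_comp_coord (hS.continuousOn_mode1 j (σ j) (k j))

theorem continuousOn_field :
    ContinuousOn (fun z : ℝ × (Fin d → ℝ) => S.field s σ a z.1 z.2) (Set.univ ×ˢ S.X) :=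
  continuousOn_finsetSum _ fun k _ =>
    (by fun_prop : Continuous fun z : ℝ × (Fin d → ℝ) =>
      a k * Real.exp (-z.1 * √(S.eigenvalue k))).continuousOn.mul (continuousOn_modeProd hS k)

theorem continuousOn_fieldX (i : Fin d) :
    ContinuousOn (fun z : ℝ × (Fin d → ℝ) => S.fieldX s σ a i z.1 z.2) (Set.univ ×ˢ S.X) :=
  continuousOn_finsetSum _ fun k _ =>
    (by fun_prop : Continuous fun z : ℝ × (Fin d → ℝ) =>
      a k * Real.exp (-z.1 * √(S.eigenvalue k))).continuousOn.mul
      ((continuousOn_comp_coord (hS.continuousOn_deriv_mode1 i (σ i) (k i))).mul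
        (continuousOn_finsetProd _ fun j _ =>
          continuousOn_comp_coord (hS.continuousOn_mode1 j (σ j) (k j))))

theorem continuousOn_fieldL (i : Fin d) :
    ContinuousOn (fun z : ℝ × (Fin d → ℝ) => S.fieldL s σ a i z.1 z.2) (Set.univ ×ˢ S.X) :=
  continuousOn_finsetSum _ fun k _ =>
    (by fun_prop : Continuous fun z : ℝ × (Fin d → ℝ) =>
      a k * Real.exp (-z.1 * √(S.eigenvalue k))).continuousOn.mul
      (((continuousOn_comp_coord (hS.continuousOn_potential1 i (σ i))).sub
        continuousOn_const).mul (continuousOn_modeProd hS k))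

end Continuity

/-! ### Pointwise bounds -/

/-- The product of the envelopes of all coordinates. -/
noncomputable def envelopeProd (S : OrthExpansion d) (T : Finset ℕ) (x : Fin d → ℝ) : ℝ :=
  ∏ j, S.envelope T j (x j)

/-- The product of the envelopes of all coordinates but `i`. -/
noncomputable def envelopeErase (S : OrthExpansion d) (T : Finset ℕ) (i : Fin d)
    (x : Fin d → ℝ) : ℝ :=
  ∏ j ∈ Finset.univ.erase i, S.envelope T j (x j)

variable {T : Finset ℕ}

theorem envelopeProd_nonneg (x : Fin d → ℝ) : 0 ≤ S.envelopeProd T x :=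
  Finset.prod_nonneg fun _ _ => envelope_nonneg _ _ _

theorem envelopeErase_nonneg (i : Fin d) (x : Fin d → ℝ) : 0 ≤ S.envelopeErase T i x :=
  Finset.prod_nonneg fun _ _ => envelope_nonneg _ _ _

theorem abs_modeProd_le {k : Fin d → ℕ} (hk : ∀ i, k i ∈ T) (x : Fin d → ℝ) :
    |S.modeProd σ k x| ≤ S.envelopeProd T x := by
  unfold modeProd
  rw [Finset.abs_prod]
  exact Finset.prod_le_prod (fun _ _ => abs_nonneg _)
    fun j _ => abs_mode1_le_envelope j _ (hk j) _

theorem abs_modeProdErase_le {k : Fin d → ℕ} (hk : ∀ i, k i ∈ T) (i : Fin d) (x : Fin d → ℝ) :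
    |S.modeProdErase σ i k x| ≤ S.envelopeErase T i x := by
  unfold modeProdErase
  rw [Finset.abs_prod]
  exact Finset.prod_le_prod (fun _ _ => abs_nonneg _)
    fun j _ => abs_mode1_le_envelope j _ (hk j) _

theorem exp_le_one {t r : ℝ} (ht : 0 ≤ t) : Real.exp (-t * √r) ≤ 1 :=
  Real.exp_le_one_iff.2 (by have := mul_nonneg ht (Real.sqrt_nonneg r); linarith)

theorem abs_field_update_le (hs : ∀ k ∈ s, ∀ i, k i ∈ T) (i : Fin d) {t : ℝ} (ht : 0 ≤ t)
    (x : Fin d → ℝ) (y : ℝ) :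
    |S.field s σ a t (Function.update x i y)| ≤
      (∑ k ∈ s, |a k|) * (S.envelope T i y * S.envelopeErase T i x) := by
  unfold field
  rw [Finset.sum_mul]
  refine (Finset.abs_sum_le_sum_abs _ _).trans (Finset.sum_le_sum fun k hk => ?_)
  rw [abs_mul, abs_mul, Real.abs_exp, modeProd_update, abs_mul]
  have h1 := abs_mode1_le_envelope (S := S) i (σ i) (hs k hk i) y
  have h2 := abs_modeProdErase_le (S := S) (σ := σ) (hs k hk) i x
  have h3 := exp_le_one (r := S.eigenvalue k) ht
  have h4 := envelope_nonneg (S := S) T i y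
  calc |a k| * Real.exp (-t * √(S.eigenvalue k)) * _ ≤ |a k| * 1 * (S.envelope T i y * S.envelopeErase T i x) := by gcongr
    _ = _ := by ring

theorem abs_field_update_sub_le (hs : ∀ k ∈ s, ∀ i, k i ∈ T) (i : Fin d) {t : ℝ} (ht : 0 ≤ t)
    (x : Fin d → ℝ) (y z : ℝ) :
    |S.field s σ a t (Function.update x i z) - S.field s σ a t (Function.update x i y)| ≤
      (∑ k ∈ s, |a k|) * (S.increment T i y z * S.envelopeErase T i x) := by
  unfold field
  rw [Finset.sum_mul, ← Finset.sum_sub_distrib]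
  refine (Finset.abs_sum_le_sum_abs _ _).trans (Finset.sum_le_sum fun k hk => ?_)
  rw [modeProd_update, modeProd_update, ← mul_sub, ← sub_mul, abs_mul, abs_mul, abs_mul,
    Real.abs_exp]
  have h1 := abs_sub_le_increment (S := S) i (σ i) (hs k hk i) y z
  have h2 := abs_modeProdErase_le (S := S) (σ := σ) (hs k hk) i x
  have h3 := exp_le_one (r := S.eigenvalue k) ht
  have h4 := increment_nonneg (S := S) T i y z
  calc |a k| * Real.exp (-t * √(S.eigenvalue k)) * _ ≤ |a k| * 1 * (S.increment T i y z * S.envelopeErase T i x) := by gcongr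
    _ = _ := by ring

theorem abs_field_le (hs : ∀ k ∈ s, ∀ i, k i ∈ T) {t : ℝ} (ht : 0 ≤ t) (x : Fin d → ℝ) :
    |S.field s σ a t x| ≤ (∑ k ∈ s, |a k|) * S.envelopeProd T x := by
  unfold field
  rw [Finset.sum_mul]
  refine (Finset.abs_sum_le_sum_abs _ _).trans (Finset.sum_le_sum fun k hk => ?_)
  rw [abs_mul, abs_mul, Real.abs_exp]
  have h2 := abs_modeProd_le (S := S) (σ := σ) (hs k hk) x
  have h3 := exp_le_one (r := S.eigenvalue k) ht
  calc |a k| * Real.exp (-t * √(S.eigenvalue k)) * _ ≤ |a k| * 1 * S.envelopeProd T x := by gcongr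
    _ = _ := by ring

/-- The time derivative of a Poisson extension decays exponentially, since it contains no modes
with eigenvalue `0`. -/
theorem exists_abs_field_time_le (s : Finset (Fin d → ℕ)) (hs : ∀ k ∈ s, ∀ i, k i ∈ T) :
    ∃ κ > 0, ∀ (σ : Fin d → Bool) (a : (Fin d → ℕ) → ℝ) (t : ℝ) (x : Fin d → ℝ), 0 ≤ t →
      |S.field s σ (fun k => -√(S.eigenvalue k) * a k) t x| ≤
        (∑ k ∈ s, |-√(S.eigenvalue k) * a k|) * (Real.exp (-t * κ) * S.envelopeProd T x) := by
  obtain ⟨κ, hκ, H⟩ : ∃ κ > 0, ∀ k ∈ s, √(S.eigenvalue k) = 0 ∨ κ ≤ √(S.eigenvalue k) := by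
    induction s using Finset.induction_on with
    | empty => exact ⟨1, one_pos, by simp⟩
    | insert k s _ ih =>
      obtain ⟨κ, hκ, H⟩ := ih fun k hk => hs k (Finset.mem_insert_of_mem hk)
      rcases (Real.sqrt_nonneg (S.eigenvalue k)).eq_or_lt with h | h
      · refine ⟨κ, hκ, fun l hl => ?_⟩
        rcases Finset.mem_insert.1 hl with rfl | hl
        · exact Or.inl h.symm
        · exact H l hl
      · refine ⟨min κ (√(S.eigenvalue k)), lt_min hκ h, fun l hl => ?_⟩
        rcases Finset.mem_insert.1 hl with rfl | hl
        · exact Or.inr (min_le_right _ _)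
        · exact (H l hl).imp id fun h' => (min_le_left _ _).trans h'
  refine ⟨κ, hκ, fun σ a t x ht => ?_⟩
  unfold field
  rw [Finset.sum_mul]
  refine (Finset.abs_sum_le_sum_abs _ _).trans (Finset.sum_le_sum fun k hk => ?_)
  rw [abs_mul, abs_mul, Real.abs_exp]
  have h2 := abs_modeProd_le (S := S) (σ := σ) (hs k hk) x
  rcases H k hk with h | h
  · simp [h]
  · rw [mul_assoc]
    have h3 : Real.exp (-t * √(S.eigenvalue k)) ≤ Real.exp (-t * κ) :=
      Real.exp_le_exp.2 (by nlinarith)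
    gcongr

end OrthExpansion

/-! ### The Bellman function along a vector field -/

namespace SmoothBellman

variable {c : ℝ} (B : SmoothBellman c) {ι : Type*} [Fintype ι]

/-- The value of the Bellman function at the vector `(U, V)`. -/
noncomputable def val (U : ℝ) (V : ι → ℝ) : ℝ := B.b (U ^ 2) (∑ i, V i ^ 2)

/-- The differential of the Bellman function at `(U, V)` in the direction `(U₁, V₁)`. -/
noncomputable def grad (U : ℝ) (V : ι → ℝ) (U₁ : ℝ) (V₁ : ι → ℝ) : ℝ :=
  2 * B.bX (U ^ 2) (∑ i, V i ^ 2) * (U * U₁) + 2 * B.bY (U ^ 2) (∑ i, V i ^ 2) * ∑ i, V i * V₁ i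

/-- The Hessian of the Bellman function at `(U, V)` in the direction `(U₁, V₁)`. -/
noncomputable def hess (U : ℝ) (V : ι → ℝ) (U₁ : ℝ) (V₁ : ι → ℝ) : ℝ :=
  2 * B.bX (U ^ 2) (∑ i, V i ^ 2) * U₁ ^ 2 + 2 * B.bY (U ^ 2) (∑ i, V i ^ 2) * ∑ i, V₁ i ^ 2
    + 4 * B.bXX (U ^ 2) (∑ i, V i ^ 2) * (U * U₁) ^ 2
    + 8 * B.bXY (U ^ 2) (∑ i, V i ^ 2) * ((U * U₁) * ∑ i, V i * V₁ i)
    + 4 * B.bYY (U ^ 2) (∑ i, V i ^ 2) * (∑ i, V i * V₁ i) ^ 2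

theorem sum_sq_nonneg (V : ι → ℝ) : 0 ≤ ∑ i, V i ^ 2 := Finset.sum_nonneg fun _ _ => sq_nonneg _

theorem grad_mul (p U : ℝ) (V : ι → ℝ) (U₁ : ℝ) (V₁ : ι → ℝ) :
    B.grad U V (p * U₁) (fun i => p * V₁ i) = p * B.grad U V U₁ V₁ := by
  unfold grad
  have : ∑ i, V i * (p * V₁ i) = p * ∑ i, V i * V₁ i := by
    rw [Finset.mul_sum]; exact Finset.sum_congr rfl fun i _ => by ring
  rw [this]; ring

theorem grad_add (U : ℝ) (V : ι → ℝ) (U₁ U₂ : ℝ) (V₁ V₂ : ι → ℝ) :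
    B.grad U V (U₁ + U₂) (fun i => V₁ i + V₂ i) = B.grad U V U₁ V₁ + B.grad U V U₂ V₂ := by
  unfold grad
  simp only [mul_add, Finset.sum_add_distrib]; ring

theorem grad_sum {κ : Type*} (t : Finset κ) (U : ℝ) (V : ι → ℝ) (U₁ : κ → ℝ) (V₁ : κ → ι → ℝ) :
    B.grad U V (∑ j ∈ t, U₁ j) (fun i => ∑ j ∈ t, V₁ j i) = ∑ j ∈ t, B.grad U V (U₁ j) (V₁ j) := by
  unfold grad
  simp only [Finset.mul_sum, Finset.sum_add_distrib]
  congr 1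
  rw [Finset.sum_comm]

theorem hess_mul (p U : ℝ) (V : ι → ℝ) (U₁ : ℝ) (V₁ : ι → ℝ) :
    B.hess U V (p * U₁) (fun i => p * V₁ i) = p ^ 2 * B.hess U V U₁ V₁ := by
  unfold hess
  have h1 : ∑ i, V i * (p * V₁ i) = p * ∑ i, V i * V₁ i := by
    rw [Finset.mul_sum]; exact Finset.sum_congr rfl fun i _ => by ring
  have h2 : ∑ i, (p * V₁ i) ^ 2 = p ^ 2 * ∑ i, V₁ i ^ 2 := by
    rw [Finset.mul_sum]; exact Finset.sum_congr rfl fun i _ => by ring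
  rw [h1, h2]; ring

section Deriv

variable {U U₁ P : ℝ → ℝ} {V V₁ : ι → ℝ → ℝ} {u₁ u₂ y : ℝ} {v₁ v₂ : ι → ℝ}

theorem hasDerivAt_sq_sum (hV : ∀ i, HasDerivAt (V i) (v₁ i) y) :
    HasDerivAt (fun y => ∑ i, V i y ^ 2) (2 * ∑ i, V i y * v₁ i) y := by
  refine (HasDerivAt.fun_sum fun i _ => (hV i).fun_pow 2).congr_deriv ?_
  rw [Finset.mul_sum]
  exact Finset.sum_congr rfl fun i _ => by push_cast; ring

theorem hasDerivAt_sq (hU : HasDerivAt U u₁ y) :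
    HasDerivAt (fun y => U y ^ 2) (2 * (U y * u₁)) y :=
  (hU.fun_pow 2).congr_deriv (by push_cast; ring)

theorem hasDerivAt_val (hU : HasDerivAt U u₁ y) (hV : ∀ i, HasDerivAt (V i) (v₁ i) y) :
    HasDerivAt (fun y => B.val (U y) (fun i => V i y)) (B.grad (U y) (fun i => V i y) u₁ v₁) y :=
  (B.hasDerivAt_b (hasDerivAt_sq hU) (hasDerivAt_sq_sum hV) (sq_nonneg _)
    (sum_sq_nonneg _)).congr_deriv (by unfold grad; ring)

theorem hasDerivAt_mul_grad (hU : HasDerivAt U (U₁ y) y) (hV : ∀ i, HasDerivAt (V i) (V₁ i y) y)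
    (hU₁ : HasDerivAt (fun y => P y * U₁ y) u₂ y)
    (hV₁ : ∀ i, HasDerivAt (fun y => P y * V₁ i y) (v₂ i) y) :
    HasDerivAt (fun y => P y * B.grad (U y) (fun i => V i y) (U₁ y) (fun i => V₁ i y))
      (P y * B.hess (U y) (fun i => V i y) (U₁ y) (fun i => V₁ i y)
        + B.grad (U y) (fun i => V i y) u₂ v₂) y := by
  have hX := B.hasDerivAt_bX (hasDerivAt_sq hU) (hasDerivAt_sq_sum hV) (sq_nonneg _)
    (sum_sq_nonneg _)
  have hY := B.hasDerivAt_bY (hasDerivAt_sq hU) (hasDerivAt_sq_sum hV) (sq_nonneg _)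
    (sum_sq_nonneg _)
  have hs : HasDerivAt (fun y => ∑ i, V i y * (P y * V₁ i y))
      (∑ i, (V₁ i y * (P y * V₁ i y) + V i y * v₂ i)) y :=
    HasDerivAt.fun_sum fun i _ => (hV i).mul (hV₁ i)
  refine (((hX.const_mul 2).mul (hU.mul hU₁)).add ((hY.const_mul 2).mul hs)).congr_deriv ?_
    |>.congr_of_eventuallyEq (Eventually.of_forall fun z => ?_)
  · have e1 : ∑ i, V i y * (P y * V₁ i y) = P y * ∑ i, V i y * V₁ i y := by
      rw [Finset.mul_sum]; exact Finset.sum_congr rfl fun i _ => by ring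
    have e2 : ∑ i, V₁ i y * (P y * V₁ i y) = P y * ∑ i, V₁ i y ^ 2 := by
      rw [Finset.mul_sum]; exact Finset.sum_congr rfl fun i _ => by ring
    rw [e1, Finset.sum_add_distrib, e2]
    simp only [Pi.mul_apply]
    unfold grad hess
    ring
  · have e1 : ∑ i, V i z * (P z * V₁ i z) = P z * ∑ i, V i z * V₁ i z := by
      rw [Finset.mul_sum]; exact Finset.sum_congr rfl fun i _ => by ring
    simp only [Pi.mul_apply, Pi.add_apply]
    unfold grad
    rw [e1]
    ring

end Deriv

theorem le_hess (U : ℝ) (V : ι → ℝ) (U₁ : ℝ) (V₁ : ι → ℝ) :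
    c * (B.τ (U ^ 2) (∑ i, V i ^ 2) * U₁ ^ 2 + (B.τ (U ^ 2) (∑ i, V i ^ 2))⁻¹ * ∑ i, V₁ i ^ 2) ≤
      B.hess U V U₁ V₁ :=
  B.dissipation (sq_nonneg _) (sum_sq_nonneg _) (sq_nonneg _) (sum_sq_nonneg _)
    (by rw [mul_pow]) (Finset.sum_mul_sq_le_sq_mul_sq _ _ _)

/-- Convexity in all directions `(U₁ j, V₁ j)` at once, together with the contribution of a
potential `r ≥ 0`: the weights `τ` and `τ⁻¹` combine to a product. -/
theorem two_mul_sqrt_mul_sqrt_le {κ : Type*} [Fintype κ] (hc : 0 ≤ c) {r : ℝ} (hr : 0 ≤ r) (U : ℝ)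
    (V : ι → ℝ) (U₁ : κ → ℝ) (V₁ : κ → ι → ℝ) :
    2 * c * (√(r * U ^ 2 + ∑ j, U₁ j ^ 2) * √(r * ∑ i, V i ^ 2 + ∑ j, ∑ i, V₁ j i ^ 2)) ≤
      ∑ j, B.hess U V (U₁ j) (V₁ j) + r * B.grad U V U V := by
  set τ := B.τ (U ^ 2) (∑ i, V i ^ 2) with hτ
  have hτ0 : 0 < τ := B.τ_pos (sq_nonneg _) (sum_sq_nonneg _)
  obtain ⟨w1, w2⟩ := B.weight_le (sq_nonneg U) (sum_sq_nonneg V)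
  rw [← hτ] at w1 w2
  have hY := sum_sq_nonneg V
  have hg : c * (τ * U ^ 2 + τ⁻¹ * ∑ i, V i ^ 2) ≤ B.grad U V U V := by
    have e : ∑ i, V i * V i = ∑ i, V i ^ 2 := Finset.sum_congr rfl fun i _ => (sq _).symm
    unfold grad
    rw [e]
    nlinarith [mul_le_mul_of_nonneg_right w1 (sq_nonneg U), mul_le_mul_of_nonneg_right w2 hY]
  have hh : c * (τ * ∑ j, U₁ j ^ 2 + τ⁻¹ * ∑ j, ∑ i, V₁ j i ^ 2) ≤
      ∑ j, B.hess U V (U₁ j) (V₁ j) := by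
    rw [Finset.mul_sum, Finset.mul_sum, ← Finset.sum_add_distrib, Finset.mul_sum]
    exact Finset.sum_le_sum fun j _ => B.le_hess U V (U₁ j) (V₁ j)
  set a := r * U ^ 2 + ∑ j, U₁ j ^ 2 with ha
  set b := r * ∑ i, V i ^ 2 + ∑ j, ∑ i, V₁ j i ^ 2 with hb
  have ha0 : 0 ≤ a := add_nonneg (mul_nonneg hr (sq_nonneg _)) (sum_sq_nonneg _)
  have hb0 : 0 ≤ b := add_nonneg (mul_nonneg hr hY) (Finset.sum_nonneg fun _ _ => sum_sq_nonneg _)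
  have hab : 2 * (√a * √b) ≤ τ * a + τ⁻¹ * b := by
    have h1 := two_mul_le_add_sq (√(τ * a)) (√(τ⁻¹ * b))
    rw [Real.sq_sqrt (by positivity), Real.sq_sqrt (by positivity), mul_assoc,
      ← Real.sqrt_mul (by positivity), show τ * a * (τ⁻¹ * b) = a * b by field_simp,
      Real.sqrt_mul ha0] at h1
    exact h1
  calc 2 * c * (√a * √b) = c * (2 * (√a * √b)) := by ring
    _ ≤ c * (τ * a + τ⁻¹ * b) := by gcongr
    _ = c * (τ * ∑ j, U₁ j ^ 2 + τ⁻¹ * ∑ j, ∑ i, V₁ j i ^ 2)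
        + r * (c * (τ * U ^ 2 + τ⁻¹ * ∑ i, V i ^ 2)) := by rw [ha, hb]; ring
    _ ≤ _ := by gcongr

end SmoothBellman

namespace OrthExpansion

variable {d : ℕ}

/-- The coordinates in which the `n`-th component of the vector `(F, G_1, …, G_d)` is expanded in
the functions `δ_j φ^j_k` instead of `φ^j_k`. -/
def slot (n : Option (Fin d)) (j : Fin d) : Bool := decide (n = some j)

/-- The components of the vector `(F, G_1, …, G_d)` with coefficients `A`. -/
noncomputable def comp (S : OrthExpansion d) (s : Finset (Fin d → ℕ))
    (A : Option (Fin d) → (Fin d → ℕ) → ℝ) (n : Option (Fin d)) : ℝ → (Fin d → ℝ) → ℝ :=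
  S.field s (slot n) (A n)

/-- The coefficients of the time derivative of an expansion with coefficients `A`. -/
noncomputable def timeCoeff (S : OrthExpansion d) (A : Option (Fin d) → (Fin d → ℕ) → ℝ)
    (n : Option (Fin d)) (k : Fin d → ℕ) : ℝ :=
  -√(S.eigenvalue k) * A n k

variable {c : ℝ} (B : SmoothBellman c) (S : OrthExpansion d) (s : Finset (Fin d → ℕ))
  (A : Option (Fin d) → (Fin d → ℕ) → ℝ)

/-- The Bellman function along `(F, G)`. -/
noncomputable def bVal (t : ℝ) (x : Fin d → ℝ) : ℝ :=
  B.val (S.comp s A none t x) (fun i => S.comp s A (some i) t x)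

/-- The time derivative of `S.bVal`. -/
noncomputable def bT (t : ℝ) (x : Fin d → ℝ) : ℝ :=
  B.grad (S.comp s A none t x) (fun i => S.comp s A (some i) t x)
    (S.comp s (S.timeCoeff A) none t x) (fun i => S.comp s (S.timeCoeff A) (some i) t x)

/-- The second time derivative of `S.bVal`. -/
noncomputable def bTT (t : ℝ) (x : Fin d → ℝ) : ℝ :=
  B.hess (S.comp s A none t x) (fun i => S.comp s A (some i) t x)
    (S.comp s (S.timeCoeff A) none t x) (fun i => S.comp s (S.timeCoeff A) (some i) t x)
  + B.grad (S.comp s A none t x) (fun i => S.comp s A (some i) t x)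
    (S.comp s (S.timeCoeff (S.timeCoeff A)) none t x)
    (fun i => S.comp s (S.timeCoeff (S.timeCoeff A)) (some i) t x)

/-- The partial derivative of `S.bVal` in the coordinate `j`. -/
noncomputable def bX (j : Fin d) (t : ℝ) (x : Fin d → ℝ) : ℝ :=
  B.grad (S.comp s A none t x) (fun i => S.comp s A (some i) t x)
    (S.fieldX s (slot none) (A none) j t x)
    (fun i => S.fieldX s (slot (some i)) (A (some i)) j t x)

/-- The function `w_j⁻¹ ∂_j (p_j² w_j ∂_j ⬝)` of `S.bVal`. -/
noncomputable def bL (j : Fin d) (t : ℝ) (x : Fin d → ℝ) : ℝ :=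
  S.pc j (x j) ^ 2 * B.hess (S.comp s A none t x) (fun i => S.comp s A (some i) t x)
    (S.fieldX s (slot none) (A none) j t x)
    (fun i => S.fieldX s (slot (some i)) (A (some i)) j t x)
  + B.grad (S.comp s A none t x) (fun i => S.comp s A (some i) t x)
    (S.fieldL s (slot none) (A none) j t x)
    (fun i => S.fieldL s (slot (some i)) (A (some i)) j t x)

variable {B S s A}

theorem bVal_nonneg (t : ℝ) (x : Fin d → ℝ) : 0 ≤ S.bVal B s A t x :=
  B.b_nonneg (sq_nonneg _) (SmoothBellman.sum_sq_nonneg _)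

theorem hasDerivAt_comp_time (n : Option (Fin d)) (t : ℝ) (x : Fin d → ℝ) :
    HasDerivAt (fun t => S.comp s A n t x) (S.comp s (S.timeCoeff A) n t x) t :=
  hasDerivAt_field_time t x

theorem hasDerivAt_bVal_time (t : ℝ) (x : Fin d → ℝ) :
    HasDerivAt (fun t => S.bVal B s A t x) (S.bT B s A t x) t :=
  B.hasDerivAt_val (hasDerivAt_comp_time none t x) fun i => hasDerivAt_comp_time (some i) t x

theorem hasDerivAt_bT (t : ℝ) (x : Fin d → ℝ) :
    HasDerivAt (fun t => S.bT B s A t x) (S.bTT B s A t x) t := by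
  have := B.hasDerivAt_mul_grad (P := fun _ => 1) (hasDerivAt_comp_time (s := s) (A := A) none t x)
    (fun i => hasDerivAt_comp_time (some i) t x)
    (u₂ := S.comp s (S.timeCoeff (S.timeCoeff A)) none t x)
    (v₂ := fun i => S.comp s (S.timeCoeff (S.timeCoeff A)) (some i) t x)
    (by simpa using hasDerivAt_comp_time (A := S.timeCoeff A) none t x)
    (fun i => by simpa using hasDerivAt_comp_time (A := S.timeCoeff A) (some i) t x)
  simp only [one_mul] at this
  exact this

theorem hasDerivAt_bVal_update (hS : S.Standing) (j : Fin d) (t : ℝ) (x : Fin d → ℝ) {y : ℝ}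
    (hy : y ∈ S.X1 j) :
    HasDerivAt (fun y => S.bVal B s A t (Function.update x j y))
      (S.bX B s A j t (Function.update x j y)) y :=
  B.hasDerivAt_val (hasDerivAt_field_update hS j t x hy)
    fun _ => hasDerivAt_field_update hS j t x hy

theorem hasDerivAt_diffusion_bX (hS : S.Standing) (j : Fin d) (t : ℝ) (x : Fin d → ℝ) {y : ℝ}
    (hy : y ∈ S.X1 j) :
    HasDerivAt (fun y => S.diffusion j y * S.bX B s A j t (Function.update x j y))
      (S.w j y * S.bL B s A j t (Function.update x j y)) y := by
  refine (B.hasDerivAt_mul_grad (P := S.diffusion j) (hasDerivAt_field_update hS j t x hy)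
    (fun i => hasDerivAt_field_update (σ := slot (some i)) (a := A (some i)) hS j t x hy)
    (hasDerivAt_diffusion_fieldX hS j t x hy)
    (fun i => hasDerivAt_diffusion_fieldX hS j t x hy)).congr_deriv ?_
  unfold bL comp
  rw [B.grad_mul, Function.update_self]
  unfold diffusion
  ring

theorem sum_potential1_none (x : Fin d → ℝ) :
    ∑ j, S.potential1 j (slot none j) (x j) = S.r x := by
  simp [potential1, slot, r]

theorem sum_potential1_some (i : Fin d) (x : Fin d → ℝ) :
    ∑ j, S.potential1 j (slot (some i) j) (x j) = S.r x + S.v i (x i) := by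
  simp [potential1, slot, r, Finset.sum_add_distrib]

theorem r_nonneg (hS : S.Standing) (hA2 : S.A2) {x : Fin d → ℝ} (hx : x ∈ S.X) : 0 ≤ S.r x := by
  obtain ⟨K, hK, H⟩ := hA2
  have hq : ∀ z ∈ S.X, 0 ≤ ∑ i, S.qc i (z i) ^ 2 := fun z _ => SmoothBellman.sum_sq_nonneg _
  rcases hK.eq_or_lt with rfl | hK
  · -- here all the `q_i` vanish, so that `r` is the sum of the `a_i`
    have h0 : ∀ i, ∀ y ∈ S.X1 i, S.qc i y = 0 := by
      intro i y hy
      have h1 := H _ (update_mem_X hx hy)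
      rw [zero_mul] at h1
      have h2 := Finset.single_le_sum (f := fun j => S.qc j (Function.update x i y j) ^ 2)
        (fun _ _ => sq_nonneg _) (Finset.mem_univ i)
      simp only [Function.update_self] at h2
      exact pow_eq_zero_iff (two_ne_zero) |>.1 (le_antisymm (h2.trans h1) (sq_nonneg _))
    refine Finset.sum_nonneg fun i _ => ?_
    have hd : deriv (S.qc i) (x i) = 0 := by
      have : S.qc i =ᶠ[𝓝 (x i)] fun _ => 0 := by
        filter_upwards [(S.isOpen_X1 i).mem_nhds (hx i)] with y hy using h0 i y hy
      rw [this.deriv_eq, deriv_const]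
    simp [r1, h0 i _ (hx i), hd, hS.a_nonneg i]
  · exact nonneg_of_mul_nonneg_right ((hq x hx).trans (H x hx)) hK

/-- The dissipation of the Bellman function along `(F, G)`: the operator `∂_t² + ∑ w_j⁻¹ ∂_j (p_j²
w_j ∂_j ⬝)` applied to it dominates the product of the quantities `|F|_*` and `|G|_*`. -/
theorem le_bTT_add_sum_bL (hS : S.Standing) (hA1 : S.A1) (hA2 : S.A2) (hc : 0 ≤ c) (t : ℝ)
    {x : Fin d → ℝ} (hx : x ∈ S.X) :
    2 * c * (S.starNorm (fun _ : Fin 1 => S.comp s A none) x t *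
      S.starNorm (fun i : Fin d => S.comp s A (some i)) x t) ≤
      S.bTT B s A t x + ∑ j, S.bL B s A j t x := by
  have hr := r_nonneg hS hA2 hx
  set U := S.comp s A none t x with hU
  set V : Fin d → ℝ := fun i => S.comp s A (some i) t x with hV
  have key := B.two_mul_sqrt_mul_sqrt_le hc hr U V
    (fun j : Option (Fin d) => j.elim (S.comp s (S.timeCoeff A) none t x)
      (fun j => S.pc j (x j) * S.fieldX s (slot none) (A none) j t x))
    (fun (j : Option (Fin d)) i => j.elim (S.comp s (S.timeCoeff A) (some i) t x)
      (fun j => S.pc j (x j) * S.fieldX s (slot (some i)) (A (some i)) j t x))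
  simp only [Fintype.sum_option, Option.elim_none, Option.elim_some, B.hess_mul] at key
  have e1 : S.starNorm (fun _ : Fin 1 => S.comp s A none) x t = √(S.r x * U ^ 2 +
      (S.comp s (S.timeCoeff A) none t x ^ 2
        + ∑ j, (S.pc j (x j) * S.fieldX s (slot none) (A none) j t x) ^ 2)) := by
    unfold starNorm
    simp only [Finset.univ_unique, Finset.sum_const, Finset.card_singleton, one_smul,
      (hasDerivAt_comp_time none t x).deriv]
    rw [add_assoc]
    congr 3
    exact Finset.sum_congr rfl fun j _ => by rw [comp, dOp_field hS j t hx]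
  have e2 : S.starNorm (fun i : Fin d => S.comp s A (some i)) x t = √(S.r x * ∑ i, V i ^ 2 +
      (∑ i, S.comp s (S.timeCoeff A) (some i) t x ^ 2
        + ∑ j, ∑ i, (S.pc j (x j) * S.fieldX s (slot (some i)) (A (some i)) j t x) ^ 2)) := by
    unfold starNorm
    simp only [fun i : Fin d => (hasDerivAt_comp_time (S := S) (s := s) (A := A) (some i) t x).deriv]
    rw [add_assoc]
    congr 3
    exact Finset.sum_congr rfl fun j _ => Finset.sum_congr rfl fun i _ => by
      rw [comp, dOp_field hS j t hx]
  rw [e1, e2]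
  refine key.trans ?_
  have hg : S.r x * B.grad U V U V ≤ B.grad U V
      (S.comp s (S.timeCoeff (S.timeCoeff A)) none t x
        + ∑ j, S.fieldL s (slot none) (A none) j t x)
      (fun i => S.comp s (S.timeCoeff (S.timeCoeff A)) (some i) t x
        + ∑ j, S.fieldL s (slot (some i)) (A (some i)) j t x) := by
    have h1 : S.comp s (S.timeCoeff (S.timeCoeff A)) none t x
        + ∑ j, S.fieldL s (slot none) (A none) j t x = S.r x * U := by
      rw [← sum_potential1_none]; exact sum_fieldL_add hS t x
    have h2 : ∀ i, S.comp s (S.timeCoeff (S.timeCoeff A)) (some i) t x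
        + ∑ j, S.fieldL s (slot (some i)) (A (some i)) j t x
        = (S.r x + S.v i (x i)) * V i := by
      intro i
      rw [← sum_potential1_some]; exact sum_fieldL_add hS t x
    simp only [h1, h2]
    rw [← B.grad_mul]
    unfold SmoothBellman.grad
    have hb := B.bY_nonneg (sq_nonneg U) (SmoothBellman.sum_sq_nonneg V)
    refine add_le_add le_rfl (mul_le_mul_of_nonneg_left
      (Finset.sum_le_sum fun i _ => ?_) (by positivity))
    have := hA1 i (x i) (hx i)
    nlinarith [mul_nonneg this (sq_nonneg (V i))]
  rw [B.grad_add, B.grad_sum] at hg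
  unfold bTT bL
  rw [Finset.sum_add_distrib]
  linarith

end OrthExpansion

namespace OrthExpansion

variable {d : ℕ} {c : ℝ} {B : SmoothBellman c} {S : OrthExpansion d} {s : Finset (Fin d → ℕ)}
  {A : Option (Fin d) → (Fin d → ℕ) → ℝ}

/-! ### Continuity of the Bellman function and its derivatives along a vector field -/

section Continuity

variable {α ι : Type*} [TopologicalSpace α] [Fintype ι] {D : Set α} {U U₁ : α → ℝ}
  {V V₁ : α → ι → ℝ}

theorem continuousOn_sum_sq (hV : ∀ i, ContinuousOn (fun z => V z i) D) :
    ContinuousOn (fun z => ∑ i, V z i ^ 2) D :=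
  continuousOn_finsetSum _ fun i _ => (hV i).pow 2

theorem continuousOn_sum_mul (hV : ∀ i, ContinuousOn (fun z => V z i) D)
    (hV₁ : ∀ i, ContinuousOn (fun z => V₁ z i) D) :
    ContinuousOn (fun z => ∑ i, V z i * V₁ z i) D :=
  continuousOn_finsetSum _ fun i _ => (hV i).mul (hV₁ i)

theorem _root_.SmoothBellman.continuousOn_val (hU : ContinuousOn U D)
    (hV : ∀ i, ContinuousOn (fun z => V z i) D) : ContinuousOn (fun z => B.val (U z) (V z)) D :=
  SmoothBellman.continuousOn_comp B.continuousOn_b (hU.pow 2) (continuousOn_sum_sq hV)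
    (fun _ => sq_nonneg _) fun _ => SmoothBellman.sum_sq_nonneg _

theorem _root_.SmoothBellman.continuousOn_grad (hU : ContinuousOn U D)
    (hV : ∀ i, ContinuousOn (fun z => V z i) D) (hU₁ : ContinuousOn U₁ D)
    (hV₁ : ∀ i, ContinuousOn (fun z => V₁ z i) D) :
    ContinuousOn (fun z => B.grad (U z) (V z) (U₁ z) (V₁ z)) D := by
  have h1 := SmoothBellman.continuousOn_comp B.continuousOn_bX (hU.pow 2) (continuousOn_sum_sq hV)
    (fun _ => sq_nonneg _) fun _ => SmoothBellman.sum_sq_nonneg _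
  have h2 := SmoothBellman.continuousOn_comp B.continuousOn_bY (hU.pow 2) (continuousOn_sum_sq hV)
    (fun _ => sq_nonneg _) fun _ => SmoothBellman.sum_sq_nonneg _
  have h3 := continuousOn_sum_mul hV hV₁
  unfold SmoothBellman.grad
  fun_prop

theorem _root_.SmoothBellman.continuousOn_hess (hU : ContinuousOn U D)
    (hV : ∀ i, ContinuousOn (fun z => V z i) D) (hU₁ : ContinuousOn U₁ D)
    (hV₁ : ∀ i, ContinuousOn (fun z => V₁ z i) D) :
    ContinuousOn (fun z => B.hess (U z) (V z) (U₁ z) (V₁ z)) D := by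
  have h1 := SmoothBellman.continuousOn_comp B.continuousOn_bX (hU.pow 2) (continuousOn_sum_sq hV)
    (fun _ => sq_nonneg _) fun _ => SmoothBellman.sum_sq_nonneg _
  have h2 := SmoothBellman.continuousOn_comp B.continuousOn_bY (hU.pow 2) (continuousOn_sum_sq hV)
    (fun _ => sq_nonneg _) fun _ => SmoothBellman.sum_sq_nonneg _
  have h3 := continuousOn_sum_mul hV hV₁
  have h4 := SmoothBellman.continuousOn_comp B.continuousOn_bXX (hU.pow 2)
    (continuousOn_sum_sq hV) (fun _ => sq_nonneg _) fun _ => SmoothBellman.sum_sq_nonneg _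
  have h5 := SmoothBellman.continuousOn_comp B.continuousOn_bXY (hU.pow 2)
    (continuousOn_sum_sq hV) (fun _ => sq_nonneg _) fun _ => SmoothBellman.sum_sq_nonneg _
  have h6 := SmoothBellman.continuousOn_comp B.continuousOn_bYY (hU.pow 2)
    (continuousOn_sum_sq hV) (fun _ => sq_nonneg _) fun _ => SmoothBellman.sum_sq_nonneg _
  have h7 := continuousOn_sum_sq hV₁
  unfold SmoothBellman.hess
  fun_prop

variable (hS : S.Standing)
include hS

theorem continuousOn_bVal :
    ContinuousOn (fun z : ℝ × (Fin d → ℝ) => S.bVal B s A z.1 z.2) (Set.univ ×ˢ S.X) :=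
  SmoothBellman.continuousOn_val (continuousOn_field hS) fun _ => continuousOn_field hS

theorem continuousOn_bTT :
    ContinuousOn (fun z : ℝ × (Fin d → ℝ) => S.bTT B s A z.1 z.2) (Set.univ ×ˢ S.X) :=
  (SmoothBellman.continuousOn_hess (continuousOn_field hS) (fun _ => continuousOn_field hS)
    (continuousOn_field hS) fun _ => continuousOn_field hS).add
  (SmoothBellman.continuousOn_grad (continuousOn_field hS) (fun _ => continuousOn_field hS)
    (continuousOn_field hS) fun _ => continuousOn_field hS)

theorem continuousOn_bL (j : Fin d) :
    ContinuousOn (fun z : ℝ × (Fin d → ℝ) => S.bL B s A j z.1 z.2) (Set.univ ×ˢ S.X) :=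
  ((continuousOn_comp_coord ((hS.pc_smooth j).continuousOn.pow 2)).mul
    (SmoothBellman.continuousOn_hess (continuousOn_field hS) (fun _ => continuousOn_field hS)
      (continuousOn_fieldX hS j) fun _ => continuousOn_fieldX hS j)).add
  (SmoothBellman.continuousOn_grad (continuousOn_field hS) (fun _ => continuousOn_field hS)
    (continuousOn_fieldL hS j) fun _ => continuousOn_fieldL hS j)

end Continuity

/-! ### Growth of the Bellman function along a vector field -/

/-- The gauge `z² + z^{2m+2}`, which dominates a polynomial in `z ≥ 0` vanishing to second order
at the origin. -/
noncomputable def gauge (m : ℕ) (z : ℝ) : ℝ := z ^ 2 + z ^ (2 * m + 2)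

theorem gauge_nonneg (m : ℕ) {z : ℝ} (hz : 0 ≤ z) : 0 ≤ gauge m z := by unfold gauge; positivity

theorem one_add_sq_pow_mul_le (m : ℕ) {z : ℝ} (hz : 0 ≤ z) :
    (1 + z ^ 2) ^ m * z ^ 2 ≤ 2 ^ m * gauge m z := by
  unfold gauge
  rcases le_total z 1 with h | h
  · have h1 : 1 + z ^ 2 ≤ 2 := by nlinarith
    calc (1 + z ^ 2) ^ m * z ^ 2 ≤ 2 ^ m * z ^ 2 := by gcongr
      _ ≤ _ := by gcongr; linarith [pow_nonneg hz (2 * m + 2)]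
  · have h1 : 1 + z ^ 2 ≤ 2 * z ^ 2 := by nlinarith
    calc (1 + z ^ 2) ^ m * z ^ 2 ≤ (2 * z ^ 2) ^ m * z ^ 2 := by gcongr
      _ = 2 ^ m * z ^ (2 * m + 2) := by rw [mul_pow, ← pow_mul, pow_add]; ring
      _ ≤ _ := by gcongr; linarith [pow_nonneg hz 2]

theorem one_add_mul_pow_le (m : ℕ) {K z : ℝ} (hK : 0 ≤ K) (hz : 0 ≤ z) :
    (1 + K * z ^ 2) ^ m * z ^ 2 ≤ ((1 + K) ^ m * 2 ^ m) * gauge m z := by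
  have h1 : 1 + K * z ^ 2 ≤ (1 + K) * (1 + z ^ 2) := by nlinarith [sq_nonneg z]
  calc (1 + K * z ^ 2) ^ m * z ^ 2 ≤ ((1 + K) * (1 + z ^ 2)) ^ m * z ^ 2 := by gcongr
    _ = (1 + K) ^ m * ((1 + z ^ 2) ^ m * z ^ 2) := by rw [mul_pow]; ring
    _ ≤ (1 + K) ^ m * (2 ^ m * gauge m z) := 
        mul_le_mul_of_nonneg_left (one_add_sq_pow_mul_le m hz) (by positivity)
    _ = _ := by ring

/-- The sum of the absolute values of the coefficients of the `n`-th component. -/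
noncomputable def coeffNorm (s : Finset (Fin d → ℕ)) (A : Option (Fin d) → (Fin d → ℕ) → ℝ)
    (n : Option (Fin d)) : ℝ := ∑ k ∈ s, |A n k|

theorem coeffNorm_nonneg (n : Option (Fin d)) : 0 ≤ coeffNorm s A n :=
  Finset.sum_nonneg fun _ _ => abs_nonneg _

theorem sum_sq_le {u : Option (Fin d) → ℝ} {e : ℝ} (h : ∀ n, |u n| ≤ coeffNorm s A n * e) :
    u none ^ 2 + ∑ i, u (some i) ^ 2 ≤ (∑ n, coeffNorm s A n ^ 2) * e ^ 2 := by
  rw [← Fintype.sum_option (f := fun n => u n ^ 2), Finset.sum_mul]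
  exact Finset.sum_le_sum fun n _ => by
    rw [← mul_pow, ← sq_abs (u n)]; exact pow_le_pow_left₀ (abs_nonneg _) (h n) 2

theorem abs_sq_sub_le {u v : Option (Fin d) → ℝ} {e f : ℝ} (he : 0 ≤ e)
    (hu : ∀ n, |u n| ≤ coeffNorm s A n * e)
    (hv : ∀ n, |v n| ≤ coeffNorm s A n * e)
    (h : ∀ n, |u n - v n| ≤ coeffNorm s A n * f) :
    |u none ^ 2 - v none ^ 2| + |∑ i, u (some i) ^ 2 - ∑ i, v (some i) ^ 2| ≤
      (∑ n, coeffNorm s A n ^ 2) * (2 * e * f) := by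
  have key : ∀ n, |u n ^ 2 - v n ^ 2| ≤ coeffNorm s A n ^ 2 * (2 * e * f) := by
    intro n
    have h1 : |u n + v n| ≤ 2 * (coeffNorm s A n * e) := by
      have := abs_add_le (u n) (v n)
      linarith [hu n, hv n]
    have h0 := coeffNorm_nonneg (s := s) (A := A) n
    calc |u n ^ 2 - v n ^ 2| = |u n + v n| * |u n - v n| := by rw [← abs_mul]; ring_nf
      _ ≤ 2 * (coeffNorm s A n * e) * (coeffNorm s A n * f) := by gcongr; exact h n
      _ = _ := by ring
  have h2 : |∑ i, u (some i) ^ 2 - ∑ i, v (some i) ^ 2| ≤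
      ∑ i, |u (some i) ^ 2 - v (some i) ^ 2| := by
    rw [← Finset.sum_sub_distrib]; exact Finset.abs_sum_le_sum_abs _ _
  calc _ ≤ |u none ^ 2 - v none ^ 2| + ∑ i, |u (some i) ^ 2 - v (some i) ^ 2| := by gcongr
    _ = ∑ n, |u n ^ 2 - v n ^ 2| :=
        (Fintype.sum_option (f := fun n => |u n ^ 2 - v n ^ 2|)).symm
    _ ≤ _ := by rw [Finset.sum_mul]; exact Finset.sum_le_sum fun n _ => key n

variable {T : Finset ℕ} {C : ℝ} {m : ℕ}

theorem val_le_gauge (hC : 0 ≤ C) (h : ∀ {x y : ℝ}, 0 ≤ x → 0 ≤ y →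
      B.bX x y ≤ C * (1 + x + y) ^ m ∧ B.bY x y ≤ C * (1 + x + y) ^ m)
    {u : Option (Fin d) → ℝ} {K e : ℝ} (hK : 0 ≤ K)
    (hu : u none ^ 2 + ∑ i, u (some i) ^ 2 ≤ K * e ^ 2) :
    B.val (u none) (fun i => u (some i)) ≤ C * (1 + K * e ^ 2) ^ m * (K * e ^ 2) := by
  have h1 := B.abs_sub_le hC h le_rfl le_rfl (sq_nonneg (u none))
    (SmoothBellman.sum_sq_nonneg fun i => u (some i)) (R := K * e ^ 2)
    (by rw [add_zero]; positivity) hu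
  rw [B.b_zero, sub_zero, sub_zero, sub_zero, abs_of_nonneg (sq_nonneg (u none)),
    abs_of_nonneg (SmoothBellman.sum_sq_nonneg fun i => u (some i))] at h1
  have h2 : 0 ≤ C * (1 + K * e ^ 2) ^ m := by positivity
  exact (le_abs_self _).trans (h1.trans (mul_le_mul_of_nonneg_left hu h2))

theorem bVal_le_gauge (hC : 0 ≤ C) (h : ∀ {x y : ℝ}, 0 ≤ x → 0 ≤ y →
      B.bX x y ≤ C * (1 + x + y) ^ m ∧ B.bY x y ≤ C * (1 + x + y) ^ m)
    (hs : ∀ k ∈ s, ∀ i, k i ∈ T) :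
    ∃ K, 0 ≤ K ∧ ∀ {t : ℝ} {x : Fin d → ℝ}, 0 ≤ t →
      S.bVal B s A t x ≤ K * gauge m (S.envelopeProd T x) := by
  set K := ∑ n, coeffNorm s A n ^ 2 with hKdef
  have hK : 0 ≤ K := Finset.sum_nonneg fun _ _ => sq_nonneg _
  refine ⟨C * K * ((1 + K) ^ m * 2 ^ m), by positivity, fun {t x} ht => ?_⟩
  have h1 := sum_sq_le (s := s) (A := A) (u := fun n => S.comp s A n t x)
    fun n => abs_field_le hs ht x
  have h2 := val_le_gauge (B := B) hC h (u := fun n => S.comp s A n t x) hK h1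
  refine h2.trans ?_
  have h3 := one_add_mul_pow_le m hK (envelopeProd_nonneg (S := S) (T := T) x)
  calc C * (1 + K * S.envelopeProd T x ^ 2) ^ m * (K * S.envelopeProd T x ^ 2)
      = C * K * ((1 + K * S.envelopeProd T x ^ 2) ^ m * S.envelopeProd T x ^ 2) := by ring
    _ ≤ C * K * ((1 + K) ^ m * 2 ^ m * gauge m (S.envelopeProd T x)) := by gcongr
    _ = _ := by ring

theorem abs_bT_le_gauge (hC : 0 ≤ C) (h : ∀ {x y : ℝ}, 0 ≤ x → 0 ≤ y →
      B.bX x y ≤ C * (1 + x + y) ^ m ∧ B.bY x y ≤ C * (1 + x + y) ^ m)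
    (hs : ∀ k ∈ s, ∀ i, k i ∈ T) :
    ∃ K, 0 ≤ K ∧ ∃ κ > 0, ∀ {t : ℝ} {x : Fin d → ℝ}, 0 ≤ t →
      |S.bT B s A t x| ≤ K * Real.exp (-t * κ) * gauge m (S.envelopeProd T x) := by
  obtain ⟨κ, hκ, H⟩ := exists_abs_field_time_le (S := S) s hs
  set K := ∑ n, coeffNorm s A n ^ 2 with hKdef
  have hK : 0 ≤ K := Finset.sum_nonneg fun _ _ => sq_nonneg _
  set K' := ∑ n, coeffNorm s A n * coeffNorm s (S.timeCoeff A) n with hKdef'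
  have hK' : 0 ≤ K' :=
    Finset.sum_nonneg fun _ _ => mul_nonneg (coeffNorm_nonneg _) (coeffNorm_nonneg _)
  refine ⟨2 * C * K' * ((1 + K) ^ m * 2 ^ m), by positivity, κ, hκ, fun {t x} ht => ?_⟩
  set e := S.envelopeProd T x with he
  have he0 : 0 ≤ e := envelopeProd_nonneg x
  set u : Option (Fin d) → ℝ := fun n => S.comp s A n t x with hu
  set v : Option (Fin d) → ℝ := fun n => S.comp s (S.timeCoeff A) n t x with hv
  have hu1 : ∀ n, |u n| ≤ coeffNorm s A n * e := fun n => abs_field_le hs ht x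
  have hv1 : ∀ n, |v n| ≤ coeffNorm s (S.timeCoeff A) n * (Real.exp (-t * κ) * e) :=
    fun n => H _ (A n) t x ht
  have hsum := sum_sq_le hu1
  have hY := SmoothBellman.sum_sq_nonneg fun i => u (some i)
  set R := C * (1 + K * e ^ 2) ^ m with hR
  have hR0 : 0 ≤ R := by positivity
  have hpow : C * (1 + u none ^ 2 + ∑ i, u (some i) ^ 2) ^ m ≤ R := by
    exact mul_le_mul_of_nonneg_left (pow_le_pow_left₀ (by positivity) (by linarith) m) hC
  have hX1 := (h (sq_nonneg (u none)) hY).1.trans hpow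
  have hY1 := (h (sq_nonneg (u none)) hY).2.trans hpow
  have hX0 := B.bX_nonneg (sq_nonneg (u none)) hY
  have hY0 := B.bY_nonneg (sq_nonneg (u none)) hY
  have huv : ∀ n, |u n * v n| ≤
      coeffNorm s A n * coeffNorm s (S.timeCoeff A) n * (Real.exp (-t * κ) * e ^ 2) := by
    intro n
    rw [abs_mul]
    have h0 := coeffNorm_nonneg (s := s) (A := A) n
    calc |u n| * |v n| ≤ coeffNorm s A n * e *
          (coeffNorm s (S.timeCoeff A) n * (Real.exp (-t * κ) * e)) := by
          gcongr
          · exact hu1 n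
          · exact hv1 n
      _ = _ := by ring
  have hsumuv : |u none * v none| + |∑ i, u (some i) * v (some i)| ≤
      K' * (Real.exp (-t * κ) * e ^ 2) := by
    calc _ ≤ |u none * v none| + ∑ i, |u (some i) * v (some i)| := by
          gcongr; exact Finset.abs_sum_le_sum_abs _ _
      _ = ∑ n, |u n * v n| := (Fintype.sum_option (f := fun n => |u n * v n|)).symm
      _ ≤ _ := by rw [hKdef', Finset.sum_mul]; exact Finset.sum_le_sum fun n _ => huv n
  have hgrad : |S.bT B s A t x| ≤
      2 * R * (|u none * v none| + |∑ i, u (some i) * v (some i)|) := by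
    change |B.grad (u none) (fun i => u (some i)) (v none) (fun i => v (some i))| ≤ _
    unfold SmoothBellman.grad
    refine (abs_add_le _ _).trans ?_
    rw [abs_mul, abs_mul (2 * B.bY _ _), abs_of_nonneg (mul_nonneg zero_le_two hX0),
      abs_of_nonneg (mul_nonneg zero_le_two hY0), mul_add]
    gcongr
  have h3 := one_add_mul_pow_le m hK he0
  calc |S.bT B s A t x| ≤ 2 * R * (K' * (Real.exp (-t * κ) * e ^ 2)) :=
        hgrad.trans (by gcongr)
    _ = 2 * C * K' * Real.exp (-t * κ) * ((1 + K * e ^ 2) ^ m * e ^ 2) := by rw [hR]; ring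
    _ ≤ 2 * C * K' * Real.exp (-t * κ) * ((1 + K) ^ m * 2 ^ m * gauge m e) := by gcongr
    _ = _ := by ring

/-- The slope of the Bellman function over a flat piece is small. On a piece with large increment
`Δ` of the scale function this holds since the function is nonnegative at the inner point and small
compared with `Δ` at the outer one; on the other pieces it follows from the mean value inequality.
-/
theorem exists_slope_le (hC : 0 ≤ C) (h : ∀ {x y : ℝ}, 0 ≤ x → 0 ≤ y →
      B.bX x y ≤ C * (1 + x + y) ^ m ∧ B.bY x y ≤ C * (1 + x + y) ^ m)
    (hs : ∀ k ∈ s, ∀ i, k i ∈ T) {M : ℝ} (hM : 0 ≤ M) :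
    ∃ K, 0 ≤ K ∧ ∀ {i : Fin d} {η y₀ y₁ Δ t : ℝ} {x : Fin d → ℝ}, 0 ≤ η → 0 ≤ t →
      S.FlatPiece T i m M η y₀ y₁ Δ →
      (S.bVal B s A t (Function.update x i y₁) - S.bVal B s A t (Function.update x i y₀)) / Δ ≤
        K * η * gauge m (S.envelopeErase T i x) := by
  set K := ∑ n, coeffNorm s A n ^ 2 with hKdef
  have hK : 0 ≤ K := Finset.sum_nonneg fun _ _ => sq_nonneg _
  refine ⟨C * K * ((1 + K) ^ m * 2 ^ m) + C * (K * (2 * M)) * ((1 + K * M ^ 2) ^ m * 2 ^ m),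
    by positivity, fun {i η y₀ y₁ Δ t x} hη ht hflat => ?_⟩
  obtain ⟨hΔ, hflat⟩ := hflat
  rw [div_le_iff₀ hΔ]
  set E := S.envelopeErase T i x with hE
  have hE0 : 0 ≤ E := envelopeErase_nonneg i x
  have hg := gauge_nonneg m hE0
  rcases hflat with hflat | ⟨hx, hy, hinc⟩
  · set e := S.envelope T i y₁ with he
    have he0 : 0 ≤ e := envelope_nonneg T i y₁
    have h1 := sum_sq_le (s := s) (A := A)
      (u := fun n => S.comp s A n t (Function.update x i y₁))
      fun n => abs_field_update_le hs i ht x y₁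
    have h2 := val_le_gauge (B := B) hC h
      (u := fun n => S.comp s A n t (Function.update x i y₁)) hK h1
    have h0 := bVal_nonneg (B := B) (S := S) (s := s) (A := A) t (Function.update x i y₀)
    have hle : 1 + K * (e * E) ^ 2 ≤ (1 + e) ^ 2 * (1 + K * E ^ 2) := by
      have a1 : 0 ≤ K * E ^ 2 := by positivity
      have : (1 + e) ^ 2 * (1 + K * E ^ 2) - (1 + K * (e * E) ^ 2) =
        (2 * e + e ^ 2) + (1 + 2 * e) * (K * E ^ 2) := by ring
      have a2 : 0 ≤ (2 * e + e ^ 2) + (1 + 2 * e) * (K * E ^ 2) := by positivity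
      linarith
    have h3 := one_add_mul_pow_le m hK hE0
    have h4 : S.bVal B s A t (Function.update x i y₁) ≤
        C * K * ((1 + K) ^ m * 2 ^ m) * (η * Δ) * gauge m E := by
      calc _ ≤ C * (1 + K * (e * E) ^ 2) ^ m * (K * (e * E) ^ 2) := h2
        _ ≤ C * ((1 + e) ^ 2 * (1 + K * E ^ 2)) ^ m * (K * ((1 + e) * E) ^ 2) := by
          gcongr; linarith
        _ = C * K * (1 + e) ^ (2 * m + 2) * ((1 + K * E ^ 2) ^ m * E ^ 2) := by
          rw [mul_pow, ← pow_mul, pow_add]; ring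
        _ ≤ C * K * (η * Δ) * ((1 + K) ^ m * 2 ^ m * gauge m E) := by gcongr
        _ = _ := by ring
    have h5 : 0 ≤ C * (K * (2 * M)) * ((1 + K * M ^ 2) ^ m * 2 ^ m) * (η * Δ) * gauge m E := by
      positivity
    linarith
  · have hb : ∀ y, S.envelope T i y ≤ M → ∀ n,
        |S.comp s A n t (Function.update x i y)| ≤ coeffNorm s A n * (M * E) := by
      intro y hy n
      refine (abs_field_update_le hs i ht x y).trans ?_
      have := coeffNorm_nonneg (s := s) (A := A) n
      change coeffNorm s A n * _ ≤ _
      gcongr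
    have hd : ∀ n, |S.comp s A n t (Function.update x i y₁)
        - S.comp s A n t (Function.update x i y₀)| ≤ coeffNorm s A n * (η * Δ * E) := by
      intro n
      refine (abs_field_update_sub_le hs i ht x y₀ y₁).trans ?_
      have := coeffNorm_nonneg (s := s) (A := A) n
      change coeffNorm s A n * _ ≤ _
      gcongr
    have h1 := abs_sq_sub_le (u := fun n => S.comp s A n t (Function.update x i y₁))
      (v := fun n => S.comp s A n t (Function.update x i y₀)) (by positivity)
      (hb y₁ hy) (hb y₀ hx) hd
    have h2 := B.abs_sub_le hC h (sq_nonneg _) (SmoothBellman.sum_sq_nonneg _) (sq_nonneg _)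
      (SmoothBellman.sum_sq_nonneg _) (sum_sq_le (hb y₀ hx)) (sum_sq_le (hb y₁ hy))
    have h3 := one_add_mul_pow_le m (K := K * M ^ 2) (by positivity) hE0
    have h4 : S.bVal B s A t (Function.update x i y₁) - S.bVal B s A t (Function.update x i y₀) ≤
        C * (K * (2 * M)) * ((1 + K * M ^ 2) ^ m * 2 ^ m) * (η * Δ) * gauge m E := by
      calc _ ≤ C * (1 + K * (M * E) ^ 2) ^ m * (K * (2 * (M * E) * (η * Δ * E))) :=
            (le_abs_self _).trans (h2.trans (by gcongr))
        _ = C * (K * (2 * M)) * (η * Δ) * ((1 + K * M ^ 2 * E ^ 2) ^ m * E ^ 2) := by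
            rw [mul_pow, ← mul_assoc K]; ring
        _ ≤ C * (K * (2 * M)) * (η * Δ) * ((1 + K * M ^ 2) ^ m * 2 ^ m * gauge m E) := by gcongr
        _ = _ := by ring
    have h5 : 0 ≤ C * K * ((1 + K) ^ m * 2 ^ m) * (η * Δ) * gauge m E := by positivity
    linarith

end OrthExpansion

/-! ### Integrability of powers of the eigenfunctions -/

theorem piFinSuccAbove_symm_eq {n : ℕ} (i : Fin (n + 1)) (z : ℝ × (Fin n → ℝ)) :
    (MeasurableEquiv.piFinSuccAbove (fun _ => ℝ) i).symm z = i.insertNth z.1 z.2 := rfl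

/-- If a product of functions of separate variables is integrable and the factors other than the
`i`-th do not vanish almost everywhere, then the `i`-th factor is integrable. The functions `h j`
witness that the other factors do not vanish. -/
theorem MeasureTheory.Integrable.factor_of_prod {n : ℕ} {μ : Fin (n + 1) → Measure ℝ}
    [∀ j, SigmaFinite (μ j)] {g h : Fin (n + 1) → ℝ → ℝ} (i : Fin (n + 1))
    (hg : Integrable (fun x : Fin (n + 1) → ℝ => ∏ j, g j (x j)) (Measure.pi μ))
    (hh : ∀ j, ∫ y, h j y ∂(μ j) ≠ 0) (hgh : ∀ j ≠ i, ∀ y, g j y = 0 → h j y = 0) :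
    Integrable (g i) (μ i) := by
  have mp := (measurePreserving_piFinSuccAbove μ i).symm
  have h1 : Integrable (fun z : ℝ × (Fin n → ℝ) => g i z.1 * ∏ j, g (i.succAbove j) (z.2 j))
      ((μ i).prod (Measure.pi fun j => μ (i.succAbove j))) := by
    refine (mp.integrable_comp_emb (MeasurableEquiv.measurableEmbedding _) |>.2 hg).congr
      (ae_of_all _ fun z => ?_)
    simp [Fin.prod_univ_succAbove _ i]
  have h2 : ∃ᵐ x : Fin n → ℝ ∂(Measure.pi fun j => μ (i.succAbove j)),
      ∏ j, g (i.succAbove j) (x j) ≠ 0 := by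
    intro hcon
    have h3 : ∫ x : Fin n → ℝ, ∏ j, h (i.succAbove j) (x j)
        ∂(Measure.pi fun j => μ (i.succAbove j)) = 0 := by
      refine integral_eq_zero_of_ae ?_
      filter_upwards [hcon] with x hx
      obtain ⟨j, -, hj⟩ := Finset.prod_eq_zero_iff.1 (not_not.1 hx)
      exact Finset.prod_eq_zero (Finset.mem_univ j) (hgh _ (Fin.succAbove_ne i j) _ hj)
    rw [integral_fintype_prod_eq_prod (fun j => h (i.succAbove j))] at h3
    exact Finset.prod_ne_zero_iff.2 (fun j _ => hh _) h3
  obtain ⟨x, hx, hx'⟩ := (h2.and_eventually h1.prod_left_ae).exists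
  exact (hx'.mul_const (∏ j, g (i.succAbove j) (x j))⁻¹).congr (ae_of_all _ fun y => by
    simp only; field_simp)

namespace OrthExpansion

variable {d : ℕ} {S : OrthExpansion d}

theorem aestronglyMeasurable_of_continuousOn {i : Fin d} {f : ℝ → ℝ}
    (hf : ContinuousOn f (S.X1 i)) : AEStronglyMeasurable f (S.mu1 i) :=
  (hf.aestronglyMeasurable (S.isOpen_X1 i).measurableSet).mono_ac
    (withDensity_absolutelyContinuous _ _)

theorem integral_phi1_mul_phi1 (hS : S.Standing) (i : Fin d) (k m : ℕ) :
    ∫ y, S.phi1 i k y * S.phi1 i m y ∂(S.mu1 i) = if k = m then 1 else 0 := by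
  obtain ⟨b, hb⟩ := hS.phi_basis i
  rw [← orthonormal_iff_ite.1 b.orthonormal k m, L2.inner_def]
  refine integral_congr_ae ?_
  filter_upwards [hb k, hb m] with y h1 h2
  rw [h1, h2]
  simp [mul_comm]

theorem modeProd_slot_none (k : Fin d → ℕ) : S.modeProd (slot none) k = S.phi k := by
  funext x
  simp [modeProd, slot, phi, mode1]

theorem modeProd_slot_some (i : Fin d) (k : Fin d → ℕ) :
    S.modeProd (slot (some i)) k = S.delta i (S.phi k) := by
  funext x
  have h1 : S.modeProdErase (slot (some i)) i k x = S.modeProdErase (slot none) i k x :=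
    Finset.prod_congr rfl fun j hj => by
      simp [slot, (Finset.ne_of_mem_erase hj).symm]
  have h2 : ∀ y, S.phi k (Function.update x i y)
      = S.phi1 i (k i) y * S.modeProdErase (slot none) i k x := by
    intro y
    rw [← modeProd_slot_none, modeProd_update]
    simp [slot, mode1]
  have h3 := h2 (x i)
  rw [Function.update_eq_self] at h3
  rw [modeProd_eq _ i, h1, delta, dOp, partialX, h3]
  simp only [h2, deriv_mul_const_field]
  simp [slot, mode1, delta1]
  ring

theorem memLp_modeProd (hT3 : S.T3) (n : Option (Fin d)) (k : Fin d → ℕ) {s : ℝ≥0∞} (h1 : 1 ≤ s)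
    (h2 : s ≠ ⊤) : MemLp (S.modeProd (slot n) k) s S.mu := by
  cases n with
  | none =>
    rw [modeProd_slot_none]
    exact (hT3 s h1 h2).1.1 _ (Submodule.subset_span ⟨k, rfl⟩)
  | some i =>
    rw [modeProd_slot_some]
    exact ((hT3 s h1 h2).2 i).1 _ (Submodule.subset_span ⟨k, rfl⟩)

/-- The functions `φ^i_k` and `δ_i φ^i_k` of one variable belong to all `L^N`. By (T3) this holds for
products of them with one nonzero function in each of the other variables. -/
theorem memLp_mode1 (hS : S.Standing) (hT3 : S.T3) (i : Fin d) (ψ : Bool) (k : ℕ) {N : ℕ}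
    (hN : N ≠ 0) : MemLp (S.mode1 i ψ k) N (S.mu1 i) := by
  rw [← integrable_norm_rpow_iff (aestronglyMeasurable_of_continuousOn
    (hS.continuousOn_mode1 i ψ k)) (by exact_mod_cast hN) (ENNReal.natCast_ne_top N)]
  simp only [ENNReal.toReal_natCast, Real.rpow_natCast]
  obtain ⟨n, rfl⟩ : ∃ n, d = n + 1 := ⟨d - 1, by have := i.pos; omega⟩
  have h1 := (memLp_modeProd hT3 (if ψ then some i else none) (fun _ => k) (s := N)
    (by exact_mod_cast Nat.one_le_iff_ne_zero.2 hN) (ENNReal.natCast_ne_top N)).integrable_norm_pow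
    hN
  have h2 := Integrable.factor_of_prod (μ := S.mu1)
    (g := fun j y => ‖S.mode1 j (slot (if ψ then some i else none) j) k y‖ ^ N)
    (h := fun j y => S.phi1 j k y * S.phi1 j k y) i
    (h1.congr (ae_of_all _ fun x => by simp only [modeProd, norm_prod, Finset.prod_pow]))
    (fun j => by rw [integral_phi1_mul_phi1 hS]; simp)
    (fun j hj y hy => by
      have hs : slot (if ψ then some i else none) j = false := by
        cases ψ <;> simp [slot, Ne.symm hj]
      have := norm_eq_zero.1 (pow_eq_zero_iff hN |>.1 hy)
      rw [hs] at this
      simp only [mode1, Bool.false_eq_true, if_false] at this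
      rw [this, zero_mul])
  have hs : slot (if ψ then some i else none) i = ψ := by cases ψ <;> simp [slot]
  simpa only [hs] using h2

theorem integrable_envelope_pow (hS : S.Standing) (hT3 : S.T3) (T : Finset ℕ) (i : Fin d) {N : ℕ}
    (hN : N ≠ 0) : Integrable (fun y => S.envelope T i y ^ N) (S.mu1 i) := by
  have h1 : MemLp (S.envelope T i) N (S.mu1 i) := by
    refine memLp_finsetSum _ fun k _ => memLp_finsetSum _ fun ψ _ => ?_
    exact (memLp_mode1 hS hT3 i ψ k hN).norm
  refine (h1.integrable_norm_pow hN).congr (ae_of_all _ fun y => ?_)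
  simp only [Real.norm_of_nonneg (envelope_nonneg T i y)]

/-- The gauge of a product of envelopes is integrable. -/
theorem integrable_gauge_prod (hS : S.Standing) (hT3 : S.T3) (T : Finset ℕ) (m : ℕ) {ι : Type*}
    [Fintype ι] (e : ι → Fin d) :
    Integrable (fun x : ι → ℝ => gauge m (∏ j, S.envelope T (e j) (x j)))
      (Measure.pi fun j => S.mu1 (e j)) := by
  unfold gauge
  simp only [← Finset.prod_pow]
  exact (Integrable.fintype_prod fun j => integrable_envelope_pow hS hT3 T (e j) (by omega)).add
    (Integrable.fintype_prod fun j => integrable_envelope_pow hS hT3 T (e j) (by omega))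

theorem integrable_gauge_envelopeProd (hS : S.Standing) (hT3 : S.T3) (T : Finset ℕ) (m : ℕ) :
    Integrable (fun x => gauge m (S.envelopeProd T x)) S.mu :=
  integrable_gauge_prod hS hT3 T m id

theorem envelopeErase_insertNth {n : ℕ} {S : OrthExpansion (n + 1)} (T : Finset ℕ)
    (i : Fin (n + 1)) (y : ℝ) (x : Fin n → ℝ) :
    S.envelopeErase T i (i.insertNth (α := fun _ => ℝ) y x) =
      ∏ j, S.envelope T (i.succAbove j) (x j) := by
  unfold envelopeErase
  have h : ∀ f : Fin (n + 1) → ℝ, ∏ j ∈ Finset.univ.erase i, f j = ∏ j, f (i.succAbove j) := by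
    intro f
    rw [Fin.univ_succAbove n i, Finset.erase_cons, Finset.prod_map]
    rfl
  rw [h]
  simp

end OrthExpansion

/-! ### Integration of the dissipation in the space variables -/

/-- Product measures depend monotonically on their factors. -/
theorem MeasureTheory.Measure.pi_mono_of_sigmaFinite {ι : Type*} [Fintype ι] {α : ι → Type*}
    [∀ j, MeasurableSpace (α j)] {ν μ : ∀ j, Measure (α j)} [∀ j, SigmaFinite (ν j)]
    (h : ∀ j, ν j ≤ μ j) : Measure.pi ν ≤ Measure.pi μ := by
  have h1 : (Measure.pi ν).toOuterMeasure ≤ OuterMeasure.pi fun j => (μ j).toOuterMeasure := by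
    refine OuterMeasure.le_pi.2 fun s _ => ?_
    change Measure.pi ν _ ≤ _
    rw [Measure.pi_pi]
    exact Finset.prod_le_prod' fun j _ => h j (s j)
  refine Measure.le_iff'.2 fun s => (h1 s).trans ?_
  rw [Measure.pi_def]
  exact le_toMeasure_apply _ _ _

namespace OrthExpansion

variable {d : ℕ} {S : OrthExpansion d}

/-- A finite measure `ν ≤ μ_i` on `[a, b] ⊆ X_i` for which the integral of `w_i⁻¹ (p_i² w_i β')'`
is a sum of slopes of `β` over flat pieces at the end points of `[a, b]`. -/
structure CutoffMeasure (S : OrthExpansion d) (T : Finset ℕ) (m : ℕ) (M η : ℝ) (i : Fin d)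
    (ν : Measure ℝ) (a b : ℝ) : Prop where
  finite : IsFiniteMeasure ν
  le_mu1 : ν ≤ S.mu1 i
  mem_left : a ∈ S.X1 i
  mem_right : b ∈ S.X1 i
  compl_eq_zero : ν (Set.Icc a b)ᶜ = 0
  integral_eq : ∃ a₀ ∈ Set.Icc a b, ∃ b₀ ∈ Set.Icc a b, ∃ Δl Δr : ℝ,
    S.FlatPiece T i m M η a₀ a Δl ∧ S.FlatPiece T i m M η b₀ b Δr ∧
    ∀ β β₁ g : ℝ → ℝ, (∀ y ∈ Set.Icc a b, HasDerivAt β (β₁ y) y) →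
      (∀ y ∈ Set.Icc a b, HasDerivAt (fun y => S.diffusion i y * β₁ y) (S.w i y * g y) y) →
      ContinuousOn g (Set.Icc a b) →
      ∫ y, g y ∂ν = (β b - β b₀) / Δr + (β a - β a₀) / Δl

theorem exists_cutoffMeasure (hS : S.Standing) (hT2 : S.T2) (i : Fin d) (T : Finset ℕ) (m : ℕ) :
    ∃ M, 0 ≤ M ∧ ∀ η > 0, ∀ xl ∈ S.X1 i, ∀ xr ∈ S.X1 i, xl ≤ xr →
      ∃ ν a b, S.CutoffMeasure T m M η i ν a b ∧ (S.mu1 i).restrict (Set.Icc xl xr) ≤ ν := by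
  obtain ⟨M, hM, H⟩ := exists_coordinate_cutoff hS hT2 i T m
  refine ⟨M, hM, fun η hη xl hxl xr hxr hlr => ?_⟩
  obtain ⟨a, ha, b, hb, a₀, ha₀, b₀, hb₀, Δl, Δr, h1, h2, ν, h3, h4, h5, h6, h7⟩ :=
    H η hη xl hxl xr hxr hlr
  exact ⟨ν, a, b, ⟨h3, h4, ha, hb, h5, a₀, ha₀, b₀, hb₀, Δl, Δr, h1, h2, h7⟩, h6⟩

section Box

variable {T : Finset ℕ} {m : ℕ} {M : Fin d → ℝ} {η : ℝ} {ν : Fin d → Measure ℝ} {a b : Fin d → ℝ}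
  (hν : ∀ i, S.CutoffMeasure T m (M i) η i (ν i) (a i) (b i))
include hν

theorem box_subset_X : (Set.univ.pi fun i => Set.Icc (a i) (b i)) ⊆ S.X := fun _ hx i =>
  (S.ordConnected_X1 i).out (hν i).mem_left (hν i).mem_right (hx i trivial)

theorem pi_restrict_box :
    (Measure.pi ν).restrict (Set.univ.pi fun i => Set.Icc (a i) (b i)) = Measure.pi ν := by
  have := fun i => (hν i).finite
  refine Measure.restrict_eq_self_of_ae_mem ?_
  have h1 : ∀ i, ∀ᵐ x ∂(Measure.pi ν), x i ∈ Set.Icc (a i) (b i) := fun i =>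
    Measure.tendsto_eval_ae_ae.eventually (mem_ae_iff.2 (hν i).compl_eq_zero)
  exact (eventually_all.2 h1).mono fun _ hx i _ => hx i

theorem integrable_pi_of_continuousOn {f : (Fin d → ℝ) → ℝ} (hf : ContinuousOn f S.X) :
    Integrable f (Measure.pi ν) := by
  have := fun i => (hν i).finite
  rw [← pi_restrict_box hν]
  exact (hf.mono (box_subset_X hν)).integrableOn_compact (isCompact_univ_pi fun _ => isCompact_Icc)

theorem integrable_prod_of_continuousOn {f : ℝ × (Fin d → ℝ) → ℝ}
    (hf : ContinuousOn f (Set.univ ×ˢ S.X)) (t : ℝ) :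
    Integrable f ((volume.restrict (Set.Ioc 0 t)).prod (Measure.pi ν)) := by
  have := fun i => (hν i).finite
  rw [← pi_restrict_box hν, Measure.prod_restrict]
  exact ((hf.mono (Set.prod_mono (Set.subset_univ _) (box_subset_X hν))).integrableOn_compact
    (isCompact_Icc.prod (isCompact_univ_pi fun _ => isCompact_Icc))).mono_set
    (Set.prod_mono Set.Ioc_subset_Icc_self subset_rfl)

end Box

theorem continuousOn_slice {f : ℝ × (Fin d → ℝ) → ℝ} (hf : ContinuousOn f (Set.univ ×ˢ S.X))
    (t : ℝ) : ContinuousOn (fun x => f (t, x)) S.X :=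
  hf.comp (by fun_prop) fun _ hx => ⟨trivial, hx⟩

variable {c : ℝ} {B : SmoothBellman c} {s : Finset (Fin d → ℕ)}
  {A : Option (Fin d) → (Fin d → ℕ) → ℝ} {T : Finset ℕ} {C : ℝ} {m : ℕ}

theorem CutoffMeasure.integral_bL_update {M η : ℝ} {i : Fin d} {ν : Measure ℝ} {a b : ℝ}
    (hν : S.CutoffMeasure T m M η i ν a b) (hS : S.Standing) (t : ℝ) {z : Fin d → ℝ}
    (hz : z ∈ S.X) : ∃ a₀ b₀ Δl Δr : ℝ,
      S.FlatPiece T i m M η a₀ a Δl ∧ S.FlatPiece T i m M η b₀ b Δr ∧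
      ∫ y, S.bL B s A i t (Function.update z i y) ∂ν =
        (S.bVal B s A t (Function.update z i b) - S.bVal B s A t (Function.update z i b₀)) / Δr
        + (S.bVal B s A t (Function.update z i a) - S.bVal B s A t (Function.update z i a₀)) / Δl := by
  obtain ⟨a₀, -, b₀, -, Δl, Δr, fl, fr, hg⟩ := hν.integral_eq
  have hIcc : ∀ y ∈ Set.Icc a b, y ∈ S.X1 i := fun y hy =>
    (S.ordConnected_X1 i).out hν.mem_left hν.mem_right hy
  have hup : Continuous fun y : ℝ => Function.update z i y := continuous_const.update i continuous_id
  have hcont : ContinuousOn (fun y => S.bL B s A i t (Function.update z i y)) (Set.Icc a b) :=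
    (continuousOn_slice (continuousOn_bL (B := B) (s := s) (A := A) hS i) t).comp
      (f := fun y => Function.update z i y) hup.continuousOn
      fun y hy => update_mem_X hz (hIcc y hy)
  exact ⟨a₀, b₀, Δl, Δr, fl, fr, hg (fun y => S.bVal B s A t (Function.update z i y))
    (fun y => S.bX B s A i t (Function.update z i y)) _
    (fun y hy => hasDerivAt_bVal_update hS i t z (hIcc y hy))
    (fun y hy => hasDerivAt_diffusion_bX hS i t z (hIcc y hy)) hcont⟩

/-- The integral of `w_i⁻¹ ∂_i (p_i² w_i ∂_i ⬝)` of the Bellman function against a product of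
cutoff measures is almost nonpositive. -/
theorem exists_integral_bL_le (hS : S.Standing) (hT3 : S.T3) (hC : 0 ≤ C)
    (h : ∀ {x y : ℝ}, 0 ≤ x → 0 ≤ y →
      B.bX x y ≤ C * (1 + x + y) ^ m ∧ B.bY x y ≤ C * (1 + x + y) ^ m)
    (hs : ∀ k ∈ s, ∀ i, k i ∈ T) {M : Fin d → ℝ} (hM : ∀ i, 0 ≤ M i) (i : Fin d) :
    ∃ K, 0 ≤ K ∧ ∀ {η t : ℝ} {ν : Fin d → Measure ℝ} {a b : Fin d → ℝ}, 0 ≤ η → 0 ≤ t →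
      (∀ i, S.CutoffMeasure T m (M i) η i (ν i) (a i) (b i)) →
      ∫ x, S.bL B s A i t x ∂(Measure.pi ν) ≤ K * η := by
  obtain ⟨n, rfl⟩ : ∃ n, d = n + 1 := ⟨d - 1, by have := i.pos; omega⟩
  obtain ⟨K, hK, H⟩ := exists_slope_le (A := A) (S := S) hC h hs (hM i)
  set E : (Fin n → ℝ) → ℝ := fun x => gauge m (∏ j, S.envelope T (i.succAbove j) (x j)) with hE
  have hE0 : ∀ x, 0 ≤ E x := fun x =>
    gauge_nonneg m (Finset.prod_nonneg fun j _ => envelope_nonneg _ _ _)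
  have hEint := integrable_gauge_prod hS hT3 T m i.succAbove
  refine ⟨2 * K * ∫ x, E x ∂(Measure.pi fun j => S.mu1 (i.succAbove j)),
    mul_nonneg (by positivity) (integral_nonneg hE0), fun {η t ν a b} hη ht hν => ?_⟩
  have := fun i => (hν i).finite
  have mp := (measurePreserving_piFinSuccAbove ν i).symm
  have hint : Integrable (fun z =>
      S.bL B s A i t ((MeasurableEquiv.piFinSuccAbove (fun _ => ℝ) i).symm z))
      ((ν i).prod (Measure.pi fun j => ν (i.succAbove j))) :=
    (mp.integrable_comp_emb (MeasurableEquiv.measurableEmbedding _)).2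
    (integrable_pi_of_continuousOn hν
      (continuousOn_slice (continuousOn_bL (B := B) (s := s) (A := A) hS i) t))
  rw [← mp.integral_comp', integral_prod_symm _ hint]
  have hle : (Measure.pi fun j => ν (i.succAbove j)) ≤
      Measure.pi fun j => S.mu1 (i.succAbove j) :=
    Measure.pi_mono_of_sigmaFinite fun j => (hν _).le_mu1
  have hmem : ∀ᵐ x ∂(Measure.pi fun j => ν (i.succAbove j)),
      ∀ j, x j ∈ Set.Icc (a (i.succAbove j)) (b (i.succAbove j)) :=
    eventually_all.2 fun j =>
      Measure.tendsto_eval_ae_ae.eventually (mem_ae_iff.2 (hν (i.succAbove j)).compl_eq_zero)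
  have hinner : ∀ᵐ x ∂(Measure.pi fun j => ν (i.succAbove j)),
      ∫ y, S.bL B s A i t ((MeasurableEquiv.piFinSuccAbove (fun _ => ℝ) i).symm (y, x)) ∂(ν i) ≤
        2 * K * η * E x := by
    filter_upwards [hmem] with x hx
    set z : Fin (n + 1) → ℝ := i.insertNth (α := fun _ => ℝ) (a i) x with hz
    have hzX : z ∈ S.X := by
      intro j
      rcases Fin.eq_self_or_eq_succAbove i j with rfl | ⟨l, rfl⟩
      · rw [hz, Fin.insertNth_apply_same]; exact (hν _).mem_left
      · rw [hz, Fin.insertNth_apply_succAbove]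
        exact (S.ordConnected_X1 _).out (hν _).mem_left (hν _).mem_right (hx l)
    have hzu : ∀ y, (MeasurableEquiv.piFinSuccAbove (fun _ => ℝ) i).symm (y, x) =
        Function.update z i y := fun y => by
      rw [piFinSuccAbove_symm_eq, hz, Fin.update_insertNth]
    obtain ⟨a₀, b₀, Δl, Δr, fl, fr, hg⟩ := (hν i).integral_bL_update hS t hzX (B := B) (s := s)
      (A := A)
    simp only [hzu]
    rw [hg]
    have hEz : gauge m (S.envelopeErase T i z) = E x := by
      rw [hz, envelopeErase_insertNth]
    have h1 := H (x := z) hη ht fl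
    have h2 := H (x := z) hη ht fr
    rw [hEz] at h1 h2
    linarith
  calc _ ≤ ∫ x, 2 * K * η * E x ∂(Measure.pi fun j => ν (i.succAbove j)) :=
        integral_mono_ae hint.integral_prod_right ((hEint.mono_measure hle).const_mul _) hinner
    _ = 2 * K * η * ∫ x, E x ∂(Measure.pi fun j => ν (i.succAbove j)) := integral_const_mul _ _
    _ ≤ 2 * K * η * ∫ x, E x ∂(Measure.pi fun j => S.mu1 (i.succAbove j)) :=
        mul_le_mul_of_nonneg_left (integral_mono_measure hle (ae_of_all _ hE0) hEint)
          (by positivity)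
    _ = _ := by ring

end OrthExpansion

/-! ### Integration of the dissipation in space and time -/

namespace OrthExpansion

variable {d : ℕ} {S : OrthExpansion d}

instance : SigmaFinite S.mu := by unfold mu; infer_instance

theorem measurableSet_X : MeasurableSet S.X := by
  have : S.X = Set.univ.pi S.X1 := by ext x; simp [X]
  rw [this]
  exact MeasurableSet.univ_pi fun i => (S.isOpen_X1 i).measurableSet

theorem ae_mem_X : ∀ᵐ x ∂S.mu, x ∈ S.X := by
  have h1 : ∀ i, ∀ᵐ y ∂(S.mu1 i), y ∈ S.X1 i := fun i =>
    (withDensity_absolutelyContinuous _ _).ae_le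
      (ae_restrict_mem (S.isOpen_X1 i).measurableSet)
  exact eventually_all.2 fun i => Measure.tendsto_eval_ae_ae.eventually (h1 i)

theorem restrict_X : S.mu.restrict S.X = S.mu := Measure.restrict_eq_self_of_ae_mem ae_mem_X

theorem aestronglyMeasurable_mu {f : (Fin d → ℝ) → ℝ} (hf : ContinuousOn f S.X) :
    AEStronglyMeasurable f S.mu := by
  rw [← restrict_X]
  exact hf.aestronglyMeasurable measurableSet_X

variable {c : ℝ} {B : SmoothBellman c} {s : Finset (Fin d → ℕ)}
  {A : Option (Fin d) → (Fin d → ℕ) → ℝ}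

theorem forall_mem_image_univ {k : Fin d → ℕ} (hk : k ∈ s) (i : Fin d) :
    k i ∈ s.biUnion fun k => Finset.univ.image k :=
  Finset.mem_biUnion.2 ⟨k, hk, Finset.mem_image_of_mem _ (Finset.mem_univ i)⟩

theorem integrable_bVal (hS : S.Standing) (hT3 : S.T3) {t : ℝ} (ht : 0 ≤ t) :
    Integrable (S.bVal B s A t) S.mu := by
  obtain ⟨C, hC, m, h⟩ := B.growth
  obtain ⟨K, hK, H⟩ := bVal_le_gauge (S := S) (A := A) hC h
    (s := s) fun k hk => forall_mem_image_univ hk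
  refine ((integrable_gauge_envelopeProd hS hT3 _ m).const_mul K).mono'
    (aestronglyMeasurable_mu (continuousOn_slice (continuousOn_bVal hS) t))
    (ae_of_all _ fun x => (Real.norm_of_nonneg (bVal_nonneg t x)).trans_le (H ht))

/-- Integration by parts in the time variable. -/
theorem integral_mul_bTT (hS : S.Standing) {x : Fin d → ℝ} (hx : x ∈ S.X) {t₀ : ℝ} (ht : 0 ≤ t₀) :
    ∫ t in Set.Ioc 0 t₀, t * S.bTT B s A t x =
      t₀ * S.bT B s A t₀ x - S.bVal B s A t₀ x + S.bVal B s A 0 x := by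
  rw [← intervalIntegral.integral_of_le ht]
  have hc : Continuous fun t => S.bTT B s A t x :=
    continuousOn_univ.1 ((continuousOn_bTT (B := B) (s := s) (A := A) hS).comp
      (f := fun t : ℝ => (t, x)) (by fun_prop) fun t _ => ⟨trivial, hx⟩)
  rw [intervalIntegral.integral_eq_sub_of_hasDerivAt
    (f := fun t => t * S.bT B s A t x - S.bVal B s A t x) (fun t _ => ?_)
    ((by fun_prop : Continuous fun t => t * S.bTT B s A t x).intervalIntegrable _ _)]
  · ring
  · exact (((hasDerivAt_id t).mul (hasDerivAt_bT t x)).sub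
      (hasDerivAt_bVal_time t x)).congr_deriv (by simp [id])

theorem continuousOn_dissipation (hS : S.Standing) :
    ContinuousOn (fun z : ℝ × (Fin d → ℝ) =>
      z.1 * (S.bTT B s A z.1 z.2 + ∑ i, S.bL B s A i z.1 z.2)) (Set.univ ×ˢ S.X) :=
  continuousOn_fst.mul ((continuousOn_bTT hS).add
    (continuousOn_finsetSum _ fun i _ => continuousOn_bL hS i))

/-- The integral of the dissipation over a bounded time interval against a product of cutoff
measures. -/
theorem exists_integral_dissipation_le (hS : S.Standing) (hT2 : S.T2) (hT3 : S.T3) :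
    ∃ (T : Finset ℕ) (m : ℕ) (M : Fin d → ℝ) (K κ L : ℝ), 0 < κ ∧
      (∀ i, ∀ η > 0, ∀ xl ∈ S.X1 i, ∀ xr ∈ S.X1 i, xl ≤ xr →
        ∃ ν a b, S.CutoffMeasure T m (M i) η i ν a b ∧
          (S.mu1 i).restrict (Set.Icc xl xr) ≤ ν) ∧
      ∀ {η t₀ : ℝ} {ν : Fin d → Measure ℝ} {a b : Fin d → ℝ}, 0 ≤ η → 0 ≤ t₀ →
        (∀ i, S.CutoffMeasure T m (M i) η i (ν i) (a i) (b i)) →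
        ∫ z : ℝ × (Fin d → ℝ), z.1 * (S.bTT B s A z.1 z.2 + ∑ i, S.bL B s A i z.1 z.2)
            ∂((volume.restrict (Set.Ioc 0 t₀)).prod (Measure.pi ν)) ≤
          ∫ x, S.bVal B s A 0 x ∂S.mu + t₀ * (K * Real.exp (-t₀ * κ)) + L * t₀ ^ 2 * η := by
  obtain ⟨C, hC, m, h⟩ := B.growth
  set T := s.biUnion fun k => Finset.univ.image k with hT
  have hs : ∀ k ∈ s, ∀ i, k i ∈ T := fun k hk => forall_mem_image_univ hk
  choose M hM HM using fun i => exists_cutoffMeasure hS hT2 i T m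
  choose L hL HL using fun i => exists_integral_bL_le (A := A) hS hT3 hC h hs hM i
  obtain ⟨K, hK, κ, hκ, HK⟩ := abs_bT_le_gauge (S := S) (A := A) hC h hs
  have hEint := integrable_gauge_envelopeProd hS hT3 T m
  have hE0 : ∀ x, 0 ≤ gauge m (S.envelopeProd T x) := fun x =>
    gauge_nonneg m (envelopeProd_nonneg x)
  refine ⟨T, m, M, K * ∫ x, gauge m (S.envelopeProd T x) ∂S.mu, κ, ∑ i, L i, hκ, HM,
    fun {η t₀ ν a b} hη ht₀ hν => ?_⟩
  have := fun i => (hν i).finite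
  have hle : Measure.pi ν ≤ S.mu := Measure.pi_mono_of_sigmaFinite fun i => (hν i).le_mu1
  have hmem : ∀ᵐ x ∂(Measure.pi ν), x ∈ S.X := (ae_mono hle) ae_mem_X
  have i1 : Integrable (fun z : ℝ × (Fin d → ℝ) => z.1 * S.bTT B s A z.1 z.2)
      ((volume.restrict (Set.Ioc 0 t₀)).prod (Measure.pi ν)) :=
    integrable_prod_of_continuousOn hν (continuousOn_fst.mul (continuousOn_bTT hS)) t₀
  have i2 : ∀ i, Integrable (fun z : ℝ × (Fin d → ℝ) => z.1 * S.bL B s A i z.1 z.2)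
      ((volume.restrict (Set.Ioc 0 t₀)).prod (Measure.pi ν)) := fun i =>
    integrable_prod_of_continuousOn hν (continuousOn_fst.mul (continuousOn_bL hS i)) t₀
  simp only [mul_add, Finset.mul_sum]
  rw [integral_add i1 (integrable_finsetSum _ fun i _ => i2 i), integral_finsetSum _ fun i _ => i2 i]
  refine add_le_add ?_ ?_
  · rw [integral_prod_symm _ i1]
    calc _ ≤ ∫ x, (t₀ * (K * Real.exp (-t₀ * κ)) * gauge m (S.envelopeProd T x)
            + S.bVal B s A 0 x) ∂(Measure.pi ν) := by
          refine integral_mono_ae i1.integral_prod_right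
            (((hEint.mono_measure hle).const_mul _).add
              ((integrable_bVal hS hT3 le_rfl).mono_measure hle)) ?_
          filter_upwards [hmem] with x hx
          simp only [integral_mul_bTT hS hx ht₀]
          have h1 := (le_abs_self _).trans (HK (x := x) ht₀)
          have h2 := bVal_nonneg (B := B) (S := S) (s := s) (A := A) t₀ x
          have h3 := mul_le_mul_of_nonneg_left h1 ht₀
          linarith
      _ = t₀ * (K * Real.exp (-t₀ * κ)) * ∫ x, gauge m (S.envelopeProd T x) ∂(Measure.pi ν)
            + ∫ x, S.bVal B s A 0 x ∂(Measure.pi ν) := by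
          rw [integral_add ((hEint.mono_measure hle).const_mul _)
            ((integrable_bVal hS hT3 le_rfl).mono_measure hle), integral_const_mul]
      _ ≤ t₀ * (K * Real.exp (-t₀ * κ)) * ∫ x, gauge m (S.envelopeProd T x) ∂S.mu
            + ∫ x, S.bVal B s A 0 x ∂S.mu :=
          add_le_add (mul_le_mul_of_nonneg_left
            (integral_mono_measure hle (ae_of_all _ hE0) hEint) (by positivity))
            (integral_mono_measure hle (ae_of_all _ fun x => bVal_nonneg _ x)
              (integrable_bVal hS hT3 le_rfl))
      _ = _ := by ring
  · rw [Finset.sum_mul, Finset.sum_mul]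
    refine Finset.sum_le_sum fun i _ => ?_
    rw [integral_prod _ (i2 i)]
    calc _ ≤ ∫ t in Set.Ioc 0 t₀, t₀ * (L i * η) := by
          refine setIntegral_mono_on (i2 i).integral_prod_left
            (integrableOn_const (by simp)) measurableSet_Ioc
            fun t ht => ?_
          rw [integral_const_mul]
          have := mul_nonneg (hL i) hη
          calc _ ≤ t * (L i * η) := mul_le_mul_of_nonneg_left (HL i hη ht.1.le hν) ht.1.le
            _ ≤ _ := by gcongr; exact ht.2
      _ = _ := by
          rw [setIntegral_const]
          rw [measureReal_def, Real.volume_Ioc, ENNReal.toReal_ofReal (by linarith), smul_eq_mul]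
          ring

/-- The embedding on bounded sets, before passage to the limit. -/
theorem exists_setLIntegral_le (hS : S.Standing) (hA1 : S.A1) (hA2 : S.A2) (hT2 : S.T2)
    (hT3 : S.T3) (hc : 0 ≤ c) (B : SmoothBellman c) : ∃ K κ : ℝ, 0 < κ ∧
      ∀ (t₀ : ℝ) (xl xr : Fin d → ℝ), 0 ≤ t₀ → (∀ i, xl i ∈ S.X1 i) → (∀ i, xr i ∈ S.X1 i) →
        (∀ i, xl i ≤ xr i) →
        ∫⁻ t in Set.Ioc 0 t₀, ∫⁻ x in Set.univ.pi fun i => Set.Icc (xl i) (xr i),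
          ENNReal.ofReal (2 * c * (S.starNorm (fun _ : Fin 1 => S.comp s A none) x t *
            S.starNorm (fun i : Fin d => S.comp s A (some i)) x t) * t) ∂S.mu ≤
        ENNReal.ofReal (∫ x, S.bVal B s A 0 x ∂S.mu + t₀ * (K * Real.exp (-t₀ * κ))) := by
  obtain ⟨T, m, M, K, κ, L, hκ, H1, H2⟩ :=
    exists_integral_dissipation_le (B := B) (s := s) (A := A) hS hT2 hT3
  refine ⟨K, κ, hκ, fun t₀ xl xr ht₀ hxl hxr hlr => ?_⟩
  set R := ∫ x, S.bVal B s A 0 x ∂S.mu + t₀ * (K * Real.exp (-t₀ * κ)) with hR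
  have hlim : Tendsto (fun η : ℝ => ENNReal.ofReal (R + L * t₀ ^ 2 * η)) (𝓝[>] 0)
      (𝓝 (ENNReal.ofReal R)) := by
    have : Continuous fun η : ℝ => ENNReal.ofReal (R + L * t₀ ^ 2 * η) :=
      ENNReal.continuous_ofReal.comp (by fun_prop)
    simpa using (this.tendsto 0).mono_left nhdsWithin_le_nhds
  refine ge_of_tendsto hlim (eventually_nhdsWithin_of_forall fun η (hη : 0 < η) => ?_)
  choose ν a b hν hν' using fun i => H1 i η hη (xl i) (hxl i) (xr i) (hxr i) (hlr i)
  have := fun i => (hν i).finite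
  have hle : S.mu.restrict (Set.univ.pi fun i => Set.Icc (xl i) (xr i)) ≤ Measure.pi ν := by
    unfold mu
    rw [Measure.restrict_pi_pi]
    exact Measure.pi_mono_of_sigmaFinite hν'
  have hmem : ∀ᵐ x ∂(Measure.pi ν), x ∈ S.X :=
    (ae_mono (Measure.pi_mono_of_sigmaFinite fun i => (hν i).le_mu1)) ae_mem_X
  have hint := integrable_prod_of_continuousOn hν
    (continuousOn_dissipation (B := B) (s := s) (A := A) hS) t₀
  have hdiss : ∀ t : ℝ, 0 ≤ t → ∀ x ∈ S.X,
      2 * c * (S.starNorm (fun _ : Fin 1 => S.comp s A none) x t *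
        S.starNorm (fun i : Fin d => S.comp s A (some i)) x t) * t ≤
      t * (S.bTT B s A t x + ∑ i, S.bL B s A i t x) := fun t ht x hx => by
    rw [mul_comm _ t]
    exact mul_le_mul_of_nonneg_left (le_bTT_add_sum_bL hS hA1 hA2 hc t hx) ht
  calc _ ≤ ∫⁻ t in Set.Ioc 0 t₀, ∫⁻ x,
        ENNReal.ofReal (t * (S.bTT B s A t x + ∑ i, S.bL B s A i t x)) ∂(Measure.pi ν) := by
        refine setLIntegral_mono' measurableSet_Ioc fun t ht => ?_
        refine (lintegral_mono' hle le_rfl).trans (lintegral_mono_ae ?_)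
        filter_upwards [hmem] with x hx
        exact ENNReal.ofReal_le_ofReal (hdiss t ht.1.le x hx)
    _ = ∫⁻ z : ℝ × (Fin d → ℝ),
          ENNReal.ofReal (z.1 * (S.bTT B s A z.1 z.2 + ∑ i, S.bL B s A i z.1 z.2))
          ∂((volume.restrict (Set.Ioc 0 t₀)).prod (Measure.pi ν)) :=
        (lintegral_prod _ hint.aestronglyMeasurable.aemeasurable.ennreal_ofReal).symm
    _ = ENNReal.ofReal (∫ z : ℝ × (Fin d → ℝ),
          z.1 * (S.bTT B s A z.1 z.2 + ∑ i, S.bL B s A i z.1 z.2)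
          ∂((volume.restrict (Set.Ioc 0 t₀)).prod (Measure.pi ν))) := by
        refine (ofReal_integral_eq_lintegral_ofReal hint ?_).symm
        rw [← pi_restrict_box hν, Measure.prod_restrict]
        refine ae_restrict_of_forall_mem
          (measurableSet_Ioc.prod (MeasurableSet.univ_pi fun _ => measurableSet_Icc))
          fun z hz => le_trans ?_ (hdiss z.1 hz.1.1.le z.2 (box_subset_X hν hz.2))
        have := hz.1.1.le
        have := Real.sqrt_nonneg
        unfold starNorm
        positivity
    _ ≤ _ := ENNReal.ofReal_le_ofReal (H2 hη.le ht₀ hν)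

end OrthExpansion

/-! ### Exhaustion of the half space -/

namespace OrthExpansion

variable {d : ℕ} {S : OrthExpansion d} {c : ℝ} {s : Finset (Fin d → ℕ)}
  {A : Option (Fin d) → (Fin d → ℕ) → ℝ}

theorem exists_exhaustion_X1 (hS : S.Standing) (i : Fin d) : ∃ u v : ℕ → ℝ,
    (∀ n, u n ∈ S.X1 i ∧ v n ∈ S.X1 i ∧ u n ≤ v n) ∧ Antitone u ∧ Monotone v ∧
      ∀ x ∈ S.X1 i, ∀ᶠ n in atTop, x ∈ Set.Icc (u n) (v n) := by
  obtain ⟨z, hz⟩ := S.nonempty_X1 hS i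
  obtain ⟨u, hu, hu', hul⟩ := exists_seq_strictAnti_tendsto' hz.1
  obtain ⟨v, hv, hv', hvl⟩ := exists_seq_strictMono_tendsto' hz.2
  have eu : ∀ n, (((u n).toReal : ℝ) : EReal) = u n := fun n =>
    EReal.coe_toReal ((hu' n).2.trans (EReal.coe_lt_top z)).ne (bot_le.trans_lt (hu' n).1).ne'
  have ev : ∀ n, (((v n).toReal : ℝ) : EReal) = v n := fun n =>
    EReal.coe_toReal ((hv' n).2.trans_le le_top).ne ((EReal.bot_lt_coe z).trans (hv' n).1).ne'
  refine ⟨fun n => (u n).toReal, fun n => (v n).toReal, fun n => ⟨?_, ?_, ?_⟩, ?_, ?_, ?_⟩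
  · refine ⟨?_, ?_⟩
    · rw [eu]; exact (hu' n).1
    · rw [eu]; exact (hu' n).2.trans hz.2
  · refine ⟨?_, ?_⟩
    · rw [ev]; exact hz.1.trans (hv' n).1
    · rw [ev]; exact (hv' n).2
  · rw [← EReal.coe_le_coe_iff, eu, ev]
    exact ((hu' n).2.trans (hv' n).1).le
  · intro m n hmn
    rw [← EReal.coe_le_coe_iff, eu, eu]
    exact hu.antitone hmn
  · intro m n hmn
    rw [← EReal.coe_le_coe_iff, ev, ev]
    exact hv.monotone hmn
  · intro x hx
    filter_upwards [hul.eventually_lt_const hx.1, hvl.eventually_const_lt hx.2] with n h1 h2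
    constructor
    · rw [← EReal.coe_le_coe_iff, eu]; exact h1.le
    · rw [← EReal.coe_le_coe_iff, ev]; exact h2.le

theorem continuousOn_starNorm (hS : S.Standing) {N : ℕ} (e : Fin N → Option (Fin d)) :
    ContinuousOn (fun z : ℝ × (Fin d → ℝ) => S.starNorm (fun n => S.comp s A (e n)) z.2 z.1)
      (Set.univ ×ˢ S.X) := by
  have hr : ContinuousOn (fun z : ℝ × (Fin d → ℝ) => S.r z.2) (Set.univ ×ˢ S.X) :=
    continuousOn_finsetSum _ fun i _ => continuousOn_comp_coord (hS.continuousOn_r1 i)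
  refine ContinuousOn.congr (f := fun z : ℝ × (Fin d → ℝ) =>
    √(S.r z.2 * ∑ n, (S.comp s A (e n) z.1 z.2) ^ 2
      + ∑ n, (S.comp s (S.timeCoeff A) (e n) z.1 z.2) ^ 2
      + ∑ i, ∑ n, (S.pc i (z.2 i) * S.fieldX s (slot (e n)) (A (e n)) i z.1 z.2) ^ 2)) ?_ ?_
  · refine (((hr.mul (continuousOn_sum_sq fun n => continuousOn_field hS)).add
      (continuousOn_sum_sq fun n => continuousOn_field hS)).add
      (continuousOn_finsetSum _ fun i _ => continuousOn_sum_sq fun n =>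
        (continuousOn_comp_coord (hS.pc_smooth i).continuousOn).mul
          (continuousOn_fieldX hS i))).sqrt
  · intro z hz
    have h1 : ∀ n, deriv (fun τ => S.comp s A (e n) τ z.2) z.1 =
        S.comp s (S.timeCoeff A) (e n) z.1 z.2 := fun n => (hasDerivAt_comp_time _ _ _).deriv
    have h2 : ∀ i n, S.dOp i (S.comp s A (e n) z.1) z.2 =
        S.pc i (z.2 i) * S.fieldX s (slot (e n)) (A (e n)) i z.1 z.2 := fun i n =>
      dOp_field hS i z.1 hz.2
    simp only [starNorm, h1, h2]

/-- The bilinear embedding with the Bellman function of the boundary values as majorant. -/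
theorem lintegral_starNorm_mul_le (hS : S.Standing) (hA1 : S.A1) (hA2 : S.A2) (hT2 : S.T2)
    (hT3 : S.T3) (hc : 0 ≤ c) (B : SmoothBellman c) :
    ∫⁻ t in Set.Ioi (0 : ℝ), ∫⁻ x,
        ENNReal.ofReal (2 * c * (S.starNorm (fun _ : Fin 1 => S.comp s A none) x t *
          S.starNorm (fun i : Fin d => S.comp s A (some i)) x t) * t) ∂S.mu ≤
      ENNReal.ofReal (∫ x, S.bVal B s A 0 x ∂S.mu) := by
  obtain ⟨K, κ, hκ, H⟩ := exists_setLIntegral_le (s := s) (A := A) hS hA1 hA2 hT2 hT3 hc B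
  choose u v huv hu hv hx using exists_exhaustion_X1 hS
  set F : ℝ × (Fin d → ℝ) → ℝ≥0∞ := fun z =>
    ENNReal.ofReal (2 * c * (S.starNorm (fun _ : Fin 1 => S.comp s A none) z.2 z.1 *
      S.starNorm (fun i : Fin d => S.comp s A (some i)) z.2 z.1) * z.1) with hF
  have hFm : AEMeasurable F ((volume.prod S.mu).restrict (Set.univ ×ˢ S.X)) :=
    (ContinuousOn.aemeasurable (((continuousOn_const.mul
      ((continuousOn_starNorm hS fun _ => none).mul (continuousOn_starNorm hS some))).mul
      continuousOn_fst)) (MeasurableSet.univ.prod measurableSet_X)).ennreal_ofReal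
  have hXle : ∀ D : Set ℝ, ((volume.restrict D).prod S.mu) ≤
      (volume.prod S.mu).restrict (Set.univ ×ˢ S.X) := fun D => by
    rw [← Measure.prod_restrict, Measure.restrict_univ, restrict_X]
    exact Measure.prod_mono Measure.restrict_le_self le_rfl
  set D : ℕ → Set (ℝ × (Fin d → ℝ)) := fun n =>
    Set.Ioc (0 : ℝ) n ×ˢ Set.univ.pi fun i => Set.Icc (u i n) (v i n) with hD
  have hDmono : Monotone D := fun m n hmn => Set.prod_mono
    (Set.Ioc_subset_Ioc_right (by exact_mod_cast hmn))
    (Set.pi_mono fun i _ => Set.Icc_subset_Icc (hu i hmn) (hv i hmn))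
  have hDU : ⋃ n, D n = Set.Ioi (0 : ℝ) ×ˢ S.X := by
    ext z
    simp only [Set.mem_iUnion]
    constructor
    · rintro ⟨n, h1, h2⟩
      exact ⟨h1.1, fun i => (S.ordConnected_X1 i).out (huv i n).1 (huv i n).2.1 (h2 i trivial)⟩
    · rintro ⟨h1, h2⟩
      have h3 : ∀ᶠ n : ℕ in atTop, ∀ i, z.2 i ∈ Set.Icc (u i n) (v i n) :=
        eventually_all.2 fun i => hx i _ (h2 i)
      have h4 : ∀ᶠ n : ℕ in atTop, z.1 ≤ n := tendsto_natCast_atTop_atTop.eventually_ge_atTop _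
      obtain ⟨n, h5, h6⟩ := (h3.and h4).exists
      exact ⟨n, ⟨h1, h6⟩, fun i _ => h5 i⟩
  have hDle : ∀ n, ∫⁻ z in D n, F z ∂(volume.prod S.mu) ≤
      ENNReal.ofReal (∫ x, S.bVal B s A 0 x ∂S.mu + n * (K * Real.exp (-n * κ))) := by
    intro n
    rw [hD]
    simp only
    rw [← Measure.prod_restrict, lintegral_prod]
    · exact H n _ _ n.cast_nonneg (fun i => (huv i n).1) (fun i => (huv i n).2.1)
        fun i => (huv i n).2.2
    · exact hFm.mono_measure ((Measure.prod_mono le_rfl Measure.restrict_le_self).trans (hXle _))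
  have hlim : Tendsto (fun n : ℕ =>
      ENNReal.ofReal (∫ x, S.bVal B s A 0 x ∂S.mu + n * (K * Real.exp (-n * κ)))) atTop
      (𝓝 (ENNReal.ofReal (∫ x, S.bVal B s A 0 x ∂S.mu))) := by
    have h1 : Tendsto (fun x : ℝ => x * (K * Real.exp (-x * κ))) atTop (𝓝 0) := by
      have h2 := (Real.tendsto_pow_mul_exp_neg_atTop_nhds_zero 1).comp
        (tendsto_id.const_mul_atTop hκ)
      have h3 := h2.const_mul (K / κ)
      rw [mul_zero] at h3
      refine h3.congr fun x => ?_
      simp only [Function.comp, id, pow_one]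
      rw [show -x * κ = -(κ * x) by ring]
      field_simp
    have h4 := (h1.comp tendsto_natCast_atTop_atTop).const_add (∫ x, S.bVal B s A 0 x ∂S.mu)
    rw [add_zero] at h4
    exact (ENNReal.continuous_ofReal.tendsto _).comp h4
  calc _ = ∫⁻ z, F z ∂((volume.restrict (Set.Ioi 0)).prod S.mu) :=
        (lintegral_prod _ (hFm.mono_measure (hXle _))).symm
    _ = ∫⁻ z in ⋃ n, D n, F z ∂(volume.prod S.mu) := by
        rw [hDU, ← Measure.prod_restrict, restrict_X]
    _ = ⨆ n, ∫⁻ z in D n, F z ∂(volume.prod S.mu) :=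
        setLIntegral_iUnion_of_directed _ hDmono.directed_le
    _ ≤ _ := by
        refine iSup_le fun n => ge_of_tendsto hlim ?_
        filter_upwards [eventually_ge_atTop n] with l hl
        exact (lintegral_mono_set (hDmono hl)).trans (hDle l)

end OrthExpansion

/-! ### The embedding for finite expansions -/

namespace OrthExpansion

variable {d : ℕ} {S : OrthExpansion d}

theorem sq_rpow_half (u p : ℝ) : (u ^ 2) ^ (p / 2) = |u| ^ p := by
  rw [← sq_abs, ← Real.rpow_natCast, ← Real.rpow_mul (abs_nonneg u)]
  congr 1
  push_cast
  ring

theorem rpow_half_eq_sqrt_rpow {y : ℝ} (hy : 0 ≤ y) (q : ℝ) : y ^ (q / 2) = |√y| ^ q := by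
  rw [← sq_rpow_half, Real.sq_sqrt hy]

theorem one_lt_of_conj {p q : ℝ} (hp : 1 < p) (hpq : 1 / p + 1 / q = 1) : 1 < q := by
  have hp0 : 1 / p < 1 := (div_lt_one (by linarith)).2 hp
  have hq0 : 0 < 1 / q := by linarith
  have hq1 : 1 / q < 1 := by
    have : 0 < 1 / p := by positivity
    linarith
  exact (div_lt_one (one_div_pos.1 hq0)).1 hq1

variable {s : Finset (Fin d → ℕ)} {A : Option (Fin d) → (Fin d → ℕ) → ℝ}

theorem memLp_comp (hT3 : S.T3) (n : Option (Fin d)) (t : ℝ) {r : ℝ≥0∞} (h1 : 1 ≤ r)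
    (h2 : r ≠ ⊤) : MemLp (S.comp s A n t) r S.mu :=
  memLp_finsetSum _ fun k _ => (memLp_modeProd hT3 n k h1 h2).const_mul _

theorem memLp_sqrt_sum_sq {G : Fin d → (Fin d → ℝ) → ℝ} {r : ℝ≥0∞} {μ : Measure (Fin d → ℝ)}
    (hG : ∀ i, MemLp (G i) r μ) : MemLp (fun x => √(∑ i, G i x ^ 2)) r μ := by
  refine (memLp_finsetSum Finset.univ fun i _ => (hG i).norm).mono' ?_ (ae_of_all _ fun x => ?_)
  · have := fun i => (hG i).aestronglyMeasurable.aemeasurable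
    exact AEMeasurable.aestronglyMeasurable (by fun_prop)
  · rw [Real.norm_of_nonneg (Real.sqrt_nonneg _)]
    refine Real.sqrt_le_iff.2 ⟨Finset.sum_nonneg fun _ _ => norm_nonneg _, ?_⟩
    simpa using Finset.sum_sq_le_sq_sum_of_nonneg (s := Finset.univ)
      (f := fun i => ‖G i x‖) fun _ _ => norm_nonneg _

theorem integrable_abs_rpow {g : (Fin d → ℝ) → ℝ} {μ : Measure (Fin d → ℝ)} {p : ℝ} (hp : 1 < p)
    (hg : MemLp g (ENNReal.ofReal p) μ) : Integrable (fun x => |g x| ^ p) μ := by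
  have := hg.integrable_norm_rpow (by simp; linarith) ENNReal.ofReal_ne_top
  rwa [ENNReal.toReal_ofReal (by linarith)] at this

theorem integral_abs_rpow {g : (Fin d → ℝ) → ℝ} {μ : Measure (Fin d → ℝ)} {p : ℝ} (hp : 1 < p)
    (hg : MemLp g (ENNReal.ofReal p) μ) :
    ∫ x, |g x| ^ p ∂μ = (eLpNorm g (ENNReal.ofReal p) μ).toReal ^ p := by
  have h0 : 0 ≤ ∫ x, |g x| ^ p ∂μ := integral_nonneg fun x => by positivity
  rw [hg.eLpNorm_eq_integral_rpow_norm (by simp; linarith) ENNReal.ofReal_ne_top,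
    ENNReal.toReal_ofReal (r := p) (by linarith)]
  simp only [Real.norm_eq_abs]
  rw [ENNReal.toReal_ofReal (by positivity), ← Real.rpow_mul h0, inv_mul_cancel₀ (by linarith),
    Real.rpow_one]

/-- The bilinear embedding with the sum of the powers of the norms of the boundary values as
majorant. It follows from `lintegral_starNorm_mul_le` by passage to the limit in the Bellman
functions. -/
theorem exists_lintegral_starNorm_mul_le (hS : S.Standing) (hA1 : S.A1) (hA2 : S.A2)
    (hT2 : S.T2) (hT3 : S.T3) {p q : ℝ} (hp : 1 < p) (hpq : 1 / p + 1 / q = 1) :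
    ∃ c, c * (4 * (max p (p / (p - 1)) - 1)) = 1 ∧ 0 < c ∧
      ∀ (s : Finset (Fin d → ℕ)) (A : Option (Fin d) → (Fin d → ℕ) → ℝ),
      ∫⁻ t in Set.Ioi (0 : ℝ), ∫⁻ x,
        ENNReal.ofReal (2 * c * (S.starNorm (fun _ : Fin 1 => S.comp s A none) x t *
          S.starNorm (fun i : Fin d => S.comp s A (some i)) x t) * t) ∂S.mu ≤
      ENNReal.ofReal (9 / 8 * ((eLpNorm (S.comp s A none 0) (ENNReal.ofReal p) S.mu).toReal ^ p
        + (eLpNorm (fun x => √(∑ i, S.comp s A (some i) 0 x ^ 2))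
            (ENNReal.ofReal q) S.mu).toReal ^ q)) := by
  have hq := one_lt_of_conj hp hpq
  obtain ⟨c, hc, hc0, B, ⟨C, hC, m, hdom⟩, b, hlim⟩ := exists_bellman_sequence hp hpq
  refine ⟨c, hc, hc0, fun s A => ?_⟩
  have hmF : MemLp (S.comp s A none 0) (ENNReal.ofReal p) S.mu :=
    memLp_comp hT3 none 0 (by simpa using hp.le) ENNReal.ofReal_ne_top
  have hmG : MemLp (fun x => √(∑ i, S.comp s A (some i) 0 x ^ 2)) (ENNReal.ofReal q) S.mu :=
    memLp_sqrt_sum_sq fun i =>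
      memLp_comp hT3 (some i) 0 (by simpa using hq.le) ENNReal.ofReal_ne_top
  set X : (Fin d → ℝ) → ℝ := fun x => S.comp s A none 0 x ^ 2 with hX
  set Y : (Fin d → ℝ) → ℝ := fun x => ∑ i, S.comp s A (some i) 0 x ^ 2 with hY
  have hX0 : ∀ x, 0 ≤ X x := fun x => sq_nonneg _
  have hY0 : ∀ x, 0 ≤ Y x := fun x => SmoothBellman.sum_sq_nonneg _
  have hXp : ∀ x, X x ^ (p / 2) = |S.comp s A none 0 x| ^ p := fun x => sq_rpow_half _ _
  have hYq : ∀ x, Y x ^ (q / 2) = |√(Y x)| ^ q := fun x => rpow_half_eq_sqrt_rpow (hY0 x) q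
  have iF := integrable_abs_rpow hp hmF
  have iG := integrable_abs_rpow hq hmG
  rw [← integral_abs_rpow hp hmF, ← integral_abs_rpow hq hmG, ← integral_add iF iG,
    ← integral_const_mul]
  set K := ∑ n, coeffNorm s A n ^ 2 with hKdef
  have hK : 0 ≤ K := Finset.sum_nonneg fun _ _ => sq_nonneg _
  set T := s.biUnion fun k => Finset.univ.image k with hT
  set D : (Fin d → ℝ) → ℝ := fun x => C * K * ((1 + K) ^ m * 2 ^ m) * gauge m (S.envelopeProd T x)
    + 2 * |S.comp s A none 0 x| ^ p + 2 * |√(Y x)| ^ q with hD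
  have iD : Integrable D S.mu :=
    (((integrable_gauge_envelopeProd hS hT3 T m).const_mul _).add (iF.const_mul 2)).add
      (iG.const_mul 2)
  have hBD : ∀ n x, (B n).b (X x) (Y x) ≤ D x := by
    intro n x
    have h1 := sum_sq_le (s := s) (A := A) (u := fun n => S.comp s A n 0 x)
      fun n => abs_field_le (fun k hk => forall_mem_image_univ hk) le_rfl x
    have h2 : X x + Y x ≤ K * S.envelopeProd T x ^ 2 := h1
    have h3 := one_add_mul_pow_le m hK (envelopeProd_nonneg (S := S) (T := T) x)
    have hX0 := hX0 x
    have hY0 := hY0 x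
    have h4 : C * (1 + X x + Y x) ^ m * (X x + Y x) ≤
        C * (1 + K * S.envelopeProd T x ^ 2) ^ m * (K * S.envelopeProd T x ^ 2) := by
      rw [add_assoc]
      gcongr
    have h5 : C * (1 + K * S.envelopeProd T x ^ 2) ^ m * (K * S.envelopeProd T x ^ 2) ≤
        C * K * ((1 + K) ^ m * 2 ^ m) * gauge m (S.envelopeProd T x) := by
      calc _ = C * K * ((1 + K * S.envelopeProd T x ^ 2) ^ m * S.envelopeProd T x ^ 2) := by ring
        _ ≤ C * K * ((1 + K) ^ m * 2 ^ m * gauge m (S.envelopeProd T x)) := by gcongr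
        _ = _ := by ring
    have h6 := hdom n hX0 hY0
    rw [hXp, hYq] at h6
    rw [hD]
    linarith
  have hconv : Tendsto (fun n => ∫ x, S.bVal (B n) s A 0 x ∂S.mu) atTop
      (𝓝 (∫ x, b (X x) (Y x) ∂S.mu)) := by
    refine tendsto_integral_of_dominated_convergence D
      (fun n => (integrable_bVal hS hT3 le_rfl).aestronglyMeasurable) iD
      (fun n => ae_of_all _ fun x => ?_) (ae_of_all _ fun x => (hlim (hX0 x) (hY0 x)).1)
    rw [Real.norm_of_nonneg (bVal_nonneg 0 x)]
    exact hBD n x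
  have hle : ∫ x, b (X x) (Y x) ∂S.mu ≤
      ∫ x, 9 / 8 * (|S.comp s A none 0 x| ^ p + |√(Y x)| ^ q) ∂S.mu := by
    refine integral_mono_of_nonneg (ae_of_all _ fun x => ?_) ((iF.add iG).const_mul _)
      (ae_of_all _ fun x => ?_)
    · exact ge_of_tendsto' (hlim (hX0 x) (hY0 x)).1 fun n => bVal_nonneg (B := B n) 0 x
    · have := (hlim (hX0 x) (hY0 x)).2
      rwa [hXp, hYq] at this
  exact ge_of_tendsto' (((ENNReal.continuous_ofReal.tendsto _).comp hconv)) (fun n =>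
    lintegral_starNorm_mul_le hS hA1 hA2 hT2 hT3 hc0.le (B n)) |>.trans
    (ENNReal.ofReal_le_ofReal hle)

theorem starNorm_const_mul {N : ℕ} (α : ℝ) (F : Fin N → ℝ → (Fin d → ℝ) → ℝ) (x : Fin d → ℝ)
    (t : ℝ) : S.starNorm (fun n t x => α * F n t x) x t = |α| * S.starNorm F x t := by
  unfold starNorm dOp partialX
  rw [← Real.sqrt_sq_eq_abs, ← Real.sqrt_mul (sq_nonneg α)]
  congr 1
  simp only [deriv_const_mul_field, mul_pow, mul_add, Finset.mul_sum]
  congr 1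
  · congr 1
    exact Finset.sum_congr rfl fun _ _ => by ring
  · exact Finset.sum_congr rfl fun _ _ => Finset.sum_congr rfl fun _ _ => by ring

theorem comp_const_mul (α : Option (Fin d) → ℝ) (n : Option (Fin d)) :
    S.comp s (fun n k => α n * A n k) n = fun t x => α n * S.comp s A n t x := by
  funext t x
  simp only [comp, field, Finset.mul_sum]
  exact Finset.sum_congr rfl fun _ _ => by ring

/-- The bilinear embedding for finite expansions. The product of the norms is obtained from the sum
of their powers by homogeneity. -/
theorem lintegral_starNorm_mul_starNorm_le (hS : S.Standing) (hA1 : S.A1) (hA2 : S.A2)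
    (hT2 : S.T2) (hT3 : S.T3) {p q : ℝ} (hp : 1 < p) (hpq : 1 / p + 1 / q = 1)
    (s : Finset (Fin d → ℕ)) (A : Option (Fin d) → (Fin d → ℕ) → ℝ) :
    ∫⁻ t in Set.Ioi (0 : ℝ), ∫⁻ x,
        ENNReal.ofReal (S.starNorm (fun _ : Fin 1 => S.comp s A none) x t *
          S.starNorm (fun i : Fin d => S.comp s A (some i)) x t * t) ∂S.mu ≤
      ENNReal.ofReal (6 * (max p (p / (p - 1)) - 1)) *
        eLpNorm (S.comp s A none 0) (ENNReal.ofReal p) S.mu *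
        eLpNorm (fun x => √(∑ i, S.comp s A (some i) 0 x ^ 2)) (ENNReal.ofReal q) S.mu := by
  obtain ⟨c, hc, hc0, H⟩ := exists_lintegral_starNorm_mul_le hS hA1 hA2 hT2 hT3 hp hpq
  have hq := one_lt_of_conj hp hpq
  have hmF : MemLp (S.comp s A none 0) (ENNReal.ofReal p) S.mu :=
    memLp_comp hT3 none 0 (by simpa using hp.le) ENNReal.ofReal_ne_top
  have hmG : MemLp (fun x => √(∑ i, S.comp s A (some i) 0 x ^ 2)) (ENNReal.ofReal q) S.mu :=
    memLp_sqrt_sum_sq fun i =>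
      memLp_comp hT3 (some i) 0 (by simpa using hq.le) ENNReal.ofReal_ne_top
  set I := ∫⁻ t in Set.Ioi (0 : ℝ), ∫⁻ x,
        ENNReal.ofReal (S.starNorm (fun _ : Fin 1 => S.comp s A none) x t *
          S.starNorm (fun i : Fin d => S.comp s A (some i)) x t * t) ∂S.mu with hI
  set a := (eLpNorm (S.comp s A none 0) (ENNReal.ofReal p) S.mu).toReal with ha
  set b := (eLpNorm (fun x => √(∑ i, S.comp s A (some i) 0 x ^ 2))
    (ENNReal.ofReal q) S.mu).toReal with hb
  have ha0 : 0 ≤ a := ENNReal.toReal_nonneg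
  have hb0 : 0 ≤ b := ENNReal.toReal_nonneg
  have key : ∀ η > 0, I ≤ ENNReal.ofReal (9 / (8 * c) * ((a + η) * (b + η))) := by
    intro η hη
    set α := (a + η)⁻¹ with hα
    set β := (b + η)⁻¹ with hβ
    have hα0 : 0 < α := by positivity
    have hβ0 : 0 < β := by positivity
    have h1 := H s fun n k => (n.elim α fun _ => β) * A n k
    simp only [comp_const_mul (fun n : Option (Fin d) => n.elim α fun _ => β), Option.elim_none,
      Option.elim_some, starNorm_const_mul] at h1
    have e1 : ∀ x t, ENNReal.ofReal (2 * c * (|α| * S.starNorm (fun _ : Fin 1 => S.comp s A none) x t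
          * (|β| * S.starNorm (fun i : Fin d => S.comp s A (some i)) x t)) * t) =
        ENNReal.ofReal (2 * c * α * β) *
          ENNReal.ofReal (S.starNorm (fun _ : Fin 1 => S.comp s A none) x t *
          S.starNorm (fun i : Fin d => S.comp s A (some i)) x t * t) := fun x t => by
      rw [← ENNReal.ofReal_mul (by positivity), abs_of_pos hα0, abs_of_pos hβ0]
      congr 1; ring
    have e2 : (eLpNorm (fun x => α * S.comp s A none 0 x) (ENNReal.ofReal p) S.mu).toReal
        = α * a := by
      have := eLpNorm_const_smul (p := ENNReal.ofReal p) (μ := S.mu) α (S.comp s A none 0)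
      rw [show (fun x => α * S.comp s A none 0 x) = α • S.comp s A none 0 from rfl, this,
        ENNReal.toReal_mul, toReal_enorm, Real.norm_of_nonneg hα0.le]
    have e3 : (eLpNorm (fun x => √(∑ i, (β * S.comp s A (some i) 0 x) ^ 2))
        (ENNReal.ofReal q) S.mu).toReal = β * b := by
      have := eLpNorm_const_smul (p := ENNReal.ofReal q) (μ := S.mu) β
        (fun x => √(∑ i, S.comp s A (some i) 0 x ^ 2))
      have e : (fun x => √(∑ i, (β * S.comp s A (some i) 0 x) ^ 2)) =
          β • fun x => √(∑ i, S.comp s A (some i) 0 x ^ 2) := by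
        funext x
        simp only [mul_pow, ← Finset.mul_sum, Pi.smul_apply, smul_eq_mul]
        rw [Real.sqrt_mul (sq_nonneg _), Real.sqrt_sq hβ0.le]
      rw [e, this, ENNReal.toReal_mul, toReal_enorm, Real.norm_of_nonneg hβ0.le]
    rw [e2, e3] at h1
    simp only [e1] at h1
    have e4 : ∀ t, ∫⁻ x, ENNReal.ofReal (2 * c * α * β) *
          ENNReal.ofReal (S.starNorm (fun _ : Fin 1 => S.comp s A none) x t *
          S.starNorm (fun i : Fin d => S.comp s A (some i)) x t * t) ∂S.mu =
        ENNReal.ofReal (2 * c * α * β) * ∫⁻ x,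
          ENNReal.ofReal (S.starNorm (fun _ : Fin 1 => S.comp s A none) x t *
          S.starNorm (fun i : Fin d => S.comp s A (some i)) x t * t) ∂S.mu := fun t =>
      lintegral_const_mul' _ _ ENNReal.ofReal_ne_top
    simp only [e4] at h1
    rw [lintegral_const_mul' _ _ ENNReal.ofReal_ne_top, ← hI] at h1
    have hαa : (α * a) ^ p ≤ 1 := Real.rpow_le_one (by positivity)
      (by rw [hα, inv_mul_le_iff₀ (by positivity)]; linarith) (by linarith)
    have hβb : (β * b) ^ q ≤ 1 := Real.rpow_le_one (by positivity)
      (by rw [hβ, inv_mul_le_iff₀ (by positivity)]; linarith) (by linarith)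
    have h2 : ENNReal.ofReal (2 * c * α * β) * I ≤ ENNReal.ofReal (9 / 4) :=
      h1.trans (ENNReal.ofReal_le_ofReal (by linarith))
    have hx : 0 < 2 * c * α * β := by positivity
    calc I = ENNReal.ofReal (2 * c * α * β)⁻¹ * (ENNReal.ofReal (2 * c * α * β) * I) := by
          rw [← mul_assoc, ← ENNReal.ofReal_mul (by positivity), inv_mul_cancel₀ hx.ne',
            ENNReal.ofReal_one, one_mul]
      _ ≤ ENNReal.ofReal (2 * c * α * β)⁻¹ * ENNReal.ofReal (9 / 4) := by gcongr
      _ = _ := by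
          rw [← ENNReal.ofReal_mul (by positivity)]
          congr 1
          rw [hα, hβ]
          field_simp
          norm_num
  have hlim : Tendsto (fun η : ℝ => ENNReal.ofReal (9 / (8 * c) * ((a + η) * (b + η)))) (𝓝[>] 0)
      (𝓝 (ENNReal.ofReal (9 / (8 * c) * (a * b)))) := by
    have : Continuous fun η : ℝ => ENNReal.ofReal (9 / (8 * c) * ((a + η) * (b + η))) :=
      ENNReal.continuous_ofReal.comp (by fun_prop)
    simpa using (this.tendsto 0).mono_left nhdsWithin_le_nhds
  have hP : 0 < max p (p / (p - 1)) - 1 := by linarith [le_max_left p (p / (p - 1))]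
  have hcP : 9 / (8 * c) = 9 / 2 * (max p (p / (p - 1)) - 1) := by
    field_simp
    linear_combination -2 * hc
  calc I ≤ ENNReal.ofReal (9 / (8 * c) * (a * b)) :=
        ge_of_tendsto hlim (eventually_nhdsWithin_of_forall key)
    _ ≤ ENNReal.ofReal (6 * (max p (p / (p - 1)) - 1) * a * b) := by
        refine ENNReal.ofReal_le_ofReal ?_
        rw [hcP]
        have := mul_nonneg hP.le (mul_nonneg ha0 hb0)
        nlinarith
    _ = _ := by
        rw [ENNReal.ofReal_mul (by positivity), ENNReal.ofReal_mul (by positivity), ha, hb,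
          ENNReal.ofReal_toReal hmF.eLpNorm_ne_top, ENNReal.ofReal_toReal hmG.eLpNorm_ne_top]

end OrthExpansion

/-! ### Orthogonality and the semigroups on finite expansions -/

namespace OrthExpansion

variable {d : ℕ} {S : OrthExpansion d}

theorem integral_mode1_mul_mode1_of_ne (hS : S.Standing) (hT1 : S.T1) (i : Fin d) (ψ : Bool)
    {k m : ℕ} (hkm : k ≠ m) : ∫ y, S.mode1 i ψ k y * S.mode1 i ψ m y ∂(S.mu1 i) = 0 := by
  have h0 : ∫ y, S.phi1 i k y * S.phi1 i m y ∂(S.mu1 i) = 0 := by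
    rw [integral_phi1_mul_phi1 hS, if_neg hkm]
  cases ψ with
  | false => exact h0
  | true =>
    change ∫ y, S.delta1 i (S.phi1 i k) y * S.delta1 i (S.phi1 i m) y ∂(S.mu1 i) = 0
    have hX : ∀ᵐ y ∂(S.mu1 i), y ∈ S.X1 i := (withDensity_absolutelyContinuous _ _).ae_le
      (ae_restrict_mem (S.isOpen_X1 i).measurableSet)
    have h1 : ∀ᵐ y ∂(S.mu1 i), S.delta1Adj i (S.delta1 i (S.phi1 i k)) y * S.phi1 i m y =
        (S.ev i k - S.a i) * (S.phi1 i k y * S.phi1 i m y) := by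
      filter_upwards [hX] with y hy
      have := hS.phi_eigen i k y hy
      unfold L1 at this
      linear_combination S.phi1 i m y * this
    rw [hT1, integral_congr_ae h1, integral_const_mul, h0, mul_zero]

theorem integral_modeProd_mul_modeProd (σ : Fin d → Bool) (k m : Fin d → ℕ) :
    ∫ x, S.modeProd σ k x * S.modeProd σ m x ∂S.mu =
      ∏ j, ∫ y, S.mode1 j (σ j) (k j) y * S.mode1 j (σ j) (m j) y ∂(S.mu1 j) := by
  unfold modeProd
  simp only [← Finset.prod_mul_distrib]
  exact integral_fintype_prod_eq_prod fun j y =>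
    S.mode1 j (σ j) (k j) y * S.mode1 j (σ j) (m j) y

theorem integral_modeProd_mul_modeProd_of_ne (hS : S.Standing) (hT1 : S.T1) (σ : Fin d → Bool)
    {k m : Fin d → ℕ} (hkm : k ≠ m) :
    ∫ x, S.modeProd σ k x * S.modeProd σ m x ∂S.mu = 0 := by
  obtain ⟨j, hj⟩ := Function.ne_iff.1 hkm
  rw [integral_modeProd_mul_modeProd]
  exact Finset.prod_eq_zero (Finset.mem_univ j) (integral_mode1_mul_mode1_of_ne hS hT1 j _ hj)

theorem integral_phi_mul_phi (hS : S.Standing) (k : Fin d → ℕ) :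
    ∫ x, S.phi k x * S.phi k x ∂S.mu = 1 := by
  rw [← modeProd_slot_none, integral_modeProd_mul_modeProd]
  refine Finset.prod_eq_one fun j _ => ?_
  have := integral_phi1_mul_phi1 hS j (k j) (k j)
  rw [if_pos rfl] at this
  simpa [slot, mode1] using this

variable {s : Finset (Fin d → ℕ)}

/-- The Fourier coefficients of a finite expansion. -/
theorem integral_sum_mul_modeProd (hS : S.Standing) (hT1 : S.T1) (hT3 : S.T3)
    (n : Option (Fin d)) (a : (Fin d → ℕ) → ℝ) (m : Fin d → ℕ) :
    ∫ x, (∑ k ∈ s, a k * S.modeProd (slot n) k x) * S.modeProd (slot n) m x ∂S.mu =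
      if m ∈ s then a m * ∫ x, S.modeProd (slot n) m x * S.modeProd (slot n) m x ∂S.mu else 0 := by
  have h2 : ∀ k, MemLp (S.modeProd (slot n) k) 2 S.mu := fun k =>
    memLp_modeProd hT3 n k (by norm_num) (by norm_num)
  simp only [Finset.sum_mul, mul_assoc]
  have h3 : ∀ k ∈ s, Integrable (fun x => a k * (S.modeProd (slot n) k x * S.modeProd (slot n) m x))
      S.mu := fun k _ => ((h2 k).integrable_mul (h2 m)).const_mul (a k)
  rw [integral_finsetSum _ h3]
  simp only [integral_const_mul]
  split_ifs with hm
  · exact Finset.sum_eq_single_of_mem m hm fun k _ hk => by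
      rw [integral_modeProd_mul_modeProd_of_ne hS hT1 _ hk, mul_zero]
  · refine Finset.sum_eq_zero fun k hk => ?_
    rw [integral_modeProd_mul_modeProd_of_ne hS hT1 _ (by rintro rfl; exact hm hk), mul_zero]

theorem integral_sum_mul_phi (hS : S.Standing) (hT1 : S.T1) (hT3 : S.T3)
    (a : (Fin d → ℕ) → ℝ) (m : Fin d → ℕ) :
    ∫ x, (∑ k ∈ s, a k * S.phi k x) * S.phi m x ∂S.mu = if m ∈ s then a m else 0 := by
  have h := integral_sum_mul_modeProd (s := s) hS hT1 hT3 none a m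
  rwa [modeProd_slot_none, integral_phi_mul_phi hS, mul_one] at h

/-- The normalization of `δ_i φ_k`: its coefficient `c^i_k` is either its inverse norm, or the
function vanishes almost everywhere. -/
theorem c_sq_mul_integral (hT3 : S.T3) (i : Fin d) (k : Fin d → ℕ) :
    S.c i k ^ 2 * ∫ x, S.modeProd (slot (some i)) k x * S.modeProd (slot (some i)) k x ∂S.mu = 1 ∨
      S.modeProd (slot (some i)) k =ᵐ[S.mu] 0 := by
  have h2 : MemLp (S.modeProd (slot (some i)) k) 2 S.mu :=
    memLp_modeProd hT3 _ k (by norm_num) (by norm_num)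
  set N := ∫ x, S.modeProd (slot (some i)) k x * S.modeProd (slot (some i)) k x ∂S.mu with hN
  have hN0 : 0 ≤ N := integral_nonneg fun x => mul_self_nonneg _
  have e : (eLpNorm (S.modeProd (slot (some i)) k) 2 S.mu).toReal = √N := by
    rw [h2.eLpNorm_eq_integral_rpow_norm (by norm_num) (by norm_num),
      ENNReal.toReal_ofReal (by positivity), Real.sqrt_eq_rpow, hN]
    congr 1
    · refine integral_congr_ae (ae_of_all _ fun x => ?_)
      simp [sq]
    · norm_num
  by_cases h : eLpNorm (S.modeProd (slot (some i)) k) 2 S.mu = 0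
  · exact Or.inr ((eLpNorm_eq_zero_iff h2.aestronglyMeasurable (by norm_num)).1 h)
  · left
    have h3 : 0 < √N := by
      rw [← e]; exact ENNReal.toReal_pos h h2.eLpNorm_ne_top
    unfold c
    rw [← modeProd_slot_some, e, inv_pow, Real.sq_sqrt hN0]
    exact inv_mul_cancel₀ (Real.sqrt_pos.1 h3).ne'

/-- Elements of the linear span of a family, as finite sums over a set of indices containing a given
one. -/
theorem exists_sum_of_mem_span {ι : Type*} {v : ι → (Fin d → ℝ) → ℝ} {f : (Fin d → ℝ) → ℝ}
    (hf : f ∈ Submodule.span ℝ (Set.range v)) : ∃ (s : Finset ι) (a : ι → ℝ),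
      ∀ s', s ⊆ s' → f = fun x => ∑ k ∈ s', a k * v k x := by
  obtain ⟨l, rfl⟩ := (Finsupp.mem_span_range_iff_exists_finsupp).1 hf
  refine ⟨l.support, l, fun s' hs' => ?_⟩
  funext x
  rw [Finsupp.sum_of_support_subset l hs' _ (by simp)]
  simp

open Classical in
/-- The projection `Π` of a finite expansion removes the indices outside `ℕ^d_Λ`. -/
theorem proj_sum (hS : S.Standing) (hT1 : S.T1) (hT3 : S.T3) (a : (Fin d → ℕ) → ℝ) :
    S.proj (fun x => ∑ k ∈ s, a k * S.phi k x) =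
      fun x => ∑ k ∈ s, (if k ∈ S.indexSet then a k else 0) * S.phi k x := by
  funext x
  unfold proj
  simp only [integral_sum_mul_phi hS hT1 hT3]
  rw [tsum_subtype S.indexSet fun k => (if k ∈ s then a k else 0) * S.phi k x,
    tsum_eq_sum (s := s)]
  · refine Finset.sum_congr rfl fun k hk => ?_
    simp [Set.indicator_apply, hk]
  · intro k hk
    simp [Set.indicator_apply, hk]

/-- `P_t` maps a finite expansion to its Poisson extension. -/
theorem P_sum (hS : S.Standing) (hT1 : S.T1) (hT3 : S.T3) (a : (Fin d → ℕ) → ℝ) (t : ℝ) :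
    S.P t (fun x => ∑ k ∈ s, a k * S.phi k x) = S.field s (slot none) a t := by
  funext x
  unfold P field
  simp only [integral_sum_mul_phi hS hT1 hT3, modeProd_slot_none]
  rw [tsum_eq_sum (s := s) fun k hk => by simp [hk]]
  refine Finset.sum_congr rfl fun k hk => ?_
  rw [if_pos hk]
  ring

/-- `Q_t^i` maps a finite expansion to a Poisson extension; the factor `c² ‖δ_i φ_k‖²` is `1` or `0`.
-/
theorem Q_sum (hS : S.Standing) (hT1 : S.T1) (hT3 : S.T3) (i : Fin d) (a : (Fin d → ℕ) → ℝ)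
    (t : ℝ) : S.Q i t (fun x => ∑ k ∈ s, a k * S.delta i (S.phi k) x) =
      S.field s (slot (some i)) (fun k => a k * (S.c i k ^ 2 *
        ∫ x, S.modeProd (slot (some i)) k x * S.modeProd (slot (some i)) k x ∂S.mu)) t := by
  funext x
  have h := fun m => integral_sum_mul_modeProd (s := s) hS hT1 hT3 (some i) a m
  have h' : ∀ m, ∫ y, (∑ k ∈ s, a k * S.delta i (S.phi k) y) *
      (S.c i m * S.delta i (S.phi m) y) ∂S.mu = S.c i m * if m ∈ s then a m *
        ∫ x, S.modeProd (slot (some i)) m x * S.modeProd (slot (some i)) m x ∂S.mu else 0 := by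
    intro m
    rw [← h, ← integral_const_mul]
    simp only [modeProd_slot_some]
    congr 1
    funext y
    ring
  unfold Q field
  simp only [h']
  simp only [← modeProd_slot_some]
  rw [tsum_eq_sum (s := s) fun k hk => by simp [hk]]
  refine Finset.sum_congr rfl fun k hk => ?_
  rw [if_pos hk]
  ring

theorem field_zero (σ : Fin d → Bool) (a : (Fin d → ℕ) → ℝ) (x : Fin d → ℝ) :
    S.field s σ a 0 x = ∑ k ∈ s, a k * S.modeProd σ k x := by
  simp [field]

/-- `Q_0^i` is the identity on `𝒟_i`, up to modes `δ_i φ_k` that vanish almost everywhere. -/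
theorem Q_zero_sum (hS : S.Standing) (hT1 : S.T1) (hT3 : S.T3) (i : Fin d)
    (a : (Fin d → ℕ) → ℝ) : S.Q i 0 (fun x => ∑ k ∈ s, a k * S.delta i (S.phi k) x) =ᵐ[S.mu]
      fun x => ∑ k ∈ s, a k * S.delta i (S.phi k) x := by
  have h1 : ∀ k : (Fin d → ℕ), ∀ᵐ x ∂S.mu, S.c i k ^ 2 *
      (∫ x, S.modeProd (slot (some i)) k x * S.modeProd (slot (some i)) k x ∂S.mu) *
        S.modeProd (slot (some i)) k x = S.modeProd (slot (some i)) k x := by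
    intro k
    rcases c_sq_mul_integral hT3 i k with h | h
    · exact ae_of_all _ fun x => by rw [h, one_mul]
    · filter_upwards [h] with x hx
      rw [hx]; simp
  filter_upwards [(eventually_all_finset s).2 fun k _ => h1 k] with x hx
  rw [Q_sum hS hT1 hT3, field_zero]
  refine Finset.sum_congr rfl fun k hk => ?_
  rw [mul_assoc, hx k hk, modeProd_slot_some]

end OrthExpansion

theorem theorem3p3 {d : ℕ} (S : OrthExpansion d) (hS : S.Standing)
    (hA1 : S.A1) (hA2 : S.A2) (hT1 : S.T1) (hT2 : S.T2) (hT3 : S.T3)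
    (p q : ℝ) (hp : 1 < p) (hpq : 1 / p + 1 / q = 1)
    (f : (Fin d → ℝ) → ℝ) (hf : f ∈ S.D)
    (g : Fin d → (Fin d → ℝ) → ℝ) (hg : ∀ i, g i ∈ S.Di i) :
    ∫⁻ t in Set.Ioi (0 : ℝ), ∫⁻ x,
        ENNReal.ofReal (S.starNorm (fun _ : Fin 1 => fun t => S.P t (S.proj f)) x t *
          S.starNorm (fun i : Fin d => fun t => S.Q i t (g i)) x t * t) ∂S.mu
      ≤ ENNReal.ofReal (6 * (max p (p / (p - 1)) - 1)) *
          eLpNorm (S.proj f) (ENNReal.ofReal p) S.mu *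
          eLpNorm (fun x => √(∑ i, (g i x) ^ 2)) (ENNReal.ofReal q) S.mu := by
  classical
  obtain ⟨s₀, a, ha⟩ := OrthExpansion.exists_sum_of_mem_span hf
  choose s₁ b hb using fun i => OrthExpansion.exists_sum_of_mem_span (hg i)
  set s := s₀ ∪ Finset.univ.biUnion s₁ with hs
  have hf' := ha s Finset.subset_union_left
  have hg' := fun i => hb i s ((Finset.subset_biUnion_of_mem s₁ (Finset.mem_univ i)).trans
    Finset.subset_union_right)
  have hproj := OrthExpansion.proj_sum (s := s) hS hT1 hT3 a
  rw [← hf'] at hproj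
  set A : Option (Fin d) → (Fin d → ℕ) → ℝ := fun n => n.elim
    (fun k => if k ∈ S.indexSet then a k else 0) (fun i k => b i k * (S.c i k ^ 2 *
        ∫ x, S.modeProd (OrthExpansion.slot (some i)) k x *
          S.modeProd (OrthExpansion.slot (some i)) k x ∂S.mu)) with hA
  have hP : (fun t => S.P t (S.proj f)) = S.comp s A none := by
    funext t
    rw [hproj, OrthExpansion.P_sum hS hT1 hT3]
    rfl
  have hQ : ∀ i, (fun t => S.Q i t (g i)) = S.comp s A (some i) := by
    intro i
    funext t
    rw [hg' i, OrthExpansion.Q_sum hS hT1 hT3]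
    rfl
  have hQ' : (fun i : Fin d => fun t => S.Q i t (g i)) = fun i => S.comp s A (some i) := funext hQ
  have hF0 : S.comp s A none 0 = S.proj f := by
    rw [hproj]
    funext x
    simp only [OrthExpansion.comp, OrthExpansion.field_zero, OrthExpansion.modeProd_slot_none]
    rfl
  have hG0 : (fun x => √(∑ i, S.comp s A (some i) 0 x ^ 2)) =ᵐ[S.mu]
      fun x => √(∑ i, (g i x) ^ 2) := by
    have h1 : ∀ i, ∀ᵐ x ∂S.mu, S.comp s A (some i) 0 x = g i x := by
      intro i
      have h2 := OrthExpansion.Q_zero_sum (s := s) hS hT1 hT3 i (b i)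
      rw [← hg' i] at h2
      rw [← hQ i]
      exact h2
    filter_upwards [eventually_all.2 h1] with x hx
    simp only [hx]
  have key := OrthExpansion.lintegral_starNorm_mul_starNorm_le hS hA1 hA2 hT2 hT3 hp hpq s A
  rw [hF0, eLpNorm_congr_ae hG0] at key
  rw [hP, hQ']
  exact key
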